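/- Fix $n\ge 0$, put $N=2n+1$, and work over the field $\mathbb Q(v)$. \textbf{The algebras.} For $r\ge 0$ let $W$ be the Coxeter group of type $B_r$, realised as the group of permutations of $\{1,\dots,2r+1\}$ commuting with $x\mapsto 2r+2-x$, and let $\mathcal H(B_r)$ be its Hecke algebra over $\mathbb Q(v)$, with basis $T_w$ $(w\in W)$ and $T_s^2=(v^2-1)T_s+v^2$ for simple reflections $s$. Let $\Lambda(n+1,r)=\{\lambda\in\mathbb N^{n+1}:\sum_i\lambda_i=r\}$ and, for $\lambda$ in this set, $\widetilde\lambda=(\lambda_1,\dots,\lambda_n,2\lambda_{n+1}+1,\lambda_n,\dots,\lambda_1)\in\mathbb N^N$. Let $R^\lambda_1,\dots,R^\lambda_N$ be the consecutive intervals of $\{1,\dots,2r+1\}$ of sizes $\widetilde\lambda_1,\dots,\widetilde\lambda_N$, let $W_\lambda\le W$ be the parabolic subgroup stabilising each $R^\lambda_i$, and $x_\lambda=\sum_{w\in W_\lambda}T_w$. The $q$-Schur algebra of type $B$ is $$\mathcal S^\jmath(n,r)_{\mathbb Q(v)}=\operatorname{End}_{\mathcal H(B_r)}\Big(\bigoplus_{\lambda\in\Lambda(n+1,r)}x_\lambda\mathcal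 H(B_r)\Big).$$ For an $N\times N$ matrix $A=(a_{i,j})$ over $\mathbb N$ with $a_{i,j}=a_{N+1-i,N+1-j}$ and entries summing to $2r+1$, let $\lambda,\mu\in\Lambda(n+1,r)$ be such that $\widetilde\lambda,\widetilde\mu$ are its vectors of row sums and column sums, and let $W_\lambda dW_\mu$ be the double coset of all $w\in W$ with $|R^\lambda_i\cap wR^\mu_j|=a_{i,j}$ for all $i,j$. Let $e_A$ be the homomorphism with $e_A(x_\nu)=\delta_{\mu,\nu}\sum_{w\in W_\lambda dW_\mu}T_w$, and $[A]=v^{-\frac12\left(\sum_{i\ge k,\,j<l}a_{i,j}a_{k,l}-\sum_{j<n+1\le i}a_{i,j}\right)}e_A$. \textbf{The elements $A(\mathbf j)$.} Let $\Xi^0$ be the set of $N\times N$ matrices $A$ over $\mathbb N$ with zero diagonal and $a_{i,j}=a_{N+1-i,N+1-j}$ for all $i,j$; let $|A|$ be the (even) sum of the entries of $A$, and let $\mathrm{ro}(A)$, $\mathrm{co}(A)$ be its vectors of row and column sums. For $A\in\Xi^0$ and $\mathbf j\in\mathbb Z^N$ put $$A(\mathbf j,r)=\sum_{\lambda\in\Lambda(n+1,r-|A|/2)}v^{\sum_i\widetilde\lambda_ij_i}\,[A+\mathrm{diag}(\widetilde\lambda)]\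 \text{ if } |A|\le 2r,\qquad A(\mathbf j,r)=0\ \text{ otherwise,}$$ $$A(\mathbf j)=(A(\mathbf j,r))_{r\ge 0}\in\prod_{r\ge 0}\mathcal S^\jmath(n,r)_{\mathbb Q(v)} .$$ Let $\boldsymbol{\mathfrak A}^\jmath(n)$ be the $\mathbb Q(v)$-span of all $A(\mathbf j)$, $A\in\Xi^0$, $\mathbf j\in\mathbb Z^N$. Write $\mathbf e_i$ for the standard basis of $\mathbb Z^N$, $E_{i,j}$ for the matrix units, $E^\theta_{i,j}=E_{i,j}+E_{N+1-i,N+1-j}$, and $O$ for the zero matrix. \textbf{The multiplication formulas.} For $1\le h\le n$ and $A\in\Xi^0$ put $\alpha_h=\mathbf e_h-\mathbf e_{h+1}$, $\alpha_h^-=-\mathbf e_h-\mathbf e_{h+1}$, $\langle m\rangle=\frac{v^{-2m}-1}{v^{-2}-1}$, $$\beta_p=\sum_{j\ge p}a_{h,j}-\sum_{j>p}a_{h+1,j}+\eta_p,\qquad \beta'_p=\sum_{j\le p}a_{h+1,j}-\sum_{j<p}a_{h,j},$$ where $\eta_p=1$ if $h=n$ and $p\le n$, and $\eta_p=0$ otherwise.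 The formulas are, for all $A\in\Xi^0$, $\mathbf j,\mathbf j'\in\mathbb Z^N$, $1\le h\le n$: \begin{enumerate} \item $O(\mathbf j)A(\mathbf j')=v^{\mathrm{ro}(A)\cdot\mathbf j}A(\mathbf j+\mathbf j')$ and $A(\mathbf j')O(\mathbf j)=v^{\mathrm{co}(A)\cdot\mathbf j}A(\mathbf j+\mathbf j')$; \item $$\begin{aligned}E^\theta_{h,h+1}(\mathbf 0)A(\mathbf j)={}&\sum_{p<h,\ a_{h+1,p}\ge1}v^{\beta_p}\langle a_{h,p}+1\rangle(A+E^\theta_{h,p}-E^\theta_{h+1,p})(\mathbf j+\alpha_h)\\&+\varepsilon\,\frac{v^{\beta_h-j_h-j_{N+1-h}-1}}{1-v^{-2}}\Big((A-E^\theta_{h+1,h})(\mathbf j+\alpha_h)-(A-E^\theta_{h+1,h})(\mathbf j+\alpha_h^-)\Big)\\&+v^{\beta_{h+1}+j_{h+1}+j_{N-h}}\langle a_{h,h+1}+1\rangle(A+E^\theta_{h,h+1})(\mathbf j)\\&+\sum_{p>h+1,\ a_{h+1,p}\ge1}v^{\beta_p}\langle a_{h,p}+1\rangle(A+E^\theta_{h,p}-E^\theta_{h+1,p})(\mathbf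 j),\end{aligned}$$ where $\varepsilon=1$ if $a_{h+1,h}\ge1$, and otherwise $\varepsilon=0$ and the second line is absent; \item $$\begin{aligned}E^\theta_{h+1,h}(\mathbf 0)A(\mathbf j)={}&\sum_{p<h,\ a_{h,p}\ge1}v^{\beta'_p}\langle a_{h+1,p}+1\rangle(A-E^\theta_{h,p}+E^\theta_{h+1,p})(\mathbf j)\\&+v^{\beta'_h+j_h+j_{N+1-h}}\langle a_{h+1,h}+1\rangle(A+E^\theta_{h+1,h})(\mathbf j)\\&+\varepsilon'\,\frac{v^{\beta'_{h+1}-j_{h+1}-j_{N-h}-1}}{1-v^{-2}}\Big(v^{-\delta_{h,n}}(A-E^\theta_{h,h+1})(\mathbf j-\alpha_h)-v^{\delta_{h,n}}(A-E^\theta_{h,h+1})(\mathbf j+\alpha_h^-)\Big)\\&+\sum_{p>h+1,\ a_{h,p}\ge1}v^{\beta'_p}\langle a_{h+1,p}+1\rangle(A-E^\theta_{h,p}+E^\theta_{h+1,p})(\mathbf j-\alpha_h),\end{aligned}$$ where $\varepsilon'=1$ if $a_{h,h+1}\ge1$, and otherwise $\varepsilon'=0$ and the third line is absent. \end{enumerate}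 \textbf{Theorem.} The subspace $\boldsymbol{\mathfrak A}^\jmath(n)$ is a subalgebra of $\prod_{r\ge0}\mathcal S^\jmath(n,r)_{\mathbb Q(v)}$. It is generated, as a unital $\mathbb Q(v)$-algebra, by the elements $E^\theta_{h,h+1}(\mathbf 0)$, $E^\theta_{h+1,h}(\mathbf 0)$ $(1\le h\le n)$ and $O(\pm\mathbf e_i)$ $(1\le i\le n+1)$. It is presented by the multiplication formulas: the elements $A(\mathbf j)$ satisfy (1)--(3), $O(\mathbf 0)=1$, and $A(\mathbf j)=A(\mathbf j')$ whenever $j_i+j_{N+1-i}=j'_i+j'_{N+1-i}$ for all $i$; and for every unital associative $\mathbb Q(v)$-algebra $B$ and every family of elements $b(A,\mathbf j)\in B$ $(A\in\Xi^0,\ \mathbf j\in\mathbb Z^N)$ satisfying the same relations there is a unique algebra homomorphism $\boldsymbol{\mathfrak A}^\jmath(n)\to B$ with $A(\mathbf j)\mapsto b(A,\mathbf j)$ for all $A$ and $\mathbf j$. -/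

import Mathlib

open scoped BigOperators

noncomputable section

namespace TypeB

/-- The field `ℚ(v)`. -/
abbrev Kv : Type := RatFunc ℚ

/-- The indeterminate `v`. -/
def v : Kv := RatFunc.X

/-! ### The Coxeter group of type `B_r` -/

/-- The Coxeter group `W` of type `B_r`: the permutations of `2r+1` points that commute with the
order-reversing involution `θ`. (Indices start at `0`, so `θ(x) = 2r - x`.) -/
abbrev W (r : ℕ) : Type :=
  ↥(Subgroup.centralizer ({Fin.revPerm} : Set (Equiv.Perm (Fin (2 * r + 1)))))

theorem mem_W {r : ℕ} {w : Equiv.Perm (Fin (2 * r + 1))}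
    (h : ∀ x, w x.rev = (w x).rev) :
    w ∈ Subgroup.centralizer ({Fin.revPerm} : Set (Equiv.Perm (Fin (2 * r + 1)))) := by
  rw [Subgroup.mem_centralizer_singleton_iff]
  ext x
  simp [h]

/-- Counting from `0`: for `i + 1 < r` this is `(i, i+1)(2r-i, 2r-i-1)`, and for `i = r - 1` it is
the transposition `(r-1, r+1)` of the two neighbours of the fixed middle point `r`. -/
def simplePerm {r : ℕ} (i : Fin r) : Equiv.Perm (Fin (2 * r + 1)) :=
  if i.val + 1 < r then
    Equiv.swap ⟨i, by omega⟩ ⟨i + 1, by omega⟩ *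
      Equiv.swap (Fin.rev ⟨i, by omega⟩) (Fin.rev ⟨i + 1, by omega⟩)
  else Equiv.swap ⟨i, by omega⟩ (Fin.rev ⟨i, by omega⟩)

theorem simplePerm_rev {r : ℕ} (i : Fin r) (x : Fin (2 * r + 1)) :
    simplePerm i x.rev = (simplePerm i x).rev := by
  have key : ∀ a b y : Fin (2 * r + 1),
      Equiv.swap a.rev b.rev y.rev = (Equiv.swap a b y).rev := by
    intro a b y
    simp only [Equiv.swap_apply_def, Fin.rev_inj]
    split_ifs <;> rfl
  unfold simplePerm
  split_ifs with h
  · set a : Fin (2 * r + 1) := ⟨i, by omega⟩ with ha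
    set b : Fin (2 * r + 1) := ⟨i + 1, by omega⟩ with hb
    have hd : Equiv.Perm.Disjoint (Equiv.swap a b) (Equiv.swap a.rev b.rev) := by
      rw [Equiv.Perm.disjoint_iff_disjoint_support]
      rw [Equiv.Perm.support_swap, Equiv.Perm.support_swap]
      · simp [Finset.disjoint_left, ha, hb, Fin.ext_iff, Fin.val_rev]
        omega
      · simp [ha, hb, Fin.ext_iff, Fin.val_rev]
        omega
      · simp [ha, hb, Fin.ext_iff]
    rw [Equiv.Perm.mul_apply, ← Fin.rev_rev a, ← Fin.rev_rev b, Fin.rev_rev a.rev,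
      Fin.rev_rev b.rev, key, key, Fin.rev_rev, Fin.rev_rev, ← Equiv.Perm.mul_apply,
      hd.commute.eq]
  · have := key ⟨i, by omega⟩ (Fin.rev ⟨i, by omega⟩) x
    rw [Fin.rev_rev, Equiv.swap_comm] at this
    exact this

/-- The simple reflections of `W`. -/
def simple {r : ℕ} (i : Fin r) : W r := ⟨simplePerm i, mem_W (simplePerm_rev i)⟩

/-- The Coxeter length: the least length of a word in the simple reflections representing `w`. -/
def len {r : ℕ} (w : W r) : ℕ :=
  sInf {k | ∃ l : List (Fin r), l.length = k ∧ (l.map simple).prod = w}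

/-! ### The Hecke algebra of type `B_r` over `ℚ(v)` -/

/-- Iwahori's relations between the generators `T_w`, `w ∈ W`. -/
inductive HeckeRel (r : ℕ) : FreeAlgebra Kv (W r) → FreeAlgebra Kv (W r) → Prop
  | one : HeckeRel r (FreeAlgebra.ι Kv 1) 1
  | mul (w w' : W r) (h : len (w * w') = len w + len w') :
      HeckeRel r (FreeAlgebra.ι Kv w * FreeAlgebra.ι Kv w') (FreeAlgebra.ι Kv (w * w'))
  | quad (i : Fin r) :
      HeckeRel r (FreeAlgebra.ι Kv (simple i) * FreeAlgebra.ι Kv (simple i))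
        ((v ^ 2 - 1) • FreeAlgebra.ι Kv (simple i) + (v ^ 2) • 1)

/-- The Hecke algebra `H(B_r)` over `ℚ(v)`, with `T_s ^ 2 = (v ^ 2 - 1) T_s + v ^ 2`. -/
def Hecke (r : ℕ) : Type := RingQuot (HeckeRel r)

instance (r : ℕ) : Ring (Hecke r) := inferInstanceAs (Ring (RingQuot (HeckeRel r)))

instance (r : ℕ) : Algebra Kv (Hecke r) := inferInstanceAs (Algebra Kv (RingQuot (HeckeRel r)))

/-- The element `T_w`. -/
def T {r : ℕ} (w : W r) : Hecke r :=
  (RingQuot.mkAlgHom Kv (HeckeRel r) (FreeAlgebra.ι Kv w) : RingQuot (HeckeRel r))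

/-! ### Compositions, Young subgroups, double cosets -/

/-- `Λ(n+1,r)`. -/
abbrev Comp (n r : ℕ) : Type := {l : Fin (n + 1) → ℕ // ∑ i, l i = r}

/-- `λ ↦ λ̃ = (λ_1, …, λ_n, 2 λ_{n+1} + 1, λ_n, …, λ_1)`. -/
def tilde {n : ℕ} (l : Fin (n + 1) → ℕ) (i : Fin (2 * n + 1)) : ℕ :=
  if i.val = n then 2 * l (Fin.last n) + 1 else l ⟨min i.val (2 * n - i.val), by omega⟩

/-- The block `R_i` of the partition of the `2r+1` points into consecutive intervals of sizes
`λ̃_1, …, λ̃_{2n+1}`. -/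
def block {n : ℕ} (r : ℕ) (l : Fin (n + 1) → ℕ) (i : Fin (2 * n + 1)) :
    Set (Fin (2 * r + 1)) :=
  {x | ∑ k ∈ Finset.Iio i, tilde l k ≤ x.val ∧ x.val < ∑ k ∈ Finset.Iic i, tilde l k}

/-- `N × N` matrices over the natural numbers, `N = 2n+1`. -/
abbrev Mat (n : ℕ) : Type := Matrix (Fin (2 * n + 1)) (Fin (2 * n + 1)) ℕ

/-- The matrix `(|R_i^λ ∩ w R_j^μ|)_{i,j}`, which labels the double coset `W_λ w W_μ`. -/
def cosetMatrix {n r : ℕ} (l m : Comp n r) (w : W r) : Mat n := fun i j =>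
  (block r l.1 i ∩ (w : Equiv.Perm (Fin (2 * r + 1))) '' block r m.1 j).ncard

/-- The parabolic subgroup `W_λ`: the elements of `W` in the Young subgroup of `λ̃`. -/
def parabolic {n r : ℕ} (l : Comp n r) : Set (W r) :=
  {w | ∀ i, (w : Equiv.Perm (Fin (2 * r + 1))) '' block r l.1 i = block r l.1 i}

open Classical in
/-- `x_λ = ∑_{w ∈ W_λ} T_w`. -/
def xElt {n r : ℕ} (l : Comp n r) : Hecke r := ∑ w : W r with w ∈ parabolic l, T w

/-- The right ideal `x_λ H(B_r)`. -/
abbrev xIdeal {n r : ℕ} (l : Comp n r) : Submodule (Hecke r)ᵐᵒᵖ (Hecke r) :=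
  Submodule.span (Hecke r)ᵐᵒᵖ {xElt l}

/-- The right `H(B_r)`-module `⊕_λ x_λ H(B_r)`. -/
abbrev TModule (n r : ℕ) : Type := DirectSum (Comp n r) fun l => ↥(xIdeal l)

instance (n r : ℕ) : AddCommGroup (TModule n r) :=
  @DirectSum.instAddCommGroup _ _ fun _ => Submodule.addCommGroup _

/-- The generator `x_λ` of the summand with index `λ`. -/
def xGen {n r : ℕ} (l : Comp n r) : TModule n r :=
  DirectSum.of (fun l : Comp n r => ↥(xIdeal l)) l
    ⟨xElt l, Submodule.subset_span rfl⟩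

/-! ### The `q`-Schur algebra of type `B` -/

/-- The `q`-Schur algebra of type `B` over `ℚ(v)`; the product is composition. -/
abbrev Schur (n r : ℕ) : Type := Module.End (Hecke r)ᵐᵒᵖ (TModule n r)

open Classical in
/-- `f` is the homomorphism `e_A`: it sends `x_ν` to `∑_{w ∈ W_λ d W_μ} T_w ∈ x_λ H` if `ν = μ` and
to `0` otherwise, where `W_λ d W_μ` is the double coset with matrix `A`. If no element of
`W` has matrix `A` relative to `(λ, ν)`, the sum below is empty; this includes all pairs `(λ, ν)`
for which `λ̃` and `ν̃` are not the row sums and the column sums of `A`. As the `x_ν` generate the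
module, at most one `f` has this property. -/
def IsStd {n r : ℕ} (A : Mat n) (f : Schur n r) : Prop :=
  ∀ l m : Comp n r, ((f (xGen m) l : ↥(xIdeal l)) : Hecke r) =
    ∑ w : W r with cosetMatrix l m w = A, T w

open Classical in
/-- The standard basis element `e_A`. -/
def e {n : ℕ} (r : ℕ) (A : Mat n) : Schur n r :=
  if h : ∃ f : Schur n r, IsStd A f then h.choose else 0

/-- `d(A) - r(A)`. -/
def dimDiff {n : ℕ} (A : Mat n) : ℤ :=
  ((∑ i, ∑ j, ∑ k, ∑ l, if k ≤ i ∧ j < l then (A i j : ℤ) * A k l else 0)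
    - ∑ i, ∑ j, if j.val < n ∧ n ≤ i.val then (A i j : ℤ) else 0) / 2

/-- `[A] = v^{-d(A)+r(A)} e_A`. -/
def brk {n : ℕ} (r : ℕ) (A : Mat n) : Schur n r := v ^ (-dimDiff A) • e r A

/-- The index set of the elements `A(j)`: matrices invariant under the rotation by `180` degrees,
with zero diagonal. -/
def Xi0 (n : ℕ) : Set (Mat n) := {A | (∀ i j, A i.rev j.rev = A i j) ∧ ∀ i, A i i = 0}

/-- `|A|`, the sum of all entries. -/
def tot {n : ℕ} (A : Mat n) : ℕ := ∑ i, ∑ j, A i j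

/-- `A(j,r)`. -/
def stdElt {n : ℕ} (r : ℕ) (A : Mat n) (j : Fin (2 * n + 1) → ℤ) : Schur n r :=
  if tot A ≤ 2 * r then
    ∑ l ∈ Finset.piAntidiag (Finset.univ : Finset (Fin (n + 1))) (r - tot A / 2),
      v ^ (∑ i, (tilde l i : ℤ) * j i) • brk r (A + Matrix.diagonal (tilde l))
  else 0

/-- The direct product of the algebras `S(n,r)`, `r ≥ 0`. -/
abbrev SchurProd (n : ℕ) : Type := ∀ r : ℕ, Schur n r

/-- `A(j) = ∑_r A(j,r)`. -/
def elt {n : ℕ} (A : Mat n) (j : Fin (2 * n + 1) → ℤ) : SchurProd n := fun r => stdElt r A j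

/-- The span of all `A(j)`. -/
def spanA (n : ℕ) : Submodule Kv (SchurProd n) :=
  Submodule.span Kv {x | ∃ A ∈ Xi0 n, ∃ j : Fin (2 * n + 1) → ℤ, x = elt A j}

/-! ### The multiplication formulas -/

/-- `E^θ_{i,j} = E_{i,j} + E_{N+1-i,N+1-j}`. -/
def Eth {n : ℕ} (i j : Fin (2 * n + 1)) : Mat n :=
  Matrix.single i j 1 + Matrix.single i.rev j.rev 1

/-- The row index `h` (`h : Fin n` stands for the number `h.val + 1` in `[1,n]`). -/
def lo {n : ℕ} (h : Fin n) : Fin (2 * n + 1) := ⟨h.val, by omega⟩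

/-- The row index `h + 1`. -/
def hi {n : ℕ} (h : Fin n) : Fin (2 * n + 1) := ⟨h.val + 1, by omega⟩

/-- The index `i ∈ [1,n+1]`. -/
def idx {n : ℕ} (i : Fin (n + 1)) : Fin (2 * n + 1) := ⟨i.val, by omega⟩

/-- `e_i`. -/
def unitVec {n : ℕ} (i : Fin (2 * n + 1)) : Fin (2 * n + 1) → ℤ := Pi.single i 1

/-- `α_h = e_h - e_{h+1}`. -/
def alpha {n : ℕ} (h : Fin n) : Fin (2 * n + 1) → ℤ := unitVec (lo h) - unitVec (hi h)

/-- `α_h^- = -e_h - e_{h+1}`. -/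
def alphaMinus {n : ℕ} (h : Fin n) : Fin (2 * n + 1) → ℤ := -unitVec (lo h) - unitVec (hi h)

/-- `(v^{-2m} - 1) / (v^{-2} - 1)`. -/
def qbar (m : ℕ) : Kv := (v ^ (-2 * (m : ℤ)) - 1) / (v ^ (-2 : ℤ) - 1)

/-- `δ_{h,n}`. -/
def deltaN {n : ℕ} (h : Fin n) : ℤ := if h.val + 1 = n then 1 else 0

/-- `β_p(A,h)`. -/
def beta {n : ℕ} (A : Mat n) (h : Fin n) (p : Fin (2 * n + 1)) : ℤ :=
  ∑ j ∈ Finset.Ici p, (A (lo h) j : ℤ) - ∑ j ∈ Finset.Ioi p, (A (hi h) j : ℤ)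
    + deltaN h * (if p.val < n then 1 else 0)

/-- `β'_p(A,h)`. -/
def beta' {n : ℕ} (A : Mat n) (h : Fin n) (p : Fin (2 * n + 1)) : ℤ :=
  ∑ j ∈ Finset.Iic p, (A (hi h) j : ℤ) - ∑ j ∈ Finset.Iio p, (A (lo h) j : ℤ)

/-- `ro(A) · j`. -/
def rowDot {n : ℕ} (A : Mat n) (j : Fin (2 * n + 1) → ℤ) : ℤ := ∑ i, (∑ k, (A i k : ℤ)) * j i

/-- `co(A) · j`. -/
def colDot {n : ℕ} (A : Mat n) (j : Fin (2 * n + 1) → ℤ) : ℤ := ∑ i, (∑ k, (A k i : ℤ)) * j i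

/-- A family `b(A,j)` in a `ℚ(v)`-algebra `B` obeys the multiplication formulas. Besides the
formulas themselves there are the two conventions on the symbols `A(j)`: `A(j)` depends only on the
sums `j_i + j_{N+1-i}`, and `O(0)` is the identity. Only the values at `A ∈ Xi0 n` matter. -/
structure MultFormulas (n : ℕ) {B : Type*} [Ring B] [Algebra Kv B]
    (b : Mat n → (Fin (2 * n + 1) → ℤ) → B) : Prop where
  symm : ∀ A ∈ Xi0 n, ∀ j j' : Fin (2 * n + 1) → ℤ,
    (∀ i, j i + j i.rev = j' i + j' i.rev) → b A j = b A j'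
  one : b 0 0 = 1
  zero_mul : ∀ A ∈ Xi0 n, ∀ j j' : Fin (2 * n + 1) → ℤ,
    b 0 j * b A j' = v ^ rowDot A j • b A (j + j')
  mul_zero : ∀ A ∈ Xi0 n, ∀ j j' : Fin (2 * n + 1) → ℤ,
    b A j' * b 0 j = v ^ colDot A j • b A (j + j')
  raise : ∀ A ∈ Xi0 n, ∀ (j : Fin (2 * n + 1) → ℤ) (h : Fin n),
    b (Eth (lo h) (hi h)) 0 * b A j =
      (∑ p with p < lo h ∧ 1 ≤ A (hi h) p,
        (v ^ beta A h p * qbar (A (lo h) p + 1)) •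
          b (A + Eth (lo h) p - Eth (hi h) p) (j + alpha h))
      + (if 1 ≤ A (hi h) (lo h) then
          (v ^ (beta A h (lo h) - j (lo h) - j (lo h).rev - 1) / (1 - v ^ (-2 : ℤ))) •
            (b (A - Eth (hi h) (lo h)) (j + alpha h)
              - b (A - Eth (hi h) (lo h)) (j + alphaMinus h))
        else 0)
      + (v ^ (beta A h (hi h) + j (hi h) + j (hi h).rev) * qbar (A (lo h) (hi h) + 1)) •
          b (A + Eth (lo h) (hi h)) j
      + ∑ p with hi h < p ∧ 1 ≤ A (hi h) p,
        (v ^ beta A h p * qbar (A (lo h) p + 1)) •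
          b (A + Eth (lo h) p - Eth (hi h) p) j
  lower : ∀ A ∈ Xi0 n, ∀ (j : Fin (2 * n + 1) → ℤ) (h : Fin n),
    b (Eth (hi h) (lo h)) 0 * b A j =
      (∑ p with p < lo h ∧ 1 ≤ A (lo h) p,
        (v ^ beta' A h p * qbar (A (hi h) p + 1)) •
          b (A + Eth (hi h) p - Eth (lo h) p) j)
      + (v ^ (beta' A h (lo h) + j (lo h) + j (lo h).rev) * qbar (A (hi h) (lo h) + 1)) •
          b (A + Eth (hi h) (lo h)) j
      + (if 1 ≤ A (lo h) (hi h) then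
          (v ^ (beta' A h (hi h) - j (hi h) - j (hi h).rev - 1) / (1 - v ^ (-2 : ℤ))) •
            (v ^ (-deltaN h) • b (A - Eth (lo h) (hi h)) (j - alpha h)
              - v ^ deltaN h • b (A - Eth (lo h) (hi h)) (j + alphaMinus h))
        else 0)
      + ∑ p with hi h < p ∧ 1 ≤ A (lo h) p,
        (v ^ beta' A h p * qbar (A (hi h) p + 1)) •
          b (A + Eth (hi h) p - Eth (lo h) p) (j - alpha h)

/-- The elements `E^θ_{h,h+1}(0)`, `E^θ_{h+1,h}(0)` and `O(±e_i)`. -/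
def gens (n : ℕ) : Set (SchurProd n) :=
  {x | (∃ h : Fin n, x = elt (Eth (lo h) (hi h)) 0 ∨ x = elt (Eth (hi h) (lo h)) 0) ∨
    ∃ i : Fin (n + 1), x = elt 0 (unitVec (idx i)) ∨ x = elt 0 (-unitVec (idx i))}

end TypeB

end

/-!
The theorem rests on three facts: the elements `A(j)` satisfy the multiplication formulas, those
with `j` supported on `[1, n+1]` are linearly independent, and the listed generators produce all of
them.

*Multiplication formulas.* The Hecke algebra acts on functions on `W` by commuting left and right
operators (`Lop_comm_Rop`); this yields coefficients `coef` with respect to the basis `T_w`. As the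
Poincaré polynomials `poinc` of the parabolic subgroups are invertible, a homomorphism `f` is
determined by its entries `ent f λ μ` in the Hecke algebra, composition is a matrix product
(`ent_mul`), and the entries of `e_A` are the double coset sums `dcSum`. An element `w` is read as
a word: position `x`, which lies in block `i` of `λ`, carries as its letter the block of `μ` that
contains `w⁻¹ x`. The coset matrix counts the letters in each row. Multiplication by a generator
moves one letter from row `i` to row `i + 1`, and simultaneously the mirror image of the letter
(`dcSum_mul_dcSum`). All `2n` values of `i` are treated alike: `i ≤ n` gives the formulas for
`E^θ_{h+1,h}(0)`, and, after a reflection of the indices, `i > n` gives those for `E^θ_{h,h+1}(0)`.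
With the normalisation of the basis the exponents no longer involve the row sums (`gen_mul_brk`),
and summation over the diagonal parts `λ̃` gives the formulas (`gen_mul_stdElt`). The two diagonal
letters need care: moving a diagonal letter away lowers `λ_i`, and moving a letter onto the
diagonal raises `λ_{i+1}`, with a quantum integer that depends on `λ_{i+1}` and splits into two
powers of `v`.

*Linear independence.* Every centrally symmetric matrix with the right row and column sums labels a
nonempty double coset (`exists_cosetMatrix_eq`). Hence a coefficient in degree `r = |λ| + |A|/2`
vanishes on all `A'(j)` with `A' ≠ A` and equals `v^{λ̃·j}` on `A(j)` (`exists_coefficient`). For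
varying `λ` these powers are distinct characters of a monoid, so Dedekind's lemma applies
(`linearIndependent_elt`).

*Generation.* By induction on the sum of the squared distances of the letters from the diagonal,
`A(j)` is the leading term of a product of a generator with an element of smaller weight
(`elt_mem_of_lower`).

By the formulas, the span of the `A(j)` is stable under left multiplication by the generators; by
generation, it is the subalgebra which they generate. Given a family `b` with the same relations,
linear independence provides a linear map `F` with `F (A(j)) = b(A, j)`. It satisfies
`F (x y) = F x F y` for generators `x`, since both families obey the same formulas, and the `x` with
this property form a subalgebra (`MultFormulas.map_mul`).
-/

noncomputable section

namespace TypeB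

/-! ### Lengths and descents in the group of type `B` -/

/-- The smaller of the two positions that mark the simple reflection `simple i`. -/
def pa {r : ℕ} (i : Fin r) : Fin (2 * r + 1) := ⟨i, by omega⟩

/-- The larger of the two positions that mark the simple reflection `simple i`. -/
def pb {r : ℕ} (i : Fin r) : Fin (2 * r + 1) :=
  if h : i.val + 1 < r then ⟨i + 1, by omega⟩ else Fin.rev (pa i)

/-- The middle point, which is fixed by every element of `W r`. -/
def ctr (r : ℕ) : Fin (2 * r + 1) := ⟨r, by omega⟩

/-- The map exchanging `a` with `b` and `a.rev` with `b.rev`. -/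
def reflFun {N : ℕ} (a b z : Fin N) : Fin N :=
  if z = a then b else if z = b then a else if z = a.rev then b.rev else
    if z = b.rev then a.rev else z

theorem reflFun_comm {N : ℕ} (a b z : Fin N) : reflFun a b z = reflFun b a z := by
  unfold reflFun
  split_ifs <;> simp_all

theorem reflFun_rev {N : ℕ} (a b z : Fin N) (h : a ≠ a.rev) (h' : b ≠ b.rev) :
    reflFun a.rev b.rev z = reflFun a b z := by
  unfold reflFun
  simp only [Fin.rev_rev]
  split_ifs <;> simp_all

theorem map_rev {r : ℕ} (w : W r) (x : Fin (2 * r + 1)) : w.1 x.rev = (w.1 x).rev := by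
  have h := Subgroup.mem_centralizer_singleton_iff.1 w.2
  have := congrArg (fun f => f x) h
  simpa using this

theorem rev_eq_self {r : ℕ} {x : Fin (2 * r + 1)} : x.rev = x ↔ x = ctr r := by
  simp only [Fin.ext_iff, Fin.val_rev, ctr]
  omega

theorem map_ctr {r : ℕ} (w : W r) : w.1 (ctr r) = ctr r := by
  rw [← rev_eq_self, ← map_rev, rev_eq_self.2 rfl]

theorem map_ne_ctr {r : ℕ} (w : W r) {x : Fin (2 * r + 1)} (h : x ≠ ctr r) : w.1 x ≠ ctr r :=
  fun h' => h (w.1.injective (h'.trans (map_ctr w).symm))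

theorem map_reflFun {r : ℕ} (w : W r) (a b z : Fin (2 * r + 1)) :
    w.1 (reflFun a b z) = reflFun (w.1 a) (w.1 b) (w.1 z) := by
  simp only [reflFun, ← map_rev, EmbeddingLike.apply_eq_iff_eq, apply_ite w.1]

theorem pa_ne_rev {r : ℕ} (i : Fin r) : pa i ≠ (pa i).rev := by
  simp only [pa, ne_eq, Fin.ext_iff, Fin.val_rev]
  omega

theorem val_pb {r : ℕ} (i : Fin r) :
    (pb i).val = if i.val + 1 < r then i.val + 1 else 2 * r - i.val := by
  unfold pb
  split_ifs <;> simp [pa, Fin.val_rev]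

theorem pb_ne_rev {r : ℕ} (i : Fin r) : pb i ≠ (pb i).rev := by
  simp only [ne_eq, Fin.ext_iff, Fin.val_rev, val_pb]
  split_ifs <;> omega

theorem pa_lt_pb {r : ℕ} (i : Fin r) : pa i < pb i := by
  simp only [Fin.lt_def, val_pb, pa]
  split_ifs <;> omega

theorem pa_ne_ctr {r : ℕ} (i : Fin r) : pa i ≠ ctr r := fun h => pa_ne_rev i (rev_eq_self.2 h).symm

theorem pb_ne_ctr {r : ℕ} (i : Fin r) : pb i ≠ ctr r := fun h => pb_ne_rev i (rev_eq_self.2 h).symm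

theorem simple_val {r : ℕ} (i : Fin r) (z : Fin (2 * r + 1)) :
    ((simple i).1 z).val = if i.val + 1 < r then
        if z.val = i.val then i.val + 1 else if z.val = i.val + 1 then i.val else
        if z.val = 2 * r - i.val then 2 * r - (i.val + 1) else
        if z.val = 2 * r - (i.val + 1) then 2 * r - i.val else z.val
      else if z.val = i.val then 2 * r - i.val else if z.val = 2 * r - i.val then i.val
      else z.val := by
  have hz := z.isLt
  have hi := i.isLt
  simp only [simple, simplePerm]
  split_ifs with h <;>
  simp only [Equiv.Perm.mul_apply, Equiv.swap_apply_def, Fin.ext_iff, apply_ite Fin.val,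
    Fin.val_rev] at * <;>
  split_ifs <;> omega

theorem simple_apply {r : ℕ} (i : Fin r) (z : Fin (2 * r + 1)) :
    (simple i).1 z = reflFun (pa i) (pb i) z := by
  have hz := z.isLt
  have hi := i.isLt
  apply Fin.ext
  rw [simple_val]
  simp only [reflFun, Fin.ext_iff, apply_ite Fin.val, val_pb, pa, Fin.val_rev]
  split_ifs <;> omega

theorem simple_pa {r : ℕ} (i : Fin r) : (simple i).1 (pa i) = pb i := by
  simp [simple_apply, reflFun]

theorem simple_pb {r : ℕ} (i : Fin r) : (simple i).1 (pb i) = pa i := by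
  simp [simple_apply, reflFun, (pa_lt_pb i).ne']

theorem W_ext {r : ℕ} {w w' : W r} (h : ∀ x, w.1 x = w'.1 x) : w = w' :=
  Subtype.ext (Equiv.ext h)

theorem simple_mul_self {r : ℕ} (i : Fin r) : simple i * simple i = 1 := by
  apply W_ext
  intro x
  change (simple i).1 ((simple i).1 x) = x
  have := x.isLt
  have := i.isLt
  apply Fin.ext
  simp only [simple_val]
  split_ifs <;> omega

theorem simple_inv {r : ℕ} (i : Fin r) : (simple i)⁻¹ = simple i :=
  inv_eq_of_mul_eq_one_left (simple_mul_self i)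

theorem simple_simple_apply {r : ℕ} (i : Fin r) (x : Fin (2 * r + 1)) :
    (simple i).1 ((simple i).1 x) = x :=
  congrArg (fun w : W r => w.1 x) (simple_mul_self i)

theorem simple_mul_simple_mul {r : ℕ} (i : Fin r) (w : W r) : simple i * (simple i * w) = w := by
  rw [← mul_assoc, simple_mul_self, one_mul]

theorem mul_simple_mul_simple {r : ℕ} (i : Fin r) (w : W r) : w * simple i * simple i = w := by
  rw [mul_assoc, simple_mul_self, mul_one]

/-- Apart from the pair it exchanges and the mirror image of that pair, a simple reflection keeps
the order of any two points different from the middle one. -/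
theorem simple_lt {r : ℕ} (i : Fin r) {x y : Fin (2 * r + 1)} (hxy : x < y) (hx : x ≠ ctr r)
    (hy : y ≠ ctr r) (h1 : ¬(x = pa i ∧ y = pb i)) (h2 : ¬(x = (pb i).rev ∧ y = (pa i).rev)) :
    (simple i).1 x < (simple i).1 y := by
  have := x.isLt
  have := y.isLt
  have := i.isLt
  simp only [Fin.lt_def, Fin.ext_iff, val_pb, pa, Fin.val_rev, ctr, simple_val, ne_eq] at *
  split_ifs at * <;> omega

/-- `i` is not a right descent of `w`. -/
def AscR {r : ℕ} (i : Fin r) (w : W r) : Prop := w.1 (pa i) < w.1 (pb i)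

/-- `i` is not a left descent of `w`. -/
def Asc {r : ℕ} (i : Fin r) (w : W r) : Prop := AscR i w⁻¹

instance {r : ℕ} (i : Fin r) (w : W r) : Decidable (AscR i w) :=
  inferInstanceAs (Decidable (_ < _))

instance {r : ℕ} (i : Fin r) (w : W r) : Decidable (Asc i w) :=
  inferInstanceAs (Decidable (AscR _ _))

theorem not_ascR {r : ℕ} {i : Fin r} {w : W r} : ¬ AscR i w ↔ w.1 (pb i) < w.1 (pa i) := by
  unfold AscR
  rw [not_lt]
  exact ⟨fun h => lt_of_le_of_ne h fun h' => (pa_lt_pb i).ne' (w.1.injective h'), le_of_lt⟩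

theorem ascR_mul_simple {r : ℕ} (i : Fin r) (w : W r) : AscR i (w * simple i) ↔ ¬ AscR i w := by
  rw [not_ascR]
  unfold AscR
  change w.1 ((simple i).1 _) < w.1 ((simple i).1 _) ↔ _
  rw [simple_pa, simple_pb]

theorem asc_simple_mul {r : ℕ} (i : Fin r) (w : W r) : Asc i (simple i * w) ↔ ¬ Asc i w := by
  unfold Asc
  rw [mul_inv_rev, simple_inv, ascR_mul_simple]

theorem simple_lt_iff {r : ℕ} (j : Fin r) {x y : Fin (2 * r + 1)} (hne : x ≠ y) (hx : x ≠ ctr r)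
    (hy : y ≠ ctr r) (h1 : ¬(x = pa j ∧ y = pb j)) (h2 : ¬(x = (pb j).rev ∧ y = (pa j).rev))
    (h3 : ¬(y = pa j ∧ x = pb j)) (h4 : ¬(y = (pb j).rev ∧ x = (pa j).rev)) :
    (simple j).1 x < (simple j).1 y ↔ x < y := by
  rcases lt_or_gt_of_ne hne with h | h
  · exact iff_of_true (simple_lt j h hx hy h1 h2) h
  · exact iff_of_false (simple_lt j h hy hx h3 h4).not_gt h.not_gt

/-- The exchange property in the form used for the commutation of left and right multiplication. -/
theorem ascR_simple_mul {r : ℕ} (i j : Fin r) (w : W r) (h : simple j * w ≠ w * simple i) :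
    AscR i (simple j * w) ↔ AscR i w := by
  have key : reflFun (w.1 (pa i)) (w.1 (pb i)) ≠ reflFun (pa j) (pb j) := by
    intro h'
    apply h
    apply W_ext
    intro z
    change (simple j).1 (w.1 z) = w.1 ((simple i).1 z)
    rw [simple_apply, simple_apply, map_reflFun, h']
  refine simple_lt_iff j (fun h' => (pa_lt_pb i).ne (w.1.injective h')) (map_ne_ctr w (pa_ne_ctr i))
    (map_ne_ctr w (pb_ne_ctr i)) ?_ ?_ ?_ ?_ <;> rintro ⟨h1, h2⟩ <;> apply key <;> rw [h1, h2] <;>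
    funext z
  · rw [reflFun_rev _ _ _ (pb_ne_rev j) (pa_ne_rev j), reflFun_comm]
  · rw [reflFun_comm]
  · rw [reflFun_rev _ _ _ (pa_ne_rev j) (pb_ne_rev j)]

theorem asc_mul_simple {r : ℕ} (i j : Fin r) (w : W r) (h : simple i * w ≠ w * simple j) :
    Asc i (w * simple j) ↔ Asc i w := by
  unfold Asc
  rw [mul_inv_rev, simple_inv]
  apply ascR_simple_mul
  intro h'
  apply h
  have := congrArg (·⁻¹) h'
  simpa [mul_inv_rev, simple_inv] using this.symm

/-- If `w` has no right descent inside the blocks of a symmetric decomposition into intervals (the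
fibres of `c`), then `w` is increasing on each block. -/
theorem lt_of_ascR {r : ℕ} (w : W r) (c : Fin (2 * r + 1) → ℕ) (hc : Monotone c)
    (hrev : ∀ x y, c x = c y → c x.rev = c y.rev)
    (h : ∀ i : Fin r, c (pa i) = c (pb i) → AscR i w)
    {x y : Fin (2 * r + 1)} (hxy : x < y) (hcxy : c x = c y) : w.1 x < w.1 y := by
  have left : ∀ x y : Fin (2 * r + 1), x.val + 1 = y.val → y.val ≤ r → c x = c y →
      w.1 x < w.1 y := by
    intro x y hxy hy hcc
    have hx : x.val < r := by omega
    have hpa : pa ⟨x.val, hx⟩ = x := by simp [pa]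
    rcases hy.lt_or_eq with hy | hy
    · have hpb : pb ⟨x.val, hx⟩ = y := by
        ext
        rw [val_pb]
        simp only
        split_ifs <;> omega
      have := h ⟨x.val, hx⟩ (by rw [hpa, hpb, hcc])
      rwa [AscR, hpa, hpb] at this
    · have hpb : pb ⟨x.val, hx⟩ = x.rev := by
        ext
        rw [val_pb, Fin.val_rev]
        simp only
        split_ifs <;> omega
      have hyc : y = ctr r := Fin.ext hy
      have := h ⟨x.val, hx⟩ (by
        rw [hpa, hpb, hrev x y hcc, hcc, rev_eq_self.2 hyc])
      rw [AscR, hpa, hpb, map_rev] at this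
      rw [hyc, map_ctr]
      simp only [Fin.lt_def, Fin.val_rev, ctr] at this ⊢
      omega
  have step : ∀ x y : Fin (2 * r + 1), x.val + 1 = y.val → c x = c y → w.1 x < w.1 y := by
    intro x y hxy hcc
    rcases le_or_gt y.val r with hy | hy
    · exact left x y hxy hy hcc
    · have := left y.rev x.rev (by simp only [Fin.val_rev]; omega)
        (by simp only [Fin.val_rev]; omega) (hrev _ _ hcc.symm)
      rw [map_rev, map_rev, Fin.rev_lt_rev] at this
      exact this
  obtain ⟨d, hd⟩ : ∃ d, y.val = x.val + d + 1 := ⟨y.val - x.val - 1, by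
    rw [Fin.lt_def] at hxy; omega⟩
  clear hxy
  induction d generalizing y with
  | zero => exact step x y (by omega) hcxy
  | succ d ih =>
    have hlt : x.val + d + 1 < 2 * r + 1 := by omega
    have h1 : c x ≤ c ⟨x.val + d + 1, hlt⟩ := hc (by simp only [Fin.le_def]; omega)
    have h2 : c ⟨x.val + d + 1, hlt⟩ ≤ c y := hc (by simp only [Fin.le_def]; omega)
    exact (ih (y := ⟨x.val + d + 1, hlt⟩) (by omega) rfl).trans
      (step _ y (by rw [hd]; rfl) (by omega))

theorem eq_one_of_ascR {r : ℕ} {w : W r} (h : ∀ i, AscR i w) : w = 1 := by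
  have hm : StrictMono w.1 := fun x y hxy =>
    lt_of_ascR w (fun _ => 0) (fun _ _ _ => le_rfl) (fun _ _ _ => rfl) (fun i _ => h i) hxy rfl
  apply W_ext
  intro x
  have := Subsingleton.elim (hm.orderIsoOfSurjective _ w.1.surjective) (OrderIso.refl _)
  exact congrArg (fun f => f x) this

/-- The weight of a pair of points: zero if the middle point occurs, two for a pair of mirror
images, one otherwise. With these weights every reflection of `W r` has total weight two. -/
def pairWt {r : ℕ} (x y : Fin (2 * r + 1)) : ℤ :=
  if x = ctr r ∨ y = ctr r then 0 else if y = x.rev then 2 else 1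

/-- The weighted number of inversions, which is twice the length. -/
def invCount {r : ℕ} (w : W r) : ℤ :=
  ∑ x, ∑ y, pairWt x y * if x < y ∧ w.1 y < w.1 x then 1 else 0

theorem map_eq_rev_iff {r : ℕ} (w : W r) (x y : Fin (2 * r + 1)) :
    w.1 y = (w.1 x).rev ↔ y = x.rev := by
  rw [← map_rev, EmbeddingLike.apply_eq_iff_eq]

theorem map_eq_ctr_iff {r : ℕ} (w : W r) (x : Fin (2 * r + 1)) :
    w.1 x = ctr r ↔ x = ctr r := by
  rw [← map_ctr w, EmbeddingLike.apply_eq_iff_eq, map_ctr]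

theorem pairWt_map {r : ℕ} (w : W r) (x y : Fin (2 * r + 1)) :
    pairWt (w.1 x) (w.1 y) = pairWt x y := by
  simp only [pairWt, map_eq_rev_iff, map_eq_ctr_iff]

/-- The only pairs of points whose order a simple reflection changes, weighted by `pairWt`, are the
pair it exchanges and the mirror image of that pair. For the last simple reflection these two pairs
coincide, which the weight two accounts for. -/
theorem pairWt_simple_sub {r : ℕ} (i : Fin r) (x y : Fin (2 * r + 1)) :
    pairWt x y * ((if (simple i).1 x < (simple i).1 y then 1 else 0) - if x < y then 1 else 0) =
      (if x = pb i then if y = pa i then 1 else 0 else 0)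
      + (if x = (pa i).rev then if y = (pb i).rev then 1 else 0 else 0)
      - (if x = pa i then if y = pb i then 1 else 0 else 0)
      - (if x = (pb i).rev then if y = (pa i).rev then 1 else 0 else 0) := by
  have ha := pa_ne_rev i
  have hb := pb_ne_rev i
  have hac := pa_ne_ctr i
  have hbc := pb_ne_ctr i
  have hab := pa_lt_pb i
  have hac' : (pa i).rev ≠ ctr r := fun h => ha (by rw [← Fin.rev_rev (pa i), h,
    rev_eq_self.2 rfl, rev_eq_self.2 rfl])
  have hbc' : (pb i).rev ≠ ctr r := fun h => hb (by rw [← Fin.rev_rev (pb i), h,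
    rev_eq_self.2 rfl, rev_eq_self.2 rfl])
  have e1 : (pb i).rev = pa i ↔ pb i = (pa i).rev := by
    rw [← Fin.rev_inj, Fin.rev_rev]
  have e2 : (pa i).rev = pb i ↔ pb i = (pa i).rev := eq_comm
  have e3 : pa i = (pb i).rev ↔ pb i = (pa i).rev := by rw [eq_comm, e1]
  by_cases hne : x = y
  · subst hne
    have : ∀ a b : Fin (2 * r + 1), a ≠ b → (if x = a then if x = b then (1 : ℤ) else 0 else 0) = 0 := by
      intro a b hab; split_ifs <;> simp_all
    rw [this _ _ hab.ne, this _ _ hab.ne', this _ _ (fun h => hab.ne (Fin.rev_inj.1 h)),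
      this _ _ (fun h => hab.ne' (Fin.rev_inj.1 h))]
    simp
  by_cases hx : x = ctr r
  · subst hx
    simp [pairWt, hac.symm, hbc.symm, hac'.symm, hbc'.symm]
  by_cases hy : y = ctr r
  · subst hy
    simp [pairWt, hac.symm, hbc.symm, hac'.symm, hbc'.symm]
  by_cases h1 : x = pa i ∧ y = pb i
  · obtain ⟨rfl, rfl⟩ := h1
    rw [simple_pa, simple_pb]
    by_cases h : pb i = (pa i).rev
    · have hlt : pa i < (pa i).rev := h ▸ hab
      simp [pairWt, hac, hac', hlt, hlt.not_gt, h, ha]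
    · simp [pairWt, hac, hbc, hab, hab.le, hab.ne, h, ha, e3]
  by_cases h2 : y = pa i ∧ x = pb i
  · obtain ⟨rfl, rfl⟩ := h2
    rw [simple_pa, simple_pb]
    by_cases h : pb i = (pa i).rev
    · have hlt : pa i < (pa i).rev := h ▸ hab
      simp [pairWt, hac, hac', hlt, hlt.not_gt, h, ha.symm]
    · simp [pairWt, hac, hbc, hab, hab.le, hab.ne', h, hb, e3]
  by_cases h3 : x = (pb i).rev ∧ y = (pa i).rev
  · obtain ⟨rfl, rfl⟩ := h3
    rw [map_rev, map_rev, simple_pa, simple_pb]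
    by_cases h : pb i = (pa i).rev
    · exact absurd ⟨by rw [h, Fin.rev_rev], h.symm⟩ h1
    · simp [pairWt, hac', hbc', Fin.rev_lt_rev, hab, hab.le, hab.ne', h, e1, hb.symm, e2]
  by_cases h4 : y = (pb i).rev ∧ x = (pa i).rev
  · obtain ⟨rfl, rfl⟩ := h4
    rw [map_rev, map_rev, simple_pa, simple_pb]
    by_cases h : pb i = (pa i).rev
    · exact absurd ⟨by rw [h, Fin.rev_rev], h.symm⟩ h2
    · simp [pairWt, hac', hbc', Fin.rev_lt_rev, hab, hab.le, hab.ne, h, e1, ha.symm, e2]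
  simp only [simple_lt_iff i hne hx hy h1 h3 h2 h4, sub_self, mul_zero, ← ite_and]
  rw [if_neg (fun h => h2 h.symm), if_neg (fun h => h4 h.symm), if_neg h1, if_neg h3]
  simp

theorem invCount_mul_simple {r : ℕ} (i : Fin r) (w : W r) :
    invCount (w * simple i) = invCount w + if AscR i w then 2 else -2 := by
  have h1 : invCount (w * simple i) = ∑ x, ∑ y, pairWt x y *
      if (simple i).1 x < (simple i).1 y ∧ w.1 y < w.1 x then 1 else 0 := by
    unfold invCount
    rw [← Equiv.sum_comp (simple i).1]
    refine Finset.sum_congr rfl fun x _ => ?_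
    rw [← Equiv.sum_comp (simple i).1]
    refine Finset.sum_congr rfl fun y _ => ?_
    rw [pairWt_map]
    have : ∀ z, (w * simple i).1 ((simple i).1 z) = w.1 z := fun z => by
      change w.1 ((simple i).1 ((simple i).1 z)) = _
      rw [simple_simple_apply]
    rw [this, this]
  have h2 : invCount (w * simple i) - invCount w = ∑ x, ∑ y,
      (pairWt x y * ((if (simple i).1 x < (simple i).1 y then 1 else 0) - if x < y then 1 else 0)) *
        if w.1 y < w.1 x then 1 else 0 := by
    rw [h1, invCount, ← Finset.sum_sub_distrib]
    refine Finset.sum_congr rfl fun x _ => ?_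
    rw [← Finset.sum_sub_distrib]
    refine Finset.sum_congr rfl fun y _ => ?_
    simp only [ite_and]
    split_ifs <;> ring
  have h3 : invCount (w * simple i) - invCount w = if AscR i w then 2 else -2 := by
    rw [h2]
    simp only [pairWt_simple_sub, sub_mul, add_mul, ite_mul, one_mul, zero_mul,
      Finset.sum_sub_distrib, Finset.sum_add_distrib, Finset.sum_ite_eq',
      Finset.mem_univ, if_true, Finset.sum_ite_irrel, Finset.sum_const_zero]
    have hn := @not_ascR r i w
    simp only [map_rev, Fin.rev_lt_rev]
    by_cases h : AscR i w
    · rw [if_pos h, if_pos (show w.1 (pa i) < w.1 (pb i) from h), if_neg (fun h' => hn.2 h' h)]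
      norm_num
    · rw [if_neg h, if_neg (show ¬ w.1 (pa i) < w.1 (pb i) from h), if_pos (hn.1 h)]
      norm_num
  linarith

theorem invCount_one (r : ℕ) : invCount (1 : W r) = 0 := by
  unfold invCount
  refine Finset.sum_eq_zero fun x _ => Finset.sum_eq_zero fun y _ => ?_
  rw [if_neg, mul_zero]
  rintro ⟨h, h'⟩
  exact h.not_gt h'

theorem invCount_nonneg {r : ℕ} (w : W r) : 0 ≤ invCount w := by
  refine Finset.sum_nonneg fun x _ => Finset.sum_nonneg fun y _ => ?_
  unfold pairWt
  split_ifs <;> simp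

theorem exists_word {r : ℕ} (w : W r) :
    ∃ l : List (Fin r), 2 * (l.length : ℤ) = invCount w ∧ (l.map simple).prod = w := by
  obtain ⟨k, hk⟩ : ∃ k : ℕ, invCount w ≤ k := ⟨_, Int.self_le_toNat _⟩
  induction k using Nat.strong_induction_on generalizing w with
  | _ k ih =>
    by_cases hw : ∀ i, AscR i w
    · rw [eq_one_of_ascR hw]
      exact ⟨[], by simp [invCount_one], rfl⟩
    · push Not at hw
      obtain ⟨i, hi⟩ := hw
      have h1 := invCount_mul_simple i w
      rw [if_neg hi] at h1
      have h0 := invCount_nonneg (w * simple i)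
      obtain ⟨l, hl, hl'⟩ := ih (k - 2) (by omega) (w * simple i) (by omega)
      refine ⟨l ++ [i], ?_, ?_⟩
      · simp only [List.length_append, List.length_singleton]
        push_cast
        omega
      · simp [hl', mul_simple_mul_simple]

theorem invCount_prod_le {r : ℕ} (l : List (Fin r)) :
    invCount (l.map simple).prod ≤ 2 * l.length := by
  induction l using List.reverseRecOn with
  | nil => simp [invCount_one]
  | append_singleton l i ih =>
    simp only [List.map_append, List.map_cons, List.map_nil, List.prod_append, List.prod_cons,
      List.prod_nil, mul_one, invCount_mul_simple, List.length_append, List.length_cons,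
      List.length_nil]
    push_cast
    split_ifs <;> omega

/-- The length, defined through words in the simple reflections, is half the weighted number of
inversions. -/
theorem two_mul_len {r : ℕ} (w : W r) : 2 * (len w : ℤ) = invCount w := by
  obtain ⟨l, hl, hl'⟩ := exists_word w
  have h1 : len w ≤ l.length := Nat.sInf_le ⟨l, rfl, hl'⟩
  have h2 : len w ∈ {k | ∃ l : List (Fin r), l.length = k ∧ (l.map simple).prod = w} :=
    Nat.sInf_mem ⟨_, l, rfl, hl'⟩
  obtain ⟨l', h3, h4⟩ := h2
  have := invCount_prod_le l'
  rw [h4, h3] at this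
  omega

theorem len_mul_simple {r : ℕ} {i : Fin r} {w : W r} (h : AscR i w) :
    len (w * simple i) = len w + 1 := by
  have := invCount_mul_simple i w
  rw [if_pos h, ← two_mul_len, ← two_mul_len] at this
  omega

theorem len_one (r : ℕ) : len (1 : W r) = 0 := by
  have := two_mul_len (1 : W r)
  rw [invCount_one] at this
  omega

theorem len_inv {r : ℕ} (w : W r) : len w⁻¹ = len w := by
  have key : ∀ w : W r, len w⁻¹ ≤ len w := by
    intro w
    obtain ⟨l, hl, hl'⟩ := exists_word w
    rw [← two_mul_len] at hl
    refine Nat.sInf_le ⟨l.reverse, by rw [List.length_reverse]; omega, ?_⟩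
    rw [← hl', List.prod_inv_reverse, List.map_map, List.map_reverse]
    congr 2
    exact List.map_congr_left fun i _ => (simple_inv i).symm
  refine le_antisymm (key w) ?_
  simpa using key w⁻¹

theorem len_simple_mul {r : ℕ} {i : Fin r} {w : W r} (h : Asc i w) :
    len (simple i * w) = len w + 1 := by
  rw [← len_inv, mul_inv_rev, simple_inv, len_mul_simple h, len_inv]

theorem len_simple_mul_of_not {r : ℕ} {i : Fin r} {w : W r} (h : ¬ Asc i w) :
    len (simple i * w) + 1 = len w := by
  have := len_simple_mul ((asc_simple_mul i w).2 h)
  rw [simple_mul_simple_mul] at this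
  exact this.symm

theorem len_mul_simple_of_not {r : ℕ} {i : Fin r} {w : W r} (h : ¬ AscR i w) :
    len (w * simple i) + 1 = len w := by
  have := len_mul_simple ((ascR_mul_simple i w).2 h)
  rw [mul_simple_mul_simple] at this
  exact this.symm

theorem asc_iff_len {r : ℕ} {i : Fin r} {w : W r} : Asc i w ↔ len w < len (simple i * w) := by
  by_cases h : Asc i w
  · simp [h, len_simple_mul h]
  · have := len_simple_mul_of_not h
    simp only [h, false_iff]
    omega

theorem exists_not_asc {r : ℕ} {w : W r} (h : w ≠ 1) : ∃ i, ¬ Asc i w := by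
  by_contra! h'
  exact h (inv_eq_one.1 (eq_one_of_ascR h'))

/-! ### The regular representation of the Hecke algebra -/

theorem ascR_iff_len {r : ℕ} {i : Fin r} {w : W r} : AscR i w ↔ len w < len (w * simple i) := by
  by_cases h : AscR i w
  · simp [h, len_mul_simple h]
  · have := len_mul_simple_of_not h
    simp only [h, false_iff]
    omega

theorem asc_one {r : ℕ} (i : Fin r) : Asc i 1 := by
  unfold Asc AscR
  rw [inv_one]
  exact pa_lt_pb i

theorem len_simple {r : ℕ} (i : Fin r) : len (simple i) = 1 := by
  have := len_simple_mul (asc_one i)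
  rwa [mul_one, len_one] at this

theorem len_simple_mul_le {r : ℕ} (i : Fin r) (w : W r) : len (simple i * w) ≤ len w + 1 := by
  by_cases h : Asc i w
  · rw [len_simple_mul h]
  · have := len_simple_mul_of_not h
    omega

theorem len_prod_mul_le {r : ℕ} (l : List (Fin r)) (w : W r) :
    len ((l.map simple).prod * w) ≤ l.length + len w := by
  induction l with
  | nil => simp
  | cons i l ih =>
    have := len_simple_mul_le i ((l.map simple).prod * w)
    simp only [List.map_cons, List.prod_cons, List.length_cons, mul_assoc]
    omega

theorem exists_reduced_word {r : ℕ} (w : W r) :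
    ∃ l : List (Fin r), l.length = len w ∧ (l.map simple).prod = w := by
  obtain ⟨l, hl, hl'⟩ := exists_word w
  rw [← two_mul_len] at hl
  exact ⟨l, by omega, hl'⟩

/-- Induction on the length, adding simple reflections on the left. -/
theorem len_induction {r : ℕ} {P : W r → Prop} (h1 : P 1)
    (h : ∀ i w, Asc i w → P w → P (simple i * w)) (w : W r) : P w := by
  obtain ⟨k, hk⟩ : ∃ k, len w = k := ⟨_, rfl⟩
  induction k generalizing w with
  | zero =>
    by_cases hw : w = 1
    · exact hw ▸ h1
    · obtain ⟨i, hi⟩ := exists_not_asc hw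
      have := len_simple_mul_of_not hi
      omega
  | succ k ih =>
    obtain ⟨i, hi⟩ := exists_not_asc (w := w) (by rintro rfl; rw [len_one] at hk; omega)
    have := len_simple_mul_of_not hi
    have := h i _ ((asc_simple_mul i w).2 hi) (ih (simple i * w) (by omega))
    rwa [simple_mul_simple_mul] at this

theorem len_induction_right {r : ℕ} {P : W r → Prop} (h1 : P 1)
    (h : ∀ i w, AscR i w → P w → P (w * simple i)) (w : W r) : P w := by
  have := len_induction (P := fun w => P w⁻¹) (by simpa using h1) (fun i w hi hw => by
    rw [mul_inv_rev, simple_inv]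
    exact h i _ hi hw) w⁻¹
  simpa using this

/-- Left multiplication by `T_s` on coefficient functions, `s = simple i`. -/
def Lop {r : ℕ} (i : Fin r) : Module.End Kv (W r → Kv) where
  toFun f w := if Asc i w then v ^ 2 * f (simple i * w)
    else f (simple i * w) + (v ^ 2 - 1) * f w
  map_add' f g := by
    funext w
    simp only [Pi.add_apply]
    split_ifs <;> ring
  map_smul' c f := by
    funext w
    simp only [Pi.smul_apply, smul_eq_mul, RingHom.id_apply]
    split_ifs <;> ring

theorem Lop_apply {r : ℕ} (i : Fin r) (f : W r → Kv) (w : W r) :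
    Lop i f w = if Asc i w then v ^ 2 * f (simple i * w)
      else f (simple i * w) + (v ^ 2 - 1) * f w := rfl

/-- Right multiplication by `T_s` on coefficient functions, `s = simple i`. -/
def Rop {r : ℕ} (i : Fin r) : Module.End Kv (W r → Kv) where
  toFun f w := if AscR i w then v ^ 2 * f (w * simple i)
    else f (w * simple i) + (v ^ 2 - 1) * f w
  map_add' f g := by
    funext w
    simp only [Pi.add_apply]
    split_ifs <;> ring
  map_smul' c f := by
    funext w
    simp only [Pi.smul_apply, smul_eq_mul, RingHom.id_apply]
    split_ifs <;> ring

theorem Rop_apply {r : ℕ} (i : Fin r) (f : W r → Kv) (w : W r) :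
    Rop i f w = if AscR i w then v ^ 2 * f (w * simple i)
      else f (w * simple i) + (v ^ 2 - 1) * f w := rfl

theorem Lop_mul_self {r : ℕ} (i : Fin r) :
    (Lop i * Lop i : Module.End Kv (W r → Kv)) = (v ^ 2 - 1) • Lop i + (v ^ 2) • 1 := by
  refine LinearMap.ext fun f => funext fun w => ?_
  simp only [Module.End.mul_apply, LinearMap.add_apply, LinearMap.smul_apply, Pi.add_apply,
    Pi.smul_apply, Lop_apply, asc_simple_mul, simple_mul_simple_mul, smul_eq_mul,
    Module.End.one_apply]
  split_ifs <;> ring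

/-- Left and right multiplication by generators commute. This makes the operators `Lw` below well
defined and turns the space of coefficient functions into a module over the Hecke algebra. -/
theorem Lop_comm_Rop {r : ℕ} (i j : Fin r) : Commute (Lop i) (Rop j) := by
  refine LinearMap.ext fun f => funext fun w => ?_
  simp only [Module.End.mul_apply, Lop_apply, Rop_apply]
  by_cases h : simple i * w = w * simple j
  · have e1 : AscR j w ↔ Asc i w := by rw [ascR_iff_len, asc_iff_len, h]
    have e3 : Asc i (w * simple j) ↔ ¬ Asc i w := by rw [← h, asc_simple_mul]
    simp only [← mul_assoc, h, mul_simple_mul_simple, ascR_mul_simple, e1, e3]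
  · simp only [ascR_simple_mul _ _ _ h, asc_mul_simple _ _ _ h, mul_assoc]
    split_ifs <;> ring

theorem Lop_single {r : ℕ} {i : Fin r} {w : W r} (h : Asc i w) :
    Lop i (Pi.single w 1) = Pi.single (simple i * w) 1 := by
  funext y
  rw [Lop_apply]
  simp only [Pi.single_apply]
  have e : simple i * y = w ↔ y = simple i * w :=
    ⟨fun h => by rw [← h, simple_mul_simple_mul], fun h => by rw [h, simple_mul_simple_mul]⟩
  simp only [e]
  by_cases hy : y = simple i * w
  · rw [if_pos hy, hy, if_neg (by rw [asc_simple_mul]; exact not_not.2 h), if_neg]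
    · ring
    · intro h'
      have := len_simple_mul h
      rw [h'] at this
      omega
  · rw [if_neg hy]
    by_cases hyw : y = w
    · rw [hyw, if_pos h, mul_zero]
    · simp [hyw]

theorem Rop_single {r : ℕ} {i : Fin r} {w : W r} (h : AscR i w) :
    Rop i (Pi.single w 1) = Pi.single (w * simple i) 1 := by
  funext y
  rw [Rop_apply]
  simp only [Pi.single_apply]
  have e : y * simple i = w ↔ y = w * simple i :=
    ⟨fun h => by rw [← h, mul_simple_mul_simple], fun h => by rw [h, mul_simple_mul_simple]⟩
  simp only [e]
  by_cases hy : y = w * simple i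
  · rw [if_pos hy, hy, if_neg (by rw [ascR_mul_simple]; exact not_not.2 h), if_neg]
    · ring
    · intro h'
      have := len_mul_simple h
      rw [h'] at this
      omega
  · rw [if_neg hy]
    by_cases hyw : y = w
    · rw [hyw, if_pos h, mul_zero]
    · simp [hyw]

/-- The operator of a word in the simple reflections. -/
def Lword {r : ℕ} (l : List (Fin r)) : Module.End Kv (W r → Kv) := (l.map Lop).prod

theorem Lword_single {r : ℕ} (l : List (Fin r)) (w : W r)
    (h : len ((l.map simple).prod * w) = l.length + len w) :
    Lword l (Pi.single w 1) = Pi.single ((l.map simple).prod * w) 1 := by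
  induction l with
  | nil => simp [Lword]
  | cons i l ih =>
    simp only [List.map_cons, List.prod_cons, List.length_cons, mul_assoc] at h ⊢
    have h1 := len_prod_mul_le l w
    have h2 := len_simple_mul_le i ((l.map simple).prod * w)
    have h3 : Asc i ((l.map simple).prod * w) := by rw [asc_iff_len]; omega
    have : Lword (i :: l) = Lop i * Lword l := by simp [Lword]
    rw [this, Module.End.mul_apply, ih (by omega), Lop_single h3]

theorem Lword_comm_Rop {r : ℕ} (l : List (Fin r)) (j : Fin r) : Commute (Lword l) (Rop j) := by
  apply Commute.list_prod_left
  intro x hx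
  obtain ⟨i, -, rfl⟩ := List.mem_map.1 hx
  exact Lop_comm_Rop i j

/-- An operator that commutes with all right multiplications is determined by its value at the
identity. -/
theorem eq_of_comm_Rop {r : ℕ} {F G : Module.End Kv (W r → Kv)}
    (hF : ∀ j, Commute F (Rop j)) (hG : ∀ j, Commute G (Rop j))
    (h : F (Pi.single 1 1) = G (Pi.single 1 1)) : F = G := by
  have key : ∀ w : W r, F (Pi.single w 1) = G (Pi.single w 1) := by
    intro w
    induction w using len_induction_right with
    | h1 => exact h
    | h i w hi ih =>
      rw [← Rop_single hi]
      have h1 := congrArg (fun e => e (Pi.single w 1)) (hF i).eq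
      have h2 := congrArg (fun e => e (Pi.single w 1)) (hG i).eq
      simp only [Module.End.mul_apply] at h1 h2
      rw [h1, h2, ih]
  refine LinearMap.pi_ext fun w c => ?_
  have : (Pi.single w c : W r → Kv) = c • Pi.single w 1 := by
    rw [← Pi.single_smul, smul_eq_mul, mul_one]
  rw [this, map_smul, map_smul, key]

/-- The operator of `w`, by way of a reduced word. -/
def Lw {r : ℕ} (w : W r) : Module.End Kv (W r → Kv) := Lword (exists_reduced_word w).choose

theorem Lw_single {r : ℕ} (w w' : W r) (h : len (w * w') = len w + len w') :
    Lw w (Pi.single w' 1) = Pi.single (w * w') 1 := by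
  have := (exists_reduced_word w).choose_spec
  rw [Lw, Lword_single _ _ (by rw [this.1, this.2, h]), this.2]

theorem Lw_single_one {r : ℕ} (w : W r) : Lw w (Pi.single 1 1) = Pi.single w 1 := by
  rw [Lw_single _ _ (by simp [len_one]), mul_one]

theorem Lw_comm_Rop {r : ℕ} (w : W r) (j : Fin r) : Commute (Lw w) (Rop j) := Lword_comm_Rop _ _

theorem Lw_simple {r : ℕ} (i : Fin r) : Lw (simple i) = Lop i := by
  refine eq_of_comm_Rop (Lw_comm_Rop _) (Lop_comm_Rop i) ?_
  rw [Lw_single_one, Lop_single (asc_one i), mul_one]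

theorem Lw_rel {r : ℕ} ⦃x y : FreeAlgebra Kv (W r)⦄ (h : HeckeRel r x y) :
    FreeAlgebra.lift Kv Lw x = FreeAlgebra.lift Kv Lw y := by
  induction h with
  | one =>
    rw [FreeAlgebra.lift_ι_apply, map_one]
    refine eq_of_comm_Rop (Lw_comm_Rop _) (fun j => Commute.one_left _) ?_
    rw [Lw_single_one, Module.End.one_apply]
  | mul w w' h =>
    rw [map_mul, FreeAlgebra.lift_ι_apply, FreeAlgebra.lift_ι_apply, FreeAlgebra.lift_ι_apply]
    refine eq_of_comm_Rop (fun j => (Lw_comm_Rop _ j).mul_left (Lw_comm_Rop _ j))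
      (Lw_comm_Rop _) ?_
    rw [Module.End.mul_apply, Lw_single_one, Lw_single _ _ h, Lw_single_one]
  | quad i =>
    simp only [map_mul, map_add, map_smul, map_one, FreeAlgebra.lift_ι_apply, Lw_simple,
      Lop_mul_self]

/-- The action of the Hecke algebra on coefficient functions by left multiplication. -/
def rho (r : ℕ) : Hecke r →ₐ[Kv] Module.End Kv (W r → Kv) :=
  RingQuot.liftAlgHom Kv ⟨FreeAlgebra.lift Kv Lw, Lw_rel⟩

theorem rho_T {r : ℕ} (w : W r) : rho r (T w) = Lw w :=
  (RingQuot.liftAlgHom_mkAlgHom_apply Kv _ Lw_rel _).trans (FreeAlgebra.lift_ι_apply _ _)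

theorem T_one (r : ℕ) : T (1 : W r) = 1 := by
  have := RingQuot.mkAlgHom_rel Kv (HeckeRel.one (r := r))
  rwa [map_one] at this

theorem T_mul {r : ℕ} {w w' : W r} (h : len (w * w') = len w + len w') :
    T w * T w' = T (w * w') := by
  have := RingQuot.mkAlgHom_rel Kv (HeckeRel.mul w w' h)
  rwa [map_mul] at this

theorem T_quad {r : ℕ} (i : Fin r) :
    T (simple i) * T (simple i) = (v ^ 2 - 1) • T (simple i) + (v ^ 2) • 1 := by
  have := RingQuot.mkAlgHom_rel Kv (HeckeRel.quad i)
  rwa [map_mul, map_add, map_smul, map_smul, map_one] at this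

theorem T_simple_mul {r : ℕ} {i : Fin r} {w : W r} (h : Asc i w) :
    T (simple i) * T w = T (simple i * w) :=
  T_mul (by rw [len_simple_mul h, len_simple, add_comm])

theorem T_simple_mul_of_not {r : ℕ} {i : Fin r} {w : W r} (h : ¬ Asc i w) :
    T (simple i) * T w = (v ^ 2 - 1) • T w + (v ^ 2) • T (simple i * w) := by
  have h1 := T_simple_mul ((asc_simple_mul i w).2 h)
  rw [simple_mul_simple_mul] at h1
  rw [← h1, ← mul_assoc, T_quad, add_mul, smul_mul_assoc, smul_mul_assoc, one_mul]

theorem span_T (r : ℕ) : Submodule.span Kv (Set.range (T (r := r))) = ⊤ := by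
  set S := Submodule.span Kv (Set.range (T (r := r))) with hS
  have h1 : ∀ (i : Fin r), ∀ y ∈ S, T (simple i) * y ∈ S := by
    intro i y hy
    induction hy using Submodule.span_induction with
    | mem x hx =>
      obtain ⟨w, rfl⟩ := hx
      by_cases h : Asc i w
      · rw [T_simple_mul h]
        exact Submodule.subset_span ⟨_, rfl⟩
      · rw [T_simple_mul_of_not h]
        exact add_mem (Submodule.smul_mem _ _ (Submodule.subset_span ⟨_, rfl⟩))
          (Submodule.smul_mem _ _ (Submodule.subset_span ⟨_, rfl⟩))
    | zero => rw [mul_zero]; exact zero_mem _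
    | add x y _ _ hx hy => rw [mul_add]; exact add_mem hx hy
    | smul c x _ hx => rw [mul_smul_comm]; exact Submodule.smul_mem _ _ hx
  have h2 : ∀ (w : W r), ∀ y ∈ S, T w * y ∈ S := by
    intro w
    induction w using len_induction with
    | h1 => intro y hy; rwa [T_one, one_mul]
    | h i w hi ih =>
      intro y hy
      rw [← T_simple_mul hi, mul_assoc]
      exact h1 i _ (ih y hy)
  let π : FreeAlgebra Kv (W r) →ₐ[Kv] Hecke r := RingQuot.mkAlgHom Kv (HeckeRel r)
  have h3 : ∀ (x : FreeAlgebra Kv (W r)), ∀ y ∈ S, π x * y ∈ S := by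
    intro x
    induction x using FreeAlgebra.induction with
    | grade0 c =>
      intro y hy
      rw [AlgHom.commutes]
      have : (algebraMap Kv (Hecke r) c) * y = c • y := (Algebra.smul_def c y).symm
      rw [this]
      exact Submodule.smul_mem _ _ hy
    | grade1 w => exact h2 w
    | mul a b ha hb =>
      intro y hy
      have := ha _ (hb y hy)
      rw [← mul_assoc] at this
      rwa [map_mul]
    | add a b ha hb =>
      intro y hy
      have := add_mem (ha y hy) (hb y hy)
      rw [← add_mul] at this
      rwa [map_add]
  rw [eq_top_iff]
  intro x _
  obtain ⟨a, rfl⟩ := RingQuot.mkAlgHom_surjective Kv (HeckeRel r) x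
  have := h3 a 1 (by rw [← T_one]; exact Submodule.subset_span ⟨_, rfl⟩)
  rw [mul_one] at this
  exact this

open Classical in
instance (r : ℕ) : Fintype (W r) := inferInstance

theorem exists_eq_sum_T {r : ℕ} (h : Hecke r) : ∃ c : W r → Kv, ∑ w, c w • T w = h := by
  have : h ∈ Submodule.span Kv (Set.range (T (r := r))) := by rw [span_T]; trivial
  exact (Submodule.mem_span_range_iff_exists_fun Kv).1 this

theorem rho_comm_Rop {r : ℕ} (h : Hecke r) (j : Fin r) : Commute (rho r h) (Rop j) := by
  obtain ⟨c, rfl⟩ := exists_eq_sum_T h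
  rw [map_sum]
  apply Commute.sum_left
  intro w _
  rw [map_smul, rho_T]
  exact (Lw_comm_Rop w j).smul_left _

/-- The coefficients of an element of the Hecke algebra in the basis `T_w`. -/
def coef {r : ℕ} : Hecke r →ₗ[Kv] (W r → Kv) :=
  (LinearMap.applyₗ (Pi.single 1 1)).comp (rho r).toLinearMap

theorem coef_apply {r : ℕ} (h : Hecke r) : coef h = rho r h (Pi.single 1 1) := rfl

theorem coef_T {r : ℕ} (w : W r) : coef (T w) = Pi.single w 1 := by
  rw [coef_apply, rho_T, Lw_single_one]

theorem coef_sum_T {r : ℕ} (c : W r → Kv) : coef (∑ w, c w • T w) = c := by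
  rw [map_sum]
  funext y
  simp [coef_T, Pi.single_apply]

/-- The elements `T_w` form a basis of the Hecke algebra. -/
theorem coef_injective {r : ℕ} : Function.Injective (coef (r := r)) := by
  intro x y h
  obtain ⟨c, rfl⟩ := exists_eq_sum_T x
  obtain ⟨d, rfl⟩ := exists_eq_sum_T y
  rw [coef_sum_T, coef_sum_T] at h
  rw [h]

theorem coef_T_simple_mul {r : ℕ} (i : Fin r) (h : Hecke r) :
    coef (T (simple i) * h) = Lop i (coef h) := by
  rw [coef_apply, map_mul, rho_T, Lw_simple]
  rfl

theorem coef_mul_T_simple {r : ℕ} (i : Fin r) (h : Hecke r) :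
    coef (h * T (simple i)) = Rop i (coef h) := by
  have h1 := congrArg (fun e => e (Pi.single 1 1)) (rho_comm_Rop h i).eq
  simp only [Module.End.mul_apply] at h1
  rw [coef_apply, map_mul, rho_T, Lw_simple, coef_apply, ← h1, Module.End.mul_apply,
    Lop_single (asc_one i), mul_one, Rop_single (by simpa [Asc] using asc_one i), one_mul]

/-! ### Blocks, words and coset matrices -/

/-- The sum of the first `j` entries of `λ̃`. -/
def psum {n : ℕ} (l : Fin (n + 1) → ℕ) (j : ℕ) : ℕ :=
  ∑ k : Fin (2 * n + 1) with k.val < j, tilde l k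

theorem psum_mono {n : ℕ} (l : Fin (n + 1) → ℕ) : Monotone (psum l) := by
  intro a b hab
  refine Finset.sum_le_sum_of_subset fun k hk => ?_
  simp only [Finset.mem_filter, Finset.mem_univ, true_and] at hk ⊢
  omega

theorem psum_zero {n : ℕ} (l : Fin (n + 1) → ℕ) : psum l 0 = 0 := by simp [psum]

theorem psum_succ {n : ℕ} (l : Fin (n + 1) → ℕ) (i : Fin (2 * n + 1)) :
    psum l (i.val + 1) = psum l i.val + tilde l i := by
  unfold psum
  have : Finset.univ.filter (fun k : Fin (2 * n + 1) => k.val < i.val + 1) =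
      insert i (Finset.univ.filter fun k : Fin (2 * n + 1) => k.val < i.val) := by
    ext k
    simp only [Finset.mem_filter, Finset.mem_univ, true_and, Finset.mem_insert, Fin.ext_iff]
    omega
  rw [this, Finset.sum_insert (by simp), add_comm]

theorem sum_Iio_eq_psum {n : ℕ} (l : Fin (n + 1) → ℕ) (i : Fin (2 * n + 1)) :
    ∑ k ∈ Finset.Iio i, tilde l k = psum l i.val := by
  refine Finset.sum_congr ?_ fun _ _ => rfl
  ext k
  simp only [Finset.mem_Iio, Fin.lt_def, Finset.mem_filter, Finset.mem_univ, true_and]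

theorem sum_Iic_eq_psum {n : ℕ} (l : Fin (n + 1) → ℕ) (i : Fin (2 * n + 1)) :
    ∑ k ∈ Finset.Iic i, tilde l k = psum l (i.val + 1) := by
  refine Finset.sum_congr ?_ fun _ _ => rfl
  ext k
  simp only [Finset.mem_Iic, Fin.le_def, Finset.mem_filter, Finset.mem_univ, true_and]
  omega

theorem tilde_rev {n : ℕ} (l : Fin (n + 1) → ℕ) (i : Fin (2 * n + 1)) :
    tilde l i.rev = tilde l i := by
  have := i.isLt
  unfold tilde
  simp only [Fin.val_rev]
  split_ifs
  · rfl
  · omega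
  · omega
  · congr 2
    omega

theorem sum_fold {n : ℕ} (f : Fin (2 * n + 1) → ℕ) (hf : ∀ i, f i.rev = f i) :
    ∑ i, f i = 2 * (∑ i : Fin n, f ⟨i.val, by omega⟩) + f (ctr n) := by
  have h : ∀ f : ℕ → ℕ, ∑ i : Fin (2 * n + 1), f i.val =
      ∑ i ∈ Finset.range n, (f i + f (2 * n - i)) + f n := by
    intro f
    rw [Fin.sum_univ_eq_sum_range, show 2 * n + 1 = n + (n + 1) by ring, Finset.sum_range_add,
      Finset.sum_range_succ', Finset.sum_add_distrib,
      ← Finset.sum_range_reflect (fun x => f (n + (x + 1)))]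
    rw [← add_assoc, add_zero]
    congr 2
    refine Finset.sum_congr rfl fun i hi => ?_
    rw [Finset.mem_range] at hi
    congr 1
    omega
  have h1 := h fun i => if hi : i < 2 * n + 1 then f ⟨i, hi⟩ else 0
  simp only [Fin.is_lt, dif_pos, Fin.eta] at h1
  rw [h1, ← Fin.sum_univ_eq_sum_range
    (fun i => (if hi : i < 2 * n + 1 then f ⟨i, hi⟩ else 0) +
      if hi : 2 * n - i < 2 * n + 1 then f ⟨2 * n - i, hi⟩ else 0), Finset.mul_sum]
  congr 1
  · refine Finset.sum_congr rfl fun i _ => ?_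
    rw [dif_pos (by omega), dif_pos (by omega), two_mul (f _)]
    congr 1
    rw [← hf]
    congr 1
    ext
    simp only [Fin.val_rev]
    omega
  · rw [dif_pos (by omega)]
    rfl

theorem tilde_castSucc {n : ℕ} (l : Fin (n + 1) → ℕ) (i : Fin n) :
    tilde l ⟨i.val, by omega⟩ = l i.castSucc := by
  rw [tilde, if_neg (by simp only; omega)]
  congr 1
  ext
  simp only [Fin.val_castSucc]
  omega

theorem tilde_ctr {n : ℕ} (l : Fin (n + 1) → ℕ) : tilde l (ctr n) = 2 * l (Fin.last n) + 1 :=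
  if_pos rfl

theorem sum_tilde {n : ℕ} (l : Fin (n + 1) → ℕ) : ∑ i, tilde l i = 2 * (∑ i, l i) + 1 := by
  rw [sum_fold _ (tilde_rev l), tilde_ctr, Fin.sum_univ_castSucc]
  simp only [tilde_castSucc]
  ring

theorem psum_last {n r : ℕ} (l : Comp n r) : psum l.1 (2 * n + 1) = 2 * r + 1 := by
  have h := sum_tilde l.1
  rw [l.2] at h
  rw [← h]
  refine Finset.sum_congr ?_ fun _ _ => rfl
  ext k
  simp only [Fin.is_lt, Finset.mem_filter, Finset.mem_univ, and_self]

theorem psum_rev {n r : ℕ} (l : Comp n r) {j : ℕ} (hj : j ≤ 2 * n + 1) :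
    psum l.1 j + psum l.1 (2 * n + 1 - j) = 2 * r + 1 := by
  induction j with
  | zero => rw [psum_zero, zero_add, Nat.sub_zero, psum_last]
  | succ j ih =>
    have h1 := psum_succ l.1 ⟨j, by omega⟩
    have h2 := psum_succ l.1 (Fin.rev ⟨j, by omega⟩)
    rw [tilde_rev] at h2
    simp only [Fin.val_rev] at h1 h2
    rw [show 2 * n + 1 - (j + 1) + 1 = 2 * n + 1 - j by omega] at h2
    have := ih (by omega)
    omega

theorem exists_lt_psum {n r : ℕ} (l : Comp n r) (x : Fin (2 * r + 1)) :
    ∃ i, x.val < psum l.1 (i + 1) := ⟨2 * n, by rw [psum_last]; exact x.isLt⟩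

/-- The index of the block of `λ` that contains the point `x`. -/
def bi {n r : ℕ} (l : Comp n r) (x : Fin (2 * r + 1)) : Fin (2 * n + 1) :=
  ⟨Nat.find (exists_lt_psum l x), by
    have := Nat.find_min' (exists_lt_psum l x) (m := 2 * n) (by rw [psum_last]; exact x.isLt)
    omega⟩

theorem bi_eq_iff {n r : ℕ} (l : Comp n r) (x : Fin (2 * r + 1)) (i : Fin (2 * n + 1)) :
    bi l x = i ↔ psum l.1 i.val ≤ x.val ∧ x.val < psum l.1 (i.val + 1) := by
  have key : ∀ k, Nat.find (exists_lt_psum l x) = k ↔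
      psum l.1 k ≤ x.val ∧ x.val < psum l.1 (k + 1) := by
    intro k
    rw [Nat.find_eq_iff, and_comm, and_congr_left_iff]
    intro _
    constructor
    · intro h
      cases k with
      | zero => rw [psum_zero]; omega
      | succ k => exact not_lt.1 (h k (by omega))
    · intro h m hm
      have := psum_mono l.1 (show m + 1 ≤ k by omega)
      omega
  rw [Fin.ext_iff]
  exact key i.val

theorem mem_block {n r : ℕ} (l : Comp n r) (x : Fin (2 * r + 1)) (i : Fin (2 * n + 1)) :
    x ∈ block r l.1 i ↔ bi l x = i := by
  rw [bi_eq_iff]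
  simp only [block, Set.mem_ofPred_eq, sum_Iio_eq_psum, sum_Iic_eq_psum]

theorem bi_mono {n r : ℕ} (l : Comp n r) : Monotone (bi l) := by
  intro x y hxy
  have h1 := (bi_eq_iff l x _).1 rfl
  have h2 := (bi_eq_iff l y _).1 rfl
  by_contra h
  have := psum_mono l.1 (show (bi l y).val + 1 ≤ (bi l x).val by
    rw [not_le, Fin.lt_def] at h; omega)
  rw [Fin.le_def] at hxy
  omega

theorem bi_rev {n r : ℕ} (l : Comp n r) (x : Fin (2 * r + 1)) : bi l x.rev = (bi l x).rev := by
  rw [bi_eq_iff]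
  have h1 := (bi_eq_iff l x _).1 rfl
  have h2 := psum_rev l (j := (bi l x).val) (by omega)
  have h3 := psum_rev l (j := (bi l x).val + 1) (by omega)
  have := x.isLt
  have := (bi l x).isLt
  simp only [Fin.val_rev]
  rw [show 2 * n + 1 - ((bi l x).val + 1) + 1 = 2 * n + 1 - (bi l x).val by omega]
  omega

theorem card_bi {n r : ℕ} (l : Comp n r) (i : Fin (2 * n + 1)) :
    (Finset.univ.filter fun x => bi l x = i).card = tilde l.1 i := by
  have h1 : (Finset.univ.filter fun x => bi l x = i).map Fin.valEmbedding =
      Finset.Ico (psum l.1 i.val) (psum l.1 (i.val + 1)) := by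
    ext k
    simp only [Finset.mem_map, Finset.mem_filter, Finset.mem_univ, true_and, bi_eq_iff,
      Finset.mem_Ico, Fin.valEmbedding_apply]
    constructor
    · rintro ⟨x, hx, rfl⟩
      exact hx
    · intro hk
      have := psum_mono l.1 (show i.val + 1 ≤ 2 * n + 1 by omega)
      rw [psum_last] at this
      exact ⟨⟨k, by omega⟩, hk, rfl⟩
  rw [← Finset.card_map Fin.valEmbedding, h1, Nat.card_Ico, psum_succ]
  omega

theorem cosetMatrix_apply {n r : ℕ} (l m : Comp n r) (w : W r) (i j : Fin (2 * n + 1)) :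
    cosetMatrix l m w i j =
      (Finset.univ.filter fun x => bi l x = i ∧ bi m (w⁻¹.1 x) = j).card := by
  unfold cosetMatrix
  rw [← Set.ncard_coe_finset]
  congr 1
  ext x
  simp only [Set.mem_inter_iff, mem_block, Set.mem_image, Finset.coe_filter, Finset.mem_univ,
    true_and, Set.mem_ofPred_eq, and_congr_right_iff]
  intro _
  constructor
  · rintro ⟨y, hy, rfl⟩
    have : w⁻¹.1 (w.1 y) = y := congrArg (fun g : W r => g.1 y) (inv_mul_cancel w)
    rw [this, hy]
  · intro h
    exact ⟨w⁻¹.1 x, h, congrArg (fun g : W r => g.1 x) (mul_inv_cancel w)⟩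

theorem apply_inv_self {r : ℕ} (w : W r) (x : Fin (2 * r + 1)) : w.1 (w⁻¹.1 x) = x :=
  congrArg (fun g : W r => g.1 x) (mul_inv_cancel w)

theorem cosetMatrix_apply' {n r : ℕ} (l m : Comp n r) (w : W r) (i j : Fin (2 * n + 1)) :
    cosetMatrix l m w i j =
      (Finset.univ.filter fun x => bi l (w.1 x) = i ∧ bi m x = j).card := by
  rw [cosetMatrix_apply]
  refine Finset.card_bij' (fun x _ => w⁻¹.1 x) (fun x _ => w.1 x) ?_ ?_ ?_ ?_ <;>
    simp

theorem sum_cosetMatrix_row {n r : ℕ} (l m : Comp n r) (w : W r) (i : Fin (2 * n + 1)) :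
    ∑ j, cosetMatrix l m w i j = tilde l.1 i := by
  simp only [cosetMatrix_apply]
  rw [← card_bi, Finset.card_eq_sum_card_fiberwise (f := fun x => bi m (w⁻¹.1 x))
    (t := Finset.univ) (by simp [Set.MapsTo])]
  simp only [Finset.filter_filter]

theorem sum_cosetMatrix_col {n r : ℕ} (l m : Comp n r) (w : W r) (j : Fin (2 * n + 1)) :
    ∑ i, cosetMatrix l m w i j = tilde m.1 j := by
  simp only [cosetMatrix_apply']
  rw [← card_bi, Finset.card_eq_sum_card_fiberwise (f := fun x => bi l (w.1 x))
    (t := Finset.univ) (by simp [Set.MapsTo])]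
  simp only [Finset.filter_filter, and_comm]

theorem tilde_injective {n : ℕ} : Function.Injective (tilde (n := n)) := by
  intro l m h
  funext k
  rcases Fin.eq_castSucc_or_eq_last k with ⟨k, rfl⟩ | rfl
  · have := congrFun h ⟨k.val, by omega⟩
    rwa [tilde_castSucc, tilde_castSucc] at this
  · have := congrFun h (ctr n)
    rw [tilde_ctr, tilde_ctr] at this
    omega

theorem comp_ext {n r : ℕ} {l m : Comp n r} (h : tilde l.1 = tilde m.1) : l = m :=
  Subtype.ext (tilde_injective h)

theorem mem_parabolic {n r : ℕ} (l : Comp n r) (w : W r) :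
    w ∈ parabolic l ↔ ∀ x, bi l (w.1 x) = bi l x := by
  unfold parabolic
  simp only [Set.mem_ofPred_eq]
  constructor
  · intro h x
    have h1 : x ∈ block r l.1 (bi l x) := (mem_block l x _).2 rfl
    have h2 : w.1 x ∈ block r l.1 (bi l x) := by
      rw [← h]
      exact ⟨x, h1, rfl⟩
    exact (mem_block _ _ _).1 h2
  · intro h i
    ext x
    simp only [Set.mem_image, mem_block]
    constructor
    · rintro ⟨y, hy, rfl⟩
      rw [h, hy]
    · intro hx
      exact ⟨w⁻¹.1 x, by rw [← h, apply_inv_self, hx], apply_inv_self w x⟩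

theorem one_mem_parabolic {n r : ℕ} (l : Comp n r) : 1 ∈ parabolic l := by
  rw [mem_parabolic]
  exact fun _ => rfl

theorem mul_mem_parabolic {n r : ℕ} {l : Comp n r} {w w' : W r} (h : w ∈ parabolic l)
    (h' : w' ∈ parabolic l) : w * w' ∈ parabolic l := by
  rw [mem_parabolic] at *
  exact fun x => (h _).trans (h' x)

theorem inv_mem_parabolic {n r : ℕ} {l : Comp n r} {w : W r} (h : w ∈ parabolic l) :
    w⁻¹ ∈ parabolic l := by
  rw [mem_parabolic] at *
  intro x
  rw [← h, apply_inv_self]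

theorem simple_mem_parabolic {n r : ℕ} {l : Comp n r} {i : Fin r}
    (h : bi l (pa i) = bi l (pb i)) : simple i ∈ parabolic l := by
  rw [mem_parabolic]
  intro x
  rw [simple_apply]
  unfold reflFun
  split_ifs with h1 h2 h3 h4
  · rw [h1, h]
  · rw [h2, h]
  · rw [h3, bi_rev, bi_rev, h]
  · rw [h4, bi_rev, bi_rev, h]
  · rfl

theorem bi_eq_of_not_asc {n r : ℕ} {l : Comp n r} {w : W r} (hw : w ∈ parabolic l) {i : Fin r}
    (h : ¬ Asc i w) : bi l (pa i) = bi l (pb i) := by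
  have hw' := (mem_parabolic _ _).1 (inv_mem_parabolic hw)
  refine le_antisymm (bi_mono l (pa_lt_pb i).le) ?_
  rw [← hw' (pa i), ← hw' (pb i)]
  exact bi_mono l (not_ascR.1 h).le

/-- Induction on the length inside a parabolic subgroup. -/
theorem parabolic_induction {n r : ℕ} {l : Comp n r} {P : W r → Prop} (h1 : P 1)
    (h : ∀ i w, bi l (pa i) = bi l (pb i) → Asc i w → P w → P (simple i * w))
    {w : W r} (hw : w ∈ parabolic l) : P w := by
  obtain ⟨k, hk⟩ : ∃ k, len w = k := ⟨_, rfl⟩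
  induction k generalizing w with
  | zero =>
    by_cases hw1 : w = 1
    · exact hw1 ▸ h1
    · obtain ⟨i, hi⟩ := exists_not_asc hw1
      have := len_simple_mul_of_not hi
      omega
  | succ k ih =>
    obtain ⟨i, hi⟩ := exists_not_asc (w := w) (by rintro rfl; rw [len_one] at hk; omega)
    have := len_simple_mul_of_not hi
    have hb := bi_eq_of_not_asc hw hi
    have := h i _ hb ((asc_simple_mul i w).2 hi)
      (ih (mul_mem_parabolic (simple_mem_parabolic hb) hw) (by omega))
    rwa [simple_mul_simple_mul] at this

theorem cosetMatrix_mul_left {n r : ℕ} (l m : Comp n r) {u : W r} (hu : u ∈ parabolic l)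
    (w : W r) : cosetMatrix l m (u * w) = cosetMatrix l m w := by
  ext i j
  simp only [cosetMatrix_apply']
  have : ∀ x, bi l ((u * w).1 x) = bi l (w.1 x) := fun x => (mem_parabolic _ _).1 hu _
  simp only [this]

theorem cosetMatrix_mul_right {n r : ℕ} (l m : Comp n r) {u : W r} (hu : u ∈ parabolic m)
    (w : W r) : cosetMatrix l m (w * u) = cosetMatrix l m w := by
  ext i j
  simp only [cosetMatrix_apply, mul_inv_rev]
  have : ∀ x, bi m ((u⁻¹ * w⁻¹).1 x) = bi m (w⁻¹.1 x) :=
    fun x => (mem_parabolic _ _).1 (inv_mem_parabolic hu) _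
  simp only [this]

/-- The parabolic subgroup is the double coset with the diagonal matrix `λ̃`. -/
theorem mem_parabolic_iff_cosetMatrix {n r : ℕ} (l : Comp n r) (w : W r) :
    w ∈ parabolic l ↔ cosetMatrix l l w = Matrix.diagonal (tilde l.1) := by
  rw [mem_parabolic]
  constructor
  · intro h
    ext i j
    rw [cosetMatrix_apply', Matrix.diagonal_apply]
    simp only [h]
    split_ifs with hij
    · subst hij
      simp only [and_self, card_bi]
    · rw [Finset.card_eq_zero, Finset.filter_eq_empty_iff]
      rintro x - ⟨h1, h2⟩
      exact hij (h1.symm.trans h2)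
  · intro h x
    by_contra hx
    have := congrFun (congrFun h (bi l (w.1 x))) (bi l x)
    rw [Matrix.diagonal_apply_ne _ hx, cosetMatrix_apply', Finset.card_eq_zero,
      Finset.filter_eq_empty_iff] at this
    exact this (Finset.mem_univ x) ⟨rfl, rfl⟩

/-! ### Double coset sums -/

open Classical in
/-- The sum of all `T_w` such that `w` has coset matrix `A` with respect to `(λ, μ)`. -/
def dcSum {n r : ℕ} (l m : Comp n r) (A : Mat n) : Hecke r :=
  ∑ w : W r with cosetMatrix l m w = A, T w

open Classical in
theorem coef_dcSum {n r : ℕ} (l m : Comp n r) (A : Mat n) (w : W r) :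
    coef (dcSum l m A) w = if cosetMatrix l m w = A then 1 else 0 := by
  unfold dcSum
  rw [Finset.sum_filter, map_sum, Finset.sum_apply, Finset.sum_eq_single w]
  · split_ifs
    · rw [coef_T, Pi.single_eq_same]
    · rw [map_zero, Pi.zero_apply]
  · intro y _ hy
    split_ifs
    · rw [coef_T, Pi.single_eq_of_ne hy.symm]
    · rw [map_zero, Pi.zero_apply]
  · simp

theorem xElt_eq_dcSum {n r : ℕ} (l : Comp n r) :
    xElt l = dcSum l l (Matrix.diagonal (tilde l.1)) := by
  unfold xElt dcSum
  refine Finset.sum_congr ?_ fun _ _ => rfl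
  ext w
  simp only [Finset.mem_filter, mem_parabolic_iff_cosetMatrix]

/-- Left invariance under the parabolic subgroup of `λ`. -/
def LInv {n r : ℕ} (l : Comp n r) (h : Hecke r) : Prop :=
  ∀ i, bi l (pa i) = bi l (pb i) → T (simple i) * h = (v ^ 2 : Kv) • h

/-- Right invariance under the parabolic subgroup of `μ`. -/
def RInv {n r : ℕ} (m : Comp n r) (h : Hecke r) : Prop :=
  ∀ i, bi m (pa i) = bi m (pb i) → h * T (simple i) = (v ^ 2 : Kv) • h

theorem LInv_dcSum {n r : ℕ} (l m : Comp n r) (A : Mat n) : LInv l (dcSum l m A) := by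
  intro i hi
  apply coef_injective
  funext w
  rw [coef_T_simple_mul, Lop_apply, map_smul, Pi.smul_apply, coef_dcSum, coef_dcSum,
    cosetMatrix_mul_left l m (simple_mem_parabolic hi), smul_eq_mul]
  split_ifs <;> ring

theorem RInv_dcSum {n r : ℕ} (l m : Comp n r) (A : Mat n) : RInv m (dcSum l m A) := by
  intro i hi
  apply coef_injective
  funext w
  rw [coef_mul_T_simple, Rop_apply, map_smul, Pi.smul_apply, coef_dcSum, coef_dcSum,
    cosetMatrix_mul_right l m (simple_mem_parabolic hi), smul_eq_mul]
  split_ifs <;> ring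

theorem LInv.coef_simple_mul {n r : ℕ} {l : Comp n r} {h : Hecke r} (hh : LInv l h) {i : Fin r}
    (hi : bi l (pa i) = bi l (pb i)) {w : W r} (hw : Asc i w) :
    coef h (simple i * w) = coef h w := by
  have h1 := congrArg (fun e => coef e w) (hh i hi)
  simp only [coef_T_simple_mul, Lop_apply, if_pos hw, map_smul, Pi.smul_apply, smul_eq_mul] at h1
  exact mul_left_cancel₀ (pow_ne_zero 2 RatFunc.X_ne_zero) h1

theorem LInv.T_mul {n r : ℕ} {l : Comp n r} {h : Hecke r} (hh : LInv l h) {w : W r}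
    (hw : w ∈ parabolic l) : T w * h = ((v ^ 2) ^ len w : Kv) • h := by
  refine parabolic_induction (l := l) (P := fun w => T w * h = ((v ^ 2) ^ len w : Kv) • h) ?_ ?_ hw
  · rw [T_one, len_one, pow_zero, one_mul, one_smul]
  · intro i w hi ha ih
    rw [← T_simple_mul ha, mul_assoc, ih, mul_smul_comm, hh i hi, smul_smul, len_simple_mul ha,
      pow_succ (v ^ 2)]

theorem T_mul_simple {r : ℕ} {i : Fin r} {w : W r} (h : AscR i w) :
    T w * T (simple i) = T (w * simple i) :=
  T_mul (by rw [len_mul_simple h, len_simple])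

theorem RInv.mul_T {n r : ℕ} {m : Comp n r} {h : Hecke r} (hh : RInv m h) {w : W r}
    (hw : w ∈ parabolic m) : h * T w = ((v ^ 2) ^ len w : Kv) • h := by
  have key : h * T w⁻¹⁻¹ = ((v ^ 2) ^ len w⁻¹ : Kv) • h := by
    refine parabolic_induction (l := m) (P := fun u => h * T u⁻¹ = ((v ^ 2) ^ len u : Kv) • h)
      ?_ ?_ (inv_mem_parabolic hw)
    · rw [inv_one, T_one, len_one, pow_zero, mul_one, one_smul]
    · intro i u hi ha ih
      rw [mul_inv_rev, simple_inv, ← T_mul_simple ha, ← mul_assoc, ih, smul_mul_assoc, hh i hi,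
        smul_smul, len_simple_mul ha, pow_succ (v ^ 2)]
  rwa [inv_inv, len_inv] at key

open Classical in
/-- The Poincaré polynomial of the parabolic subgroup of `λ`. -/
def poinc {n r : ℕ} (l : Comp n r) : Kv := ∑ w : W r with w ∈ parabolic l, (v ^ 2) ^ len w

theorem poinc_ne_zero {n r : ℕ} (l : Comp n r) : poinc l ≠ 0 := by
  classical
  have h : poinc l = algebraMap (Polynomial ℚ) Kv
      (∑ w : W r with w ∈ parabolic l, (Polynomial.X ^ 2) ^ len w) := by
    simp [poinc, v, RatFunc.algebraMap_X]
  rw [h]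
  intro h0
  have h1 := RatFunc.algebraMap_injective ℚ (h0.trans (map_zero _).symm)
  have h2 := congrArg (Polynomial.eval 1) h1
  simp only [Polynomial.eval_finsetSum, Polynomial.eval_pow, Polynomial.eval_X, one_pow,
    Finset.sum_const, nsmul_eq_mul, mul_one, Polynomial.eval_zero, Nat.cast_eq_zero,
    Finset.card_eq_zero] at h2
  have : (1 : W r) ∈ Finset.univ.filter fun w : W r => w ∈ parabolic l := by
    simp [one_mem_parabolic]
  rw [h2] at this
  simp at this

open Classical in
theorem LInv.xElt_mul {n r : ℕ} {l : Comp n r} {h : Hecke r} (hh : LInv l h) :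
    xElt l * h = poinc l • h := by
  unfold xElt poinc
  rw [Finset.sum_mul, Finset.sum_smul]
  exact Finset.sum_congr rfl fun w hw => hh.T_mul (Finset.mem_filter.1 hw).2

open Classical in
theorem RInv.mul_xElt {n r : ℕ} {m : Comp n r} {h : Hecke r} (hh : RInv m h) :
    h * xElt m = poinc m • h := by
  unfold xElt poinc
  rw [Finset.mul_sum, Finset.sum_smul]
  exact Finset.sum_congr rfl fun w hw => hh.mul_T (Finset.mem_filter.1 hw).2

/-! ### The `q`-Schur algebra as a matrix algebra over the Hecke algebra -/

instance (n r : ℕ) : Fintype (Comp n r) :=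
  Fintype.subtype (Finset.piAntidiag Finset.univ r) (by simp [Finset.mem_piAntidiag])

/-- The entry of `f` at `(λ, μ)`: the component in `x_λ H` of the image of `x_μ`. -/
def ent {n r : ℕ} (f : Schur n r) (l m : Comp n r) : Hecke r := ((f (xGen m) l : ↥(xIdeal l)) : Hecke r)

theorem ent_add {n r : ℕ} (f g : Schur n r) (l m : Comp n r) :
    ent (f + g) l m = ent f l m + ent g l m := rfl

theorem ent_zero {n r : ℕ} (l m : Comp n r) : ent (0 : Schur n r) l m = 0 := rfl

theorem ent_smul {n r : ℕ} (c : Kv) (f : Schur n r) (l m : Comp n r) :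
    ent (c • f) l m = c • ent f l m := rfl

/-- `ent` as a linear map. -/
def entHom {n r : ℕ} (l m : Comp n r) : Schur n r →ₗ[Kv] Hecke r where
  toFun f := ent f l m
  map_add' f g := ent_add f g l m
  map_smul' c f := ent_smul c f l m

theorem ent_sum {n r : ℕ} {ι : Type*} (s : Finset ι) (f : ι → Schur n r) (l m : Comp n r) :
    ent (∑ i ∈ s, f i) l m = ∑ i ∈ s, ent (f i) l m := map_sum (entHom l m) f s

theorem LInv.mul_right {n r : ℕ} {l : Comp n r} {h : Hecke r} (hh : LInv l h) (x : Hecke r) :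
    LInv l (h * x) := by
  intro i hi
  rw [← mul_assoc, hh i hi, smul_mul_assoc]

theorem LInv.smul {n r : ℕ} {l : Comp n r} {h : Hecke r} (hh : LInv l h) (c : Kv) :
    LInv l (c • h) := by
  intro i hi
  rw [mul_smul_comm, hh i hi, smul_comm]

theorem LInv_xElt {n r : ℕ} (l : Comp n r) : LInv l (xElt l) := by
  rw [xElt_eq_dcSum]
  exact LInv_dcSum _ _ _

/-- Since the Poincaré polynomial is invertible, the right ideal of `x_λ` consists of all
left invariant elements. -/
theorem mem_xIdeal {n r : ℕ} (l : Comp n r) (h : Hecke r) : h ∈ xIdeal l ↔ LInv l h := by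
  constructor
  · intro hh
    obtain ⟨a, rfl⟩ := Submodule.mem_span_singleton.1 hh
    exact (LInv_xElt l).mul_right a.unop
  · intro hh
    refine Submodule.mem_span_singleton.2 ⟨MulOpposite.op ((poinc l)⁻¹ • h), ?_⟩
    rw [op_smul_eq_mul, mul_smul_comm, hh.xElt_mul, smul_smul, inv_mul_cancel₀ (poinc_ne_zero l),
      one_smul]

theorem of_eq_smul_xGen {n r : ℕ} (l : Comp n r) (y : ↥(xIdeal l)) :
    DirectSum.of (fun l : Comp n r => ↥(xIdeal l)) l y =
      MulOpposite.op ((poinc l)⁻¹ • (y : Hecke r)) • xGen l := by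
  unfold xGen
  rw [← DirectSum.of_smul]
  congr 1
  apply Subtype.ext
  change (y : Hecke r) = xElt l * ((poinc l)⁻¹ • (y : Hecke r))
  rw [mul_smul_comm, ((mem_xIdeal l _).1 y.2).xElt_mul, smul_smul,
    inv_mul_cancel₀ (poinc_ne_zero l), one_smul]

theorem apply_of {n r : ℕ} (f : Schur n r) (l m : Comp n r) (y : ↥(xIdeal m)) :
    ((f (DirectSum.of (fun l : Comp n r => ↥(xIdeal l)) m y) l : ↥(xIdeal l)) : Hecke r) =
      (poinc m)⁻¹ • (ent f l m * y) := by
  rw [of_eq_smul_xGen, map_smul]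
  change ent f l m * ((poinc m)⁻¹ • (y : Hecke r)) = _
  rw [mul_smul_comm]

theorem schur_ext {n r : ℕ} {f g : Schur n r} (h : ∀ l m, ent f l m = ent g l m) : f = g := by
  apply LinearMap.ext
  intro t
  induction t using DirectSum.induction_on with
  | zero => rw [map_zero, map_zero]
  | of m y =>
    refine DFinsupp.ext fun l => Subtype.ext ?_
    have h1 := apply_of f l m y
    rw [h l m, ← apply_of g l m y] at h1
    exact h1
  | add x y hx hy => rw [map_add, map_add, hx, hy]

/-- Composition in the `q`-Schur algebra becomes a product of matrices over the Hecke algebra, up to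
the Poincaré polynomials of the intermediate parabolic subgroups. -/
theorem ent_mul {n r : ℕ} (f g : Schur n r) (l m : Comp n r) :
    ent (f * g) l m = ∑ k, (poinc k)⁻¹ • (ent f l k * ent g k m) := by
  classical
  have h1 : g (xGen m) = ∑ k, DirectSum.of (fun l : Comp n r => ↥(xIdeal l)) k (g (xGen m) k) :=
    (DirectSum.sum_univ_of _).symm
  unfold ent
  rw [Module.End.mul_apply]
  rw [h1]
  have h2 : ∀ t : TModule n r, ((f t l : ↥(xIdeal l)) : Hecke r) =
    ((Submodule.subtype _).toAddMonoidHom.comp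
      (((DFinsupp.evalAddMonoidHom l).comp f.toAddMonoidHom))) t := fun _ => rfl
  rw [h2, map_sum]
  refine Finset.sum_congr rfl fun k _ => ?_
  rw [← h2, apply_of, ← h1]
  rfl

/-- Left multiplication by an element of `x_λ H`, as a map from `x_μ H` to `x_λ H`. -/
def mulLeftHom {n r : ℕ} (l m : Comp n r) (c : ↥(xIdeal l)) :
    ↥(xIdeal m) →ₗ[(Hecke r)ᵐᵒᵖ] ↥(xIdeal l) where
  toFun y := ⟨c * y, by
    rw [mem_xIdeal]
    exact ((mem_xIdeal _ _).1 c.2).mul_right _⟩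
  map_add' x y := Subtype.ext (mul_add _ _ _)
  map_smul' a x := Subtype.ext (mul_assoc _ _ _).symm

theorem exists_ent {n r : ℕ} (E : Comp n r → Comp n r → Hecke r) (hl : ∀ l m, LInv l (E l m))
    (hr : ∀ l m, RInv m (E l m)) : ∃ f : Schur n r, ∀ l m, ent f l m = E l m := by
  classical
  let c : ∀ l m : Comp n r, ↥(xIdeal l) := fun l m =>
    ⟨(poinc m)⁻¹ • E l m, (mem_xIdeal _ _).2 ((hl l m).smul _)⟩
  refine ⟨DirectSum.toModule _ _ _ fun m => ∑ l,
    (DirectSum.lof (Hecke r)ᵐᵒᵖ (Comp n r) (fun l => ↥(xIdeal l)) l).comp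
      (mulLeftHom l m (c l m)), ?_⟩
  intro l m
  have h1 : ∀ y : ↥(xIdeal m), ((∑ l,
    (DirectSum.lof (Hecke r)ᵐᵒᵖ (Comp n r) (fun l => ↥(xIdeal l)) l).comp
      (mulLeftHom l m (c l m))) y : TModule n r) l = mulLeftHom l m (c l m) y := by
    intro y
    rw [LinearMap.sum_apply]
    change (DFinsupp.evalAddMonoidHom l) (∑ l, _) = _
    rw [map_sum, Finset.sum_eq_single l]
    · exact DirectSum.of_eq_same _ _
    · intro k _ hk
      exact DirectSum.of_eq_of_ne _ _ _ hk.symm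
    · simp
  unfold ent xGen
  change (((DirectSum.toModule _ _ _ _) (DirectSum.lof (Hecke r)ᵐᵒᵖ (Comp n r)
    (fun l => ↥(xIdeal l)) m _) : TModule n r) l : Hecke r) = _
  rw [DirectSum.toModule_lof, h1]
  change ((poinc m)⁻¹ • E l m) * xElt m = E l m
  rw [smul_mul_assoc, (hr l m).mul_xElt, smul_smul, inv_mul_cancel₀ (poinc_ne_zero m), one_smul]

/-- The homomorphism `e_A` exists, so that the definition of `e` does not take its default value. -/
theorem ent_e {n r : ℕ} (A : Mat n) (l m : Comp n r) : ent (e r A) l m = dcSum l m A := by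
  have h : ∃ f : Schur n r, IsStd A f :=
    exists_ent (fun l m => dcSum l m A) (fun l m => LInv_dcSum l m A) fun l m => RInv_dcSum l m A
  unfold e
  rw [dif_pos h]
  exact h.choose_spec l m

theorem ent_one {n r : ℕ} (l m : Comp n r) :
    ent (1 : Schur n r) l m = if l = m then xElt m else 0 := by
  unfold ent
  rw [Module.End.one_apply]
  unfold xGen
  split_ifs with h
  · subst h
    rw [DirectSum.of_eq_same]
  · rw [DirectSum.of_eq_of_ne _ _ _ h]
    rfl

theorem dcSum_eq_zero {n r : ℕ} {l m : Comp n r} {A : Mat n}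
    (h : ∀ w, cosetMatrix l m w ≠ A) : dcSum l m A = 0 := by
  unfold dcSum
  rw [Finset.sum_eq_zero]
  intro w hw
  exact absurd (Finset.mem_filter.1 hw).2 (h w)

theorem dcSum_eq_zero_of_row {n r : ℕ} {l m : Comp n r} {A : Mat n} {i : Fin (2 * n + 1)}
    (h : ∑ j, A i j ≠ tilde l.1 i) : dcSum l m A = 0 :=
  dcSum_eq_zero fun w hw => h (by rw [← hw, sum_cosetMatrix_row])

theorem dcSum_eq_zero_of_col {n r : ℕ} {l m : Comp n r} {A : Mat n} {j : Fin (2 * n + 1)}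
    (h : ∑ i, A i j ≠ tilde m.1 j) : dcSum l m A = 0 :=
  dcSum_eq_zero fun w hw => h (by rw [← hw, sum_cosetMatrix_col])

/-! ### Moving one letter to the next block -/

theorem Eth_apply {n : ℕ} (a b i j : Fin (2 * n + 1)) :
    Eth a b i j = (if a = i ∧ b = j then 1 else 0) + if a.rev = i ∧ b.rev = j then 1 else 0 := by
  simp only [Eth, Matrix.add_apply, Matrix.single_apply]

/-- `λ̃` arises from `ν̃` by moving one point (and its mirror image) from block `i` to block
`i + 1`. -/
def Moved {n r : ℕ} (i : Fin (2 * n)) (l k : Comp n r) : Prop :=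
  ∀ j, tilde l.1 j + ((if j = i.castSucc then 1 else 0) + if j = i.castSucc.rev then 1 else 0) =
    tilde k.1 j + ((if j = i.succ then 1 else 0) + if j = i.succ.rev then 1 else 0)

theorem castSucc_ne_rev_succ {n : ℕ} (i : Fin (2 * n)) : i.castSucc ≠ i.succ.rev := by
  simp only [ne_eq, Fin.ext_iff, Fin.val_rev, Fin.val_castSucc, Fin.val_succ]
  omega

theorem Moved.psum {n r : ℕ} {i : Fin (2 * n)} {l k : Comp n r} (h : Moved i l k) (j : ℕ) :
    psum k.1 j + (if j = 2 * n - i.val then 1 else 0) =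
      psum l.1 j + if j = i.val + 1 then 1 else 0 := by
  have hc : ∀ a : Fin (2 * n + 1), (∑ t : Fin (2 * n + 1) with t.val < j, if t = a then 1 else 0) =
      if a.val < j then 1 else 0 := by
    intro a
    rw [Finset.sum_ite_eq']
    simp
  have h1 : ∑ t : Fin (2 * n + 1) with t.val < j, (tilde l.1 t +
      ((if t = i.castSucc then 1 else 0) + if t = i.castSucc.rev then 1 else 0)) =
      ∑ t : Fin (2 * n + 1) with t.val < j, (tilde k.1 t +
      ((if t = i.succ then 1 else 0) + if t = i.succ.rev then 1 else 0)) :=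
    Finset.sum_congr rfl fun t _ => h t
  simp only [Finset.sum_add_distrib, hc, Fin.val_rev, Fin.val_castSucc, Fin.val_succ] at h1
  have := i.isLt
  unfold TypeB.psum
  split_ifs at h1 ⊢ <;> omega

theorem Moved.psum_lt {n r : ℕ} {i : Fin (2 * n)} {l k : Comp n r} (h : Moved i l k) :
    TypeB.psum l.1 (i.val + 1) < TypeB.psum l.1 (i.val + 2) := by
  have h1 := psum_succ l.1 i.succ
  have h2 := h i.succ
  rw [if_pos rfl, if_neg, if_neg] at h2
  · rw [Fin.val_succ] at h1
    rw [h1]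
    omega
  · intro h'
    exact castSucc_ne_rev_succ i (Fin.rev_eq_iff.1 h'.symm)
  · simp only [Fin.ext_iff, Fin.val_castSucc, Fin.val_succ]
    omega

/-- The first point of block `i + 1` of `λ`. -/
def Moved.start {n r : ℕ} {i : Fin (2 * n)} {l k : Comp n r} (h : Moved i l k) :
    Fin (2 * r + 1) :=
  ⟨TypeB.psum l.1 (i.val + 1), by
    have h1 := h.psum_lt
    have h2 := psum_mono l.1 (show i.val + 2 ≤ 2 * n + 1 by omega)
    rw [psum_last] at h2
    omega⟩

theorem Moved.bi_start {n r : ℕ} {i : Fin (2 * n)} {l k : Comp n r} (h : Moved i l k) :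
    bi l h.start = i.succ := by
  rw [bi_eq_iff]
  exact ⟨le_rfl, h.psum_lt⟩

theorem Moved.start_le {n r : ℕ} {i : Fin (2 * n)} {l k : Comp n r} (h : Moved i l k)
    {x : Fin (2 * r + 1)} (hx : bi l x = i.succ) : h.start ≤ x :=
  ((bi_eq_iff _ _ _).1 hx).1

theorem bi_ctr {n r : ℕ} (l : Comp n r) : bi l (ctr r) = ctr n := by
  rw [← rev_eq_self, ← bi_rev, rev_eq_self.2 rfl]

theorem Moved.start_ne_ctr {n r : ℕ} {i : Fin (2 * n)} {l k : Comp n r} (h : Moved i l k) :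
    h.start ≠ ctr r := by
  intro h0
  have h1 := h.bi_start
  rw [h0, bi_ctr] at h1
  have h2 : i.val + 1 = n := by
    rw [Fin.ext_iff, Fin.val_succ] at h1
    exact h1.symm
  have h3 : TypeB.psum l.1 n = r := by
    have := congrArg Fin.val h0
    simp only [Moved.start, ctr, h2] at this
    exact this
  have h4 := psum_rev l (j := n) (by omega)
  rw [h3, show 2 * n + 1 - n = n + 1 by omega] at h4
  have h5 := psum_succ l.1 i.succ
  rw [Fin.val_succ, h2] at h5
  have h6 := h i.succ
  have e : i.succ.rev = i.succ := rev_eq_self.2 h1.symm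
  rw [e, if_pos rfl] at h6
  have e1 : i.succ ≠ i.castSucc := by
    simp only [ne_eq, Fin.ext_iff, Fin.val_castSucc, Fin.val_succ]
    omega
  rw [if_neg e1, if_neg (fun h' => e1 (by rw [← e, h', Fin.rev_rev]))] at h6
  omega

theorem Moved.bi_eq {n r : ℕ} {i : Fin (2 * n)} {l k : Comp n r} (h : Moved i l k)
    (x : Fin (2 * r + 1)) : bi k x = if x = h.start then i.castSucc else
      if x = h.start.rev then i.castSucc.rev else bi l x := by
  have hi := i.isLt
  have hs : h.start.val = TypeB.psum l.1 (i.val + 1) := rfl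
  have h0 : bi k h.start = i.castSucc := by
    rw [bi_eq_iff, hs, Fin.val_castSucc]
    have h1 := h.psum i.val
    have h2 := h.psum (i.val + 1)
    have h3 := psum_mono l.1 (show i.val ≤ i.val + 1 by omega)
    split_ifs at h1 h2 <;> omega
  split_ifs with h1 h2
  · rw [h1, h0]
  · rw [h2, bi_rev, h0]
  · rw [bi_eq_iff]
    have h3 := (bi_eq_iff l x _).1 rfl
    have h4 := h.psum (bi l x).val
    have h5 := h.psum ((bi l x).val + 1)
    have h6 := psum_rev l (j := i.val + 1) (by omega)
    rw [show 2 * n + 1 - (i.val + 1) = 2 * n - i.val by omega] at h6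
    rw [Fin.ext_iff, hs] at h1
    rw [Fin.ext_iff, Fin.val_rev, hs] at h2
    have e1 : (bi l x).val = i.val + 1 →
      TypeB.psum l.1 (bi l x).val = TypeB.psum l.1 (i.val + 1) := fun h => by rw [h]
    have e2 : (bi l x).val + 1 = 2 * n - i.val →
      TypeB.psum l.1 ((bi l x).val + 1) = TypeB.psum l.1 (2 * n - i.val) := fun h => by rw [h]
    split_ifs at h4 h5 <;> omega

/-- The points of block `i + 1` of `λ` other than the middle point. -/
def tgt {n r : ℕ} (i : Fin (2 * n)) (l : Comp n r) : Finset (Fin (2 * r + 1)) :=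
  Finset.univ.filter fun x => bi l x = i.succ ∧ x ≠ ctr r

theorem mem_tgt {n r : ℕ} {i : Fin (2 * n)} {l : Comp n r} {x : Fin (2 * r + 1)} :
    x ∈ tgt i l ↔ bi l x = i.succ ∧ x ≠ ctr r := by simp [tgt]

/-- Every point of block `i + 1` other than the first has a predecessor `y'` in the block, the
middle point being skipped, and some simple reflection exchanges the two. -/
theorem exists_pred {n r : ℕ} {i : Fin (2 * n)} {l k : Comp n r} (h : Moved i l k)
    {y : Fin (2 * r + 1)} (hy : y ∈ tgt i l) (hne : y ≠ h.start) :
    ∃ y' ∈ tgt i l, y' < y ∧ (∀ x ∈ tgt i l, x < y ↔ x = y' ∨ x < y') ∧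
      ∃ j : Fin r, (pa j = y' ∧ pb j = y) ∨ (pa j = y.rev ∧ pb j = y'.rev) := by
  have hy1 := (mem_tgt.1 hy).1
  have hy2 := (mem_tgt.1 hy).2
  have hlt : h.start < y := lt_of_le_of_ne (h.start_le hy1) (Ne.symm hne)
  have hs := h.start_ne_ctr
  have hbs := h.bi_start
  have hmem : ∀ y' : Fin (2 * r + 1), h.start ≤ y' → y' < y → y' ≠ ctr r → y' ∈ tgt i l := by
    intro y' h1 h2 h3
    refine mem_tgt.2 ⟨le_antisymm ?_ ?_, h3⟩
    · rw [← hy1]; exact bi_mono l h2.le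
    · rw [← hbs]; exact bi_mono l h1
  have hyl := y.isLt
  simp only [Fin.lt_def, Fin.le_def, ctr, ne_eq, Fin.ext_iff] at hlt hs hmem hy2
  by_cases hc : y.val = r + 1
  · refine ⟨⟨r - 1, by omega⟩, hmem _ (by simp only; omega) (by simp only; omega) (by simp only; omega),
      by simp only [Fin.lt_def]; omega, ?_, ⟨r - 1, by omega⟩, ?_⟩
    · intro x hx
      have := (mem_tgt.1 hx).2
      simp only [Fin.lt_def, ctr, ne_eq, Fin.ext_iff] at this ⊢
      omega
    · left
      simp only [pa, Fin.ext_iff, val_pb, true_and]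
      split_ifs <;> omega
  · refine ⟨⟨y.val - 1, by omega⟩, hmem _ (by simp only; omega) (by simp only; omega) (by simp only; omega),
      by simp only [Fin.lt_def]; omega, ?_, ?_⟩
    · intro x hx
      simp only [Fin.lt_def, Fin.ext_iff]
      omega
    · by_cases hr : y.val < r
      · refine ⟨⟨y.val - 1, by omega⟩, Or.inl ?_⟩
        simp only [pa, Fin.ext_iff, val_pb, true_and]
        split_ifs <;> omega
      · refine ⟨⟨2 * r - y.val, by omega⟩, Or.inr ?_⟩
        simp only [pa, Fin.ext_iff, val_pb, Fin.val_rev]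
        split_ifs <;> omega

open Classical in
/-- For a point `y` of block `i + 1` of `λ`, a product `U` of generators `T_s` and the
corresponding product `u` of simple reflections, which carries the first point of the block to `y`
along the block. -/
theorem exists_move {n r : ℕ} {i : Fin (2 * n)} {l k : Comp n r} (h : Moved i l k)
    (y : Fin (2 * r + 1)) (hy : y ∈ tgt i l) : ∃ (U : Hecke r) (u : W r),
      (∀ x, bi k (u⁻¹.1 x) = if x = y then i.castSucc else
        if x = y.rev then i.castSucc.rev else bi l x) ∧
      (∀ w, coef (U * xElt k) w = if u⁻¹ * w ∈ parabolic k then 1 else 0) ∧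
      (∀ (g : Hecke r) (w : W r), (∀ x ∈ tgt i l, x < y → w⁻¹.1 x < w⁻¹.1 y) →
        coef (U * g) w = (v ^ 2) ^ ((tgt i l).filter (· < y)).card * coef g (u⁻¹ * w)) := by
  induction y using WellFoundedLT.induction with
  | ind y ih =>
  by_cases hs : y = h.start
  · refine ⟨1, 1, ?_, ?_, ?_⟩
    · intro x
      rw [hs, inv_one]
      exact h.bi_eq x
    · intro w
      rw [one_mul, inv_one, one_mul, xElt_eq_dcSum, coef_dcSum]
      simp only [mem_parabolic_iff_cosetMatrix]
    · intro g w _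
      have : (tgt i l).filter (· < y) = ∅ := by
        rw [Finset.filter_eq_empty_iff]
        intro x hx
        rw [not_lt, hs]
        exact h.start_le (mem_tgt.1 hx).1
      rw [this, Finset.card_empty, pow_zero, one_mul, one_mul, inv_one, one_mul]
  · obtain ⟨y', hy', hlt, hpred, j, hj⟩ := exists_pred h hy hs
    obtain ⟨U, u, ha, hb, hc⟩ := ih y' hlt hy'
    have hyb := (mem_tgt.1 hy).1
    have hyc := (mem_tgt.1 hy).2
    have hyb' := (mem_tgt.1 hy').1
    have hyc' := (mem_tgt.1 hy').2
    have hsy : (simple j).1 y' = y := by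
      rcases hj with ⟨h1, h2⟩ | ⟨h1, h2⟩
      · rw [← h1, ← h2, simple_pa]
      · have := simple_pb j
        rw [h1, h2, map_rev] at this
        exact Fin.rev_injective this
    have hsy' : (simple j).1 y = y' := by rw [← hsy, simple_simple_apply]
    have hpar : simple j ∈ parabolic l := by
      apply simple_mem_parabolic
      rcases hj with ⟨h1, h2⟩ | ⟨h1, h2⟩
      · rw [h1, h2, hyb, hyb']
      · rw [h1, h2, bi_rev, bi_rev, hyb, hyb']
    have hasc : ∀ w : W r, Asc j w ↔ w⁻¹.1 y' < w⁻¹.1 y := by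
      intro w
      unfold Asc AscR
      rcases hj with ⟨h1, h2⟩ | ⟨h1, h2⟩
      · rw [h1, h2]
      · rw [h1, h2, map_rev, map_rev, Fin.rev_lt_rev]
    have hbl := (mem_parabolic l _).1 hpar
    have hinv : ∀ w : W r, (simple j * u)⁻¹ * w = u⁻¹ * (simple j * w) := by
      intro w
      rw [mul_inv_rev, simple_inv, mul_assoc]
    have hkey : ∀ w : W r, u⁻¹ * w ∈ parabolic k → Asc j w := by
      intro w hw
      have hw' := (mem_parabolic _ _).1 (inv_mem_parabolic hw)
      have e : ∀ x, bi k (w⁻¹.1 x) = bi k (u⁻¹.1 x) := by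
        intro x
        have := hw' (u⁻¹.1 x)
        rw [mul_inv_rev, inv_inv] at this
        rw [← this]
        change bi k (w⁻¹.1 x) = bi k (w⁻¹.1 (u.1 (u⁻¹.1 x)))
        rw [apply_inv_self]
      rw [hasc]
      by_contra hle
      have h1 := bi_mono k (not_lt.1 hle)
      rw [e, e, ha y', ha y, if_pos rfl, if_neg hlt.ne'] at h1
      split_ifs at h1 with h2
      · have h3 : i.succ = i.succ.rev := by
          rw [← hyb', ← bi_rev, ← h2, hyb, hyb']
        simp only [Fin.le_def, Fin.ext_iff, Fin.val_rev, Fin.val_castSucc, Fin.val_succ] at h1 h3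
        omega
      · rw [hyb] at h1
        simp only [Fin.le_def, Fin.val_castSucc, Fin.val_succ] at h1
        omega
    refine ⟨T (simple j) * U, simple j * u, ?_, ?_, ?_⟩
    · intro x
      have e1 : (simple j).1 x = y' ↔ x = y := by
        rw [← hsy', EmbeddingLike.apply_eq_iff_eq]
      have e2 : (simple j).1 x = y'.rev ↔ x = y.rev := by
        rw [← hsy', ← map_rev, EmbeddingLike.apply_eq_iff_eq]
      have e3 : (simple j * u)⁻¹.1 x = u⁻¹.1 ((simple j).1 x) := by
        rw [mul_inv_rev, simple_inv]
        rfl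
      rw [e3, ha, hbl]
      simp only [e1, e2]
    · intro w
      rw [mul_assoc, coef_T_simple_mul, Lop_apply, hb, hb, hinv]
      by_cases hw : Asc j w
      · rw [if_pos hw, if_neg, mul_zero]
        intro h'
        exact (asc_simple_mul j w).1 (hkey _ h') hw
      · rw [if_neg hw, if_neg (c := u⁻¹ * w ∈ parabolic k) (fun h' => hw (hkey _ h')), mul_zero,
          add_zero]
    · intro g w hw
      have hw1 : Asc j w := (hasc w).2 (hw y' hy' hlt)
      rw [mul_assoc, coef_T_simple_mul, Lop_apply, if_pos hw1, hc, hinv, ← mul_assoc, ← pow_succ']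
      · congr 2
        have : (tgt i l).filter (· < y) = insert y' ((tgt i l).filter (· < y')) := by
          ext x
          simp only [Finset.mem_filter, Finset.mem_insert]
          constructor
          · rintro ⟨h1, h2⟩
            exact ((hpred x h1).1 h2).imp id fun h3 => ⟨h1, h3⟩
          · rintro (rfl | ⟨h1, h2⟩)
            · exact ⟨hy', hlt⟩
            · exact ⟨h1, (hpred x h1).2 (Or.inr h2)⟩
        rw [this, Finset.card_insert_of_notMem (by simp)]
      · intro x hx hxy
        have e3 : ∀ z, (simple j * w)⁻¹.1 z = w⁻¹.1 ((simple j).1 z) := by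
          intro z
          rw [mul_inv_rev, simple_inv]
          rfl
        rw [e3, e3, hsy]
        refine hw _ (mem_tgt.2 ⟨(hbl x).trans (mem_tgt.1 hx).1,
          map_ne_ctr _ (mem_tgt.1 hx).2⟩) ?_
        rw [← hsy]
        refine simple_lt j hxy (mem_tgt.1 hx).2 hyc' ?_ ?_
        · rintro ⟨h1, h2⟩
          rcases hj with ⟨h3, h4⟩ | ⟨h3, h4⟩
          · exact (pa_lt_pb j).ne (h3.trans h2)
          · exact hyc' (rev_eq_self.1 (h4.symm.trans h2.symm))
        · rintro ⟨h1, h2⟩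
          rcases hj with ⟨h3, h4⟩ | ⟨h3, h4⟩
          · exact pa_ne_rev j (h3.trans h2)
          · rw [h3, Fin.rev_rev] at h2
            exact hlt.ne h2

/-! ### The product of two double coset sums -/

/-- The Gaussian integer `1 + q + ⋯ + q^{m-1}` at `q = v^2`. -/
def qnum (m : ℕ) : Kv := ∑ t ∈ Finset.range m, (v ^ 2) ^ t

theorem sum_pow_card_lt {α : Type*} [LinearOrder α] (S : Finset α) (q : Kv) :
    ∑ y ∈ S, q ^ (S.filter (· < y)).card = ∑ t ∈ Finset.range S.card, q ^ t := by
  induction S using Finset.induction_on_max with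
  | empty => simp
  | insert a s ha ih =>
    have hna : a ∉ s := fun h => lt_irrefl a (ha a h)
    rw [Finset.sum_insert hna, Finset.card_insert_of_notMem hna, Finset.sum_range_succ, ← ih,
      add_comm]
    congr 1
    · refine Finset.sum_congr rfl fun y hy => ?_
      rw [Finset.filter_insert, if_neg (ha y hy).not_gt]
    · rw [Finset.filter_insert, if_neg (lt_irrefl a), Finset.filter_true_of_mem ha]

theorem sum_pow_card_lt_fiber {α β : Type*} [LinearOrder α] [LinearOrder β] (K : Finset α)
    (c : α → β) (hc : ∀ x ∈ K, ∀ y ∈ K, x < y → c x ≤ c y) (p : β) (q : Kv) :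
    ∑ y ∈ K with c y = p, q ^ (K.filter (· < y)).card =
      q ^ (K.filter (c · < p)).card * ∑ t ∈ Finset.range (K.filter (c · = p)).card, q ^ t := by
  rw [← sum_pow_card_lt, Finset.mul_sum]
  refine Finset.sum_congr rfl fun y hy => ?_
  rw [Finset.mem_filter] at hy
  rw [← pow_add, ← Finset.card_union_of_disjoint]
  · congr 2
    ext x
    simp only [Finset.mem_filter, Finset.mem_union]
    constructor
    · rintro ⟨h1, h2⟩
      have := hc x h1 y hy.1 h2
      rw [hy.2] at this
      rcases this.lt_or_eq with h3 | h3
      · exact Or.inl ⟨h1, h3⟩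
      · exact Or.inr ⟨⟨h1, h3⟩, h2⟩
    · rintro (⟨h1, h2⟩ | ⟨⟨h1, h2⟩, h3⟩)
      · refine ⟨h1, ?_⟩
        rcases lt_trichotomy x y with h4 | h4 | h4
        · exact h4
        · rw [h4, hy.2] at h2
          exact absurd h2 (lt_irrefl _)
        · have := hc y hy.1 x h1 h4
          rw [hy.2] at this
          exact absurd h2 this.not_gt
      · exact ⟨h1, h3⟩
  · rw [Finset.disjoint_left]
    intro x hx hx'
    simp only [Finset.mem_filter] at hx hx'
    exact hx.2.ne hx'.1.2

/-- If `u` carries the first point of block `i + 1` of `λ` to `y`, then passing from `w` to `u⁻¹ w`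
moves the letter at position `y` of the word of `w` from row `i + 1` back to row `i`. -/
theorem cosetMatrix_move {n r : ℕ} {i : Fin (2 * n)} {l k : Comp n r} {y : Fin (2 * r + 1)}
    (hy : y ∈ tgt i l) {u : W r} (hu : ∀ x, bi k (u⁻¹.1 x) = if x = y then i.castSucc else
        if x = y.rev then i.castSucc.rev else bi l x) (m : Comp n r) (w : W r) :
    cosetMatrix k m (u⁻¹ * w) + Eth i.succ (bi m (w⁻¹.1 y)) =
      cosetMatrix l m w + Eth i.castSucc (bi m (w⁻¹.1 y)) := by
  ext a b
  have hyb := (mem_tgt.1 hy).1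
  have hyc : y.rev ≠ y := fun h => (mem_tgt.1 hy).2 (rev_eq_self.1 h)
  have h1 : cosetMatrix k m (u⁻¹ * w) a b =
      ∑ x, if bi k (u⁻¹.1 x) = a ∧ bi m (w⁻¹.1 x) = b then 1 else 0 := by
    rw [cosetMatrix_apply, Finset.card_filter, ← Equiv.sum_comp u⁻¹.1]
    refine Finset.sum_congr rfl fun x _ => ?_
    have : (u⁻¹ * w)⁻¹.1 (u⁻¹.1 x) = w⁻¹.1 x := by
      rw [mul_inv_rev, inv_inv]
      change w⁻¹.1 (u.1 (u⁻¹.1 x)) = _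
      rw [apply_inv_self]
    rw [this]
  have h2 : cosetMatrix l m w a b = ∑ x, if bi l x = a ∧ bi m (w⁻¹.1 x) = b then 1 else 0 := by
    rw [cosetMatrix_apply, Finset.card_filter]
  have h3 : ∀ c : Fin (2 * n + 1), Eth c (bi m (w⁻¹.1 y)) a b =
      ∑ x, ((if x = y then if c = a ∧ bi m (w⁻¹.1 x) = b then 1 else 0 else 0) +
        if x = y.rev then if c.rev = a ∧ bi m (w⁻¹.1 x) = b then 1 else 0 else 0) := by
    intro c
    rw [Eth_apply, Finset.sum_add_distrib, Finset.sum_ite_eq', Finset.sum_ite_eq']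
    simp only [Finset.mem_univ, if_true, map_rev, bi_rev]
  rw [Matrix.add_apply, Matrix.add_apply, h1, h2, h3, h3, ← Finset.sum_add_distrib,
    ← Finset.sum_add_distrib]
  refine Finset.sum_congr rfl fun x _ => ?_
  rw [hu]
  by_cases hx : x = y
  · subst hx
    rw [if_pos rfl, hyb, if_pos rfl, if_pos rfl, if_neg hyc.symm, if_neg hyc.symm]
    ring
  · rw [if_neg hx, if_neg hx, if_neg hx]
    by_cases hx' : x = y.rev
    · rw [if_pos hx', if_pos hx', if_pos hx', hx', bi_rev, hyb]
      ring
    · rw [if_neg hx', if_neg hx', if_neg hx']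

theorem Eth_castSucc_succ_row {n : ℕ} (i : Fin (2 * n)) (p b : Fin (2 * n + 1)) :
    Eth i.castSucc p i.succ b = 0 := by
  rw [Eth_apply, if_neg, if_neg]
  · rintro ⟨h, -⟩
    exact castSucc_ne_rev_succ i (by rw [← h, Fin.rev_rev])
  · rintro ⟨h, -⟩
    simp only [Fin.ext_iff, Fin.val_castSucc, Fin.val_succ] at h
    omega

theorem Eth_succ_castSucc_row {n : ℕ} (i : Fin (2 * n)) (p b : Fin (2 * n + 1)) :
    Eth i.succ p i.castSucc b = 0 := by
  rw [Eth_apply, if_neg, if_neg]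
  · rintro ⟨h, -⟩
    exact castSucc_ne_rev_succ i h.symm
  · rintro ⟨h, -⟩
    simp only [Fin.ext_iff, Fin.val_castSucc, Fin.val_succ] at h
    omega

/-- The coset matrix of the generator that moves a point from block `i` to block `i + 1`. -/
def IsGenMat {n r : ℕ} (i : Fin (2 * n)) (k : Comp n r) (B : Mat n) : Prop :=
  B + Eth i.castSucc i.castSucc = Matrix.diagonal (tilde k.1) + Eth i.succ i.castSucc

theorem eq_castSucc_of_diagonal {n r : ℕ} {i : Fin (2 * n)} {k : Comp n r} {C : Mat n}
    {p : Fin (2 * n + 1)}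
    (h : Matrix.diagonal (tilde k.1) + Eth i.succ p = C + Eth i.castSucc p) : p = i.castSucc := by
  by_contra hp
  have := congrFun (congrFun h i.castSucc) p
  rw [Matrix.add_apply, Matrix.add_apply, Matrix.diagonal_apply_ne _ (Ne.symm hp),
    Eth_succ_castSucc_row, Eth_apply, if_pos ⟨rfl, rfl⟩] at this
  omega

/-- The letters `j` in block `i + 1`, counted without the middle point. -/
theorem card_tgt_fiber {n r : ℕ} (i : Fin (2 * n)) (l m : Comp n r) (w : W r)
    (j : Fin (2 * n + 1)) :
    ((tgt i l).filter fun x => bi m (w⁻¹.1 x) = j).card +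
      (if i.succ = ctr n ∧ j = ctr n then 1 else 0) = cosetMatrix l m w i.succ j := by
  rw [cosetMatrix_apply]
  have h1 : (Finset.univ.filter fun x => bi l x = i.succ ∧ bi m (w⁻¹.1 x) = j).filter
      (· ≠ ctr r) = (tgt i l).filter fun x => bi m (w⁻¹.1 x) = j := by
    ext x
    simp only [Finset.mem_filter, Finset.mem_univ, true_and, mem_tgt]
    tauto
  have h2 : (Finset.univ.filter fun x => bi l x = i.succ ∧ bi m (w⁻¹.1 x) = j).filter
      (fun x => ¬ (x ≠ ctr r)) = if i.succ = ctr n ∧ j = ctr n then {ctr r} else ∅ := by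
    ext x
    simp only [Finset.mem_filter, Finset.mem_univ, true_and, not_not]
    constructor
    · rintro ⟨⟨h1, h2⟩, rfl⟩
      rw [map_ctr, bi_ctr] at h2
      rw [bi_ctr] at h1
      rw [if_pos ⟨h1.symm, h2.symm⟩, Finset.mem_singleton]
    · split_ifs with h
      · rw [Finset.mem_singleton]
        rintro rfl
        rw [map_ctr, bi_ctr, bi_ctr, h.1, h.2]
        simp
      · simp
  rw [← Finset.card_filter_add_card_filter_not (s := Finset.univ.filter fun x => bi l x = i.succ ∧
    bi m (w⁻¹.1 x) = j) (· ≠ ctr r), h1, h2]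
  congr 1
  split_ifs <;> simp

/-- Every coset of the parabolic subgroup contains an element without left descents in it. -/
theorem exists_sorted {n r : ℕ} (l : Comp n r) (w : W r) : ∃ u ∈ parabolic l,
    ∀ i, bi l (pa i) = bi l (pb i) → Asc i (u * w) := by
  obtain ⟨k, hk⟩ : ∃ k, len w = k := ⟨_, rfl⟩
  induction k using Nat.strong_induction_on generalizing w with
  | _ k ih =>
    by_cases hw : ∀ i, bi l (pa i) = bi l (pb i) → Asc i w
    · exact ⟨1, one_mem_parabolic l, by simpa using hw⟩
    · push Not at hw
      obtain ⟨i, hi, hi'⟩ := hw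
      have := len_simple_mul_of_not hi'
      obtain ⟨u, hu, hu'⟩ := ih (len (simple i * w)) (by omega) (simple i * w) rfl
      refine ⟨u * simple i, mul_mem_parabolic hu (simple_mem_parabolic hi), ?_⟩
      rwa [mul_assoc]

theorem LInv.coef_mul {n r : ℕ} {l : Comp n r} {h : Hecke r} (hh : LInv l h) {u : W r}
    (hu : u ∈ parabolic l) (w : W r) : coef h (u * w) = coef h w := by
  refine parabolic_induction (l := l) (P := fun u => coef h (u * w) = coef h w) (by rw [one_mul])
    ?_ hu
  intro i u hi _ ih
  rw [mul_assoc, ← ih]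
  by_cases ha : Asc i (u * w)
  · exact hh.coef_simple_mul hi ha
  · have := hh.coef_simple_mul hi ((asc_simple_mul i (u * w)).2 ha)
    rw [simple_mul_simple_mul] at this
    exact this.symm

open Classical in
/-- The coefficients of the product of a generator and a double coset sum. The generator is a sum of
products `U y` of the generators `T_s`, one for every target point `y`. Evaluated at the shortest
element of a coset, the summand of `y` is a power of `q` that counts the target points to the left
of `y`; summing over the targets that carry the letter `p` gives the Gaussian integer. -/
theorem coef_dcSum_mul_dcSum {n r : ℕ} {i : Fin (2 * n)} {l k : Comp n r} (h : Moved i l k)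
    {B : Mat n} (hB : IsGenMat i k B) (m : Comp n r) (A : Mat n) (w : W r) :
    coef (dcSum l k B * dcSum k m A) w = poinc k * ∑ p,
      if A + Eth i.succ p = cosetMatrix l m w + Eth i.castSucc p then
        (v ^ 2) ^ (∑ j ∈ Finset.Iio p, A i.succ j) * qnum (A i.succ p + 1) else 0 := by
  choose! U u ha hb hc using exists_move h
  set D : Hecke r := ∑ y ∈ tgt i l, U y with hD
  -- The generator is a sum of the `U y` times the generator of the right ideal.
  have hDx : D * xElt k = dcSum l k B := by
    apply coef_injective
    funext z
    rw [hD, Finset.sum_mul, map_sum, Finset.sum_apply, coef_dcSum,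
      Finset.sum_congr rfl fun y hy => hb y hy z]
    have hpar : ∀ y ∈ tgt i l, ((u y)⁻¹ * z ∈ parabolic k ↔
        bi k (z⁻¹.1 y) = i.castSucc ∧ cosetMatrix l k z = B) := by
      intro y hy
      have h1 := cosetMatrix_move hy (ha y hy) k z
      rw [mem_parabolic_iff_cosetMatrix]
      constructor
      · intro h2
        rw [h2] at h1
        have h3 := eq_castSucc_of_diagonal h1
        refine ⟨h3, ?_⟩
        rw [h3] at h1
        exact add_right_cancel (h1.symm.trans hB.symm)
      · rintro ⟨h2, h3⟩
        rw [h2, h3] at h1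
        exact add_right_cancel (h1.trans hB)
    rw [Finset.sum_congr rfl fun y hy => by rw [hpar y hy]]
    by_cases hz : cosetMatrix l k z = B
    · simp only [hz, and_true, if_true]
      rw [← Finset.sum_filter, Finset.sum_const]
      have h1 := card_tgt_fiber i l k z i.castSucc
      have h2 := congrFun (congrFun hB i.succ) i.castSucc
      rw [Matrix.add_apply, Matrix.add_apply, Eth_castSucc_succ_row, Matrix.diagonal_apply_ne _
        (by simp only [ne_eq, Fin.ext_iff, Fin.val_castSucc, Fin.val_succ]; omega), Eth_apply,
        if_pos ⟨rfl, rfl⟩, if_neg] at h2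
      · rw [hz, if_neg, add_zero] at h1
        · rw [h1, show B i.succ i.castSucc = 1 by omega, one_smul]
        · rintro ⟨h3, h4⟩
          have := h3.trans h4.symm
          simp only [Fin.ext_iff, Fin.val_castSucc, Fin.val_succ] at this
          omega
      · rintro ⟨h3, h4⟩
        have := (rev_eq_self.1 h3).trans (rev_eq_self.1 h4).symm
        simp only [Fin.ext_iff, Fin.val_castSucc, Fin.val_succ] at this
        omega
    · simp [hz]
  have hx := (LInv_dcSum k m A).xElt_mul
  have h1 : dcSum l k B * dcSum k m A = poinc k • (D * dcSum k m A) := by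
    rw [← hDx, mul_assoc, hx, mul_smul_comm]
  have h2 : LInv l (D * dcSum k m A) := by
    have := ((LInv_dcSum l k B).mul_right (dcSum k m A)).smul (poinc k)⁻¹
    rwa [h1, smul_smul, inv_mul_cancel₀ (poinc_ne_zero k), one_smul] at this
  rw [h1, map_smul, Pi.smul_apply, smul_eq_mul]
  congr 1
  -- By left invariance, `w` may be replaced by the shortest element of its coset.
  obtain ⟨s, hs, hsort⟩ := exists_sorted l w
  rw [← h2.coef_mul hs, ← cosetMatrix_mul_left l m hs w]
  generalize s * w = w at hsort ⊢
  have hinc : ∀ x y, x < y → bi l x = bi l y → w⁻¹.1 x < w⁻¹.1 y := by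
    intro x y hxy hb
    refine lt_of_ascR w⁻¹ (fun x => (bi l x).val) (bi_mono l) ?_ ?_ hxy (congrArg _ hb)
    · intro x y hb
      simp only [bi_rev, Fin.val_rev]
      omega
    · intro i hi
      exact hsort i (Fin.ext hi)
  have hinc' : ∀ x ∈ tgt i l, ∀ y ∈ tgt i l, x < y → w⁻¹.1 x < w⁻¹.1 y :=
    fun x hx y hy hxy => hinc x y hxy ((mem_tgt.1 hx).1.trans (mem_tgt.1 hy).1.symm)
  rw [hD, Finset.sum_mul, map_sum, Finset.sum_apply,
    Finset.sum_congr rfl fun y hy => hc y hy (dcSum k m A) w fun x hx hxy => hinc' x hx y hy hxy]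
  have h3 : ∀ y ∈ tgt i l, coef (dcSum k m A) ((u y)⁻¹ * w) =
      ∑ p, if bi m (w⁻¹.1 y) = p then
        if A + Eth i.succ p = cosetMatrix l m w + Eth i.castSucc p then 1 else 0 else 0 := by
    intro y hy
    have h4 := cosetMatrix_move hy (ha y hy) m w
    rw [coef_dcSum, Finset.sum_ite_eq, if_pos (Finset.mem_univ _)]
    congr 1
    rw [eq_iff_iff]
    constructor
    · intro h5
      rw [← h5, h4]
    · intro h5
      exact add_right_cancel (h4.trans h5.symm)
  rw [Finset.sum_congr rfl fun y hy => by rw [h3 y hy, Finset.mul_sum], Finset.sum_comm]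
  refine Finset.sum_congr rfl fun p _ => ?_
  by_cases hp : A + Eth i.succ p = cosetMatrix l m w + Eth i.castSucc p
  swap
  · simp [hp]
  simp only [hp, if_true, mul_ite, mul_one, mul_zero]
  rw [← Finset.sum_filter, sum_pow_card_lt_fiber (tgt i l) (fun y => bi m (w⁻¹.1 y))
    (fun x hx y hy hxy => bi_mono m (hinc' x hx y hy hxy).le)]
  have hrow : ∀ j, A i.succ j + ((if j = p then 1 else 0) +
      if i.succ = ctr n ∧ j = p.rev then 1 else 0) = cosetMatrix l m w i.succ j := by
    intro j
    have := congrFun (congrFun hp i.succ) j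
    rw [Matrix.add_apply, Matrix.add_apply, Eth_castSucc_succ_row, add_zero, Eth_apply] at this
    rw [← this]
    simp only [true_and, rev_eq_self, eq_comm (a := j)]
  have hc1 : ∀ j, ((tgt i l).filter fun x => bi m (w⁻¹.1 x) = j).card +
      (if i.succ = ctr n ∧ j = ctr n then 1 else 0) = A i.succ j + ((if j = p then 1 else 0) +
      if i.succ = ctr n ∧ j = p.rev then 1 else 0) := by
    intro j
    rw [hrow, card_tgt_fiber]
  have hcard : ((tgt i l).filter fun x => bi m (w⁻¹.1 x) = p).card = A i.succ p + 1 := by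
    have h5 := hc1 p
    have h6 : p = p.rev ↔ p = ctr n := by rw [eq_comm, rev_eq_self]
    simp only [if_true, h6] at h5
    omega
  have hlow : ((tgt i l).filter fun x => bi m (w⁻¹.1 x) < p).card =
      ∑ j ∈ Finset.Iio p, A i.succ j := by
    have h5 := Finset.sum_congr (rfl : Finset.Iio p = Finset.Iio p) fun j _ => hc1 j
    rw [Finset.sum_add_distrib, Finset.sum_add_distrib, Finset.sum_add_distrib] at h5
    have h6 : ∑ j ∈ Finset.Iio p, ((tgt i l).filter fun x => bi m (w⁻¹.1 x) = j).card =
        ((tgt i l).filter fun x => bi m (w⁻¹.1 x) < p).card := by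
      rw [Finset.card_eq_sum_card_fiberwise (f := fun x => bi m (w⁻¹.1 x)) (t := Finset.Iio p)]
      · refine Finset.sum_congr rfl fun j hj => ?_
        congr 1
        ext x
        simp only [Finset.mem_filter, Finset.mem_Iio] at hj ⊢
        constructor
        · rintro ⟨h7, h8⟩
          exact ⟨⟨h7, h8 ▸ hj⟩, h8⟩
        · rintro ⟨⟨h7, -⟩, h8⟩
          exact ⟨h7, h8⟩
      · intro x hx
        exact Finset.mem_Iio.2 (Finset.mem_filter.1 hx).2
    have h7 : ∑ j ∈ Finset.Iio p, (if j = p then 1 else 0) = 0 := by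
      rw [Finset.sum_ite_eq']
      simp
    have h8 : ∀ a : Fin (2 * n + 1), ∑ j ∈ Finset.Iio p, (if i.succ = ctr n ∧ j = a then 1 else 0) =
        if i.succ = ctr n ∧ a < p then 1 else 0 := by
      intro a
      by_cases hcn : i.succ = ctr n
      · simp [hcn]
      · simp [hcn]
    have h9 : p.rev < p ↔ ctr n < p := by
      simp only [Fin.lt_def, Fin.val_rev, ctr]
      omega
    rw [h6, h7, h8, h8] at h5
    simp only [h9] at h5
    omega
  rw [hcard, hlow, qnum]

/-- The entries of `A` allow `E^θ_{i,p}` to be subtracted. -/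
def CanMove {n : ℕ} (A : Mat n) (i : Fin (2 * n)) (p : Fin (2 * n + 1)) : Prop :=
  ∀ a b, Eth i.castSucc p a b ≤ A a b

theorem add_sub_Eth_eq_iff {n : ℕ} {A C : Mat n} {i : Fin (2 * n)} {p : Fin (2 * n + 1)} :
    A + Eth i.succ p = C + Eth i.castSucc p ↔
      CanMove A i p ∧ C = A + Eth i.succ p - Eth i.castSucc p := by
  have h0 : ∀ a b, Eth i.castSucc p a b = 0 ∨ Eth i.succ p a b = 0 := by
    intro a b
    by_contra! h
    obtain ⟨h1, h2⟩ := h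
    rw [Eth_apply] at h1 h2
    have h3 := castSucc_ne_rev_succ i
    have h4 : i.castSucc ≠ i.succ := by
      simp only [ne_eq, Fin.ext_iff, Fin.val_castSucc, Fin.val_succ]
      omega
    have h5 : a = i.castSucc ∨ a = i.castSucc.rev := by
      by_contra! h
      exact h1 (by rw [if_neg (fun h' => h.1 h'.1.symm), if_neg (fun h' => h.2 h'.1.symm)])
    have h6 : a = i.succ ∨ a = i.succ.rev := by
      by_contra! h
      exact h2 (by rw [if_neg (fun h' => h.1 h'.1.symm), if_neg (fun h' => h.2 h'.1.symm)])
    rcases h5 with h5 | h5 <;> rcases h6 with h6 | h6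
    · exact h4 (h5.symm.trans h6)
    · exact h3 (h5.symm.trans h6)
    · exact h3 (by rw [← h6, h5, Fin.rev_rev])
    · exact h4 (Fin.rev_injective (h5.symm.trans h6))
  constructor
  · intro h
    have h1 : ∀ a b, A a b + Eth i.succ p a b = C a b + Eth i.castSucc p a b := fun a b =>
      congrFun (congrFun h a) b
    constructor
    · intro a b
      have := h1 a b
      have := h0 a b
      omega
    · ext a b
      have := h1 a b
      simp only [Matrix.sub_apply, Matrix.add_apply]
      omega
  · rintro ⟨h, rfl⟩
    ext a b
    have := h a b
    simp only [Matrix.sub_apply, Matrix.add_apply]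
    omega

open Classical in
/-- The multiplication rule for a generator and a double coset sum: every letter `p` of row `i` can
be moved to row `i + 1`. -/
theorem dcSum_mul_dcSum {n r : ℕ} {i : Fin (2 * n)} {l k : Comp n r} (h : Moved i l k)
    {B : Mat n} (hB : IsGenMat i k B) (m : Comp n r) (A : Mat n) :
    dcSum l k B * dcSum k m A = poinc k • ∑ p with CanMove A i p,
      ((v ^ 2) ^ (∑ j ∈ Finset.Iio p, A i.succ j) * qnum (A i.succ p + 1)) •
        dcSum l m (A + Eth i.succ p - Eth i.castSucc p) := by
  apply coef_injective
  funext w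
  rw [coef_dcSum_mul_dcSum h hB, map_smul, Pi.smul_apply, smul_eq_mul, map_sum, Finset.sum_apply,
    Finset.sum_filter]
  congr 1
  refine Finset.sum_congr rfl fun p _ => ?_
  rw [map_smul, Pi.smul_apply, coef_dcSum, smul_eq_mul, mul_ite, mul_one, mul_zero, ← ite_and]
  exact if_congr add_sub_Eth_eq_iff rfl rfl

/-! ### The exponents in the normalisation of the standard basis -/

/-- The bilinear form underlying the dimension of the orbit of a matrix. -/
def bil {N : ℕ} (A C : Fin N → Fin N → ℤ) : ℤ :=
  ∑ i, ∑ j, ∑ k, ∑ l, if k ≤ i ∧ j < l then A i j * C k l else 0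

theorem bil_add_left {N : ℕ} (A B C : Fin N → Fin N → ℤ) : bil (A + B) C = bil A C + bil B C := by
  simp only [bil, ← Finset.sum_add_distrib]
  refine Finset.sum_congr rfl fun i _ => Finset.sum_congr rfl fun j _ => Finset.sum_congr rfl
    fun k _ => Finset.sum_congr rfl fun l _ => ?_
  split_ifs
  · exact add_mul _ _ _
  · rfl

theorem bil_add_right {N : ℕ} (A B C : Fin N → Fin N → ℤ) : bil A (B + C) = bil A B + bil A C := by
  simp only [bil, ← Finset.sum_add_distrib]
  refine Finset.sum_congr rfl fun i _ => Finset.sum_congr rfl fun j _ => Finset.sum_congr rfl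
    fun k _ => Finset.sum_congr rfl fun l _ => ?_
  split_ifs
  · exact mul_add _ _ _
  · rfl

/-- The sum of the entries of `A` to the lower left of `(k, l)`. -/
def low {N : ℕ} (A : Fin N → Fin N → ℤ) (k l : Fin N) : ℤ :=
  ∑ i ∈ Finset.Ici k, ∑ j ∈ Finset.Iio l, A i j

theorem sum_sum_comm_sum_sum {N : ℕ} (F : Fin N → Fin N → Fin N → Fin N → ℤ) :
    ∑ i, ∑ j, ∑ k, ∑ l, F i j k l = ∑ k, ∑ l, ∑ i, ∑ j, F i j k l := by
  rw [Finset.sum_congr rfl fun i _ => Finset.sum_comm, Finset.sum_comm]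
  refine Finset.sum_congr rfl fun k _ => ?_
  rw [Finset.sum_congr rfl fun i _ => Finset.sum_comm, Finset.sum_comm]

theorem bil_eq_sum_low {N : ℕ} (A C : Fin N → Fin N → ℤ) :
    bil A C = ∑ k, ∑ l, C k l * low A k l := by
  unfold bil
  rw [sum_sum_comm_sum_sum]
  refine Finset.sum_congr rfl fun k _ => Finset.sum_congr rfl fun l _ => ?_
  rw [low, Finset.mul_sum]
  have : Finset.Ici k = Finset.univ.filter (k ≤ ·) := by ext; simp
  rw [this, Finset.sum_filter]
  refine Finset.sum_congr rfl fun i _ => ?_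
  have : Finset.Iio l = Finset.univ.filter (· < l) := by ext; simp
  rw [this, Finset.sum_filter, Finset.mul_sum]
  by_cases h : k ≤ i
  · simp only [h, if_true, true_and, mul_ite, mul_zero, mul_comm]
  · simp [h]

theorem bil_comm_of_symm {N : ℕ} {A C : Fin N → Fin N → ℤ} (hA : ∀ i j, A i.rev j.rev = A i j)
    (hC : ∀ i j, C i.rev j.rev = C i j) : bil A C = bil C A := by
  unfold bil
  rw [sum_sum_comm_sum_sum]
  rw [← Equiv.sum_comp Fin.revPerm]
  refine Finset.sum_congr rfl fun k _ => ?_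
  rw [← Equiv.sum_comp Fin.revPerm]
  refine Finset.sum_congr rfl fun l _ => ?_
  rw [← Equiv.sum_comp Fin.revPerm]
  refine Finset.sum_congr rfl fun i _ => ?_
  rw [← Equiv.sum_comp Fin.revPerm]
  refine Finset.sum_congr rfl fun j _ => ?_
  simp only [Fin.revPerm_apply, hA, hC, Fin.rev_le_rev, Fin.rev_lt_rev]
  exact if_congr Iff.rfl (mul_comm _ _) rfl

/-- The integral matrix `E^θ_{i+1,p} - E^θ_{i,p}`. -/
def moveMat {n : ℕ} (i : Fin (2 * n)) (p : Fin (2 * n + 1)) :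
    Fin (2 * n + 1) → Fin (2 * n + 1) → ℤ :=
  fun a b => (Eth i.succ p a b : ℤ) - Eth i.castSucc p a b

theorem Eth_rev_apply {n : ℕ} (a b i j : Fin (2 * n + 1)) : Eth a b i.rev j.rev = Eth a b i j := by
  rw [Eth_apply, Eth_apply, add_comm]
  simp only [Fin.rev_eq_iff (i := a), Fin.rev_eq_iff (i := b), Fin.rev_rev]

theorem moveMat_rev {n : ℕ} (i : Fin (2 * n)) (p a b : Fin (2 * n + 1)) :
    moveMat i p a.rev b.rev = moveMat i p a b := by
  simp only [moveMat, Eth_rev_apply]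

/-- The linear form by which the dimension changes when a letter `p` moves from row `i` to
row `i + 1`. -/
def moveForm {n : ℕ} (A : Fin (2 * n + 1) → Fin (2 * n + 1) → ℤ) (i : Fin (2 * n))
    (p : Fin (2 * n + 1)) : ℤ :=
  ∑ j ∈ Finset.Ioi p, A i.succ j - ∑ j ∈ Finset.Iio p, A i.castSucc j

theorem sum_Eth_mul {n : ℕ} (a b : Fin (2 * n + 1)) (f : Fin (2 * n + 1) → Fin (2 * n + 1) → ℤ) :
    ∑ k, ∑ l, (Eth a b k l : ℤ) * f k l = f a b + f a.rev b.rev := by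
  have h : ∀ a b : Fin (2 * n + 1), ∑ k, ∑ l, (if a = k ∧ b = l then f k l else 0) = f a b := by
    intro a b
    simp [ite_and]
  rw [← h a b, ← h a.rev b.rev, ← Finset.sum_add_distrib]
  refine Finset.sum_congr rfl fun k _ => ?_
  rw [← Finset.sum_add_distrib]
  refine Finset.sum_congr rfl fun l _ => ?_
  rw [Eth_apply]
  push_cast
  rw [add_mul]
  simp only [ite_mul, one_mul, zero_mul]

theorem bil_moveMat {n : ℕ} {A : Fin (2 * n + 1) → Fin (2 * n + 1) → ℤ}
    (hA : ∀ i j, A i.rev j.rev = A i j) (i : Fin (2 * n)) (p : Fin (2 * n + 1)) :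
    bil A (moveMat i p) = moveForm A i p := by
  rw [bil_eq_sum_low]
  simp only [moveMat, sub_mul, Finset.sum_sub_distrib, sum_Eth_mul]
  have h1 : low A i.castSucc p = ∑ j ∈ Finset.Iio p, A i.castSucc j + low A i.succ p := by
    have : Finset.Ici i.castSucc = insert i.castSucc (Finset.Ici i.succ) := by
      ext a
      simp only [Finset.mem_Ici, Finset.mem_insert, Fin.le_def, Fin.ext_iff, Fin.val_castSucc,
        Fin.val_succ]
      omega
    unfold low
    rw [this, Finset.sum_insert]
    simp only [Finset.mem_Ici, Fin.le_def, Fin.val_castSucc, Fin.val_succ]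
    omega
  have h2 : low A i.succ.rev p.rev = ∑ j ∈ Finset.Ioi p, A i.succ j +
      low A i.castSucc.rev p.rev := by
    have : Finset.Ici i.succ.rev = insert i.succ.rev (Finset.Ici i.castSucc.rev) := by
      ext a
      simp only [Finset.mem_Ici, Finset.mem_insert, Fin.le_def, Fin.ext_iff, Fin.val_castSucc,
        Fin.val_succ, Fin.val_rev]
      omega
    unfold low
    rw [this, Finset.sum_insert]
    · congr 1
      refine Finset.sum_bij' (fun j _ => j.rev) (fun j _ => j.rev) ?_ ?_ ?_ ?_ ?_
      · intro j hj
        rw [Finset.mem_Iio] at hj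
        rw [Finset.mem_Ioi]
        exact Fin.lt_rev_iff.2 hj
      · intro j hj
        rw [Finset.mem_Ioi] at hj
        rw [Finset.mem_Iio]
        exact Fin.rev_lt_rev.2 hj
      · intro j _
        exact Fin.rev_rev j
      · intro j _
        exact Fin.rev_rev j
      · intro j _
        rw [← hA, Fin.rev_rev]
    · simp only [Finset.mem_Ici, Fin.le_def, Fin.val_castSucc, Fin.val_succ, Fin.val_rev]
      omega
  rw [moveForm, h1, h2]
  ring

theorem sum_Ioi_ite_eq {n : ℕ} (p a : Fin (2 * n + 1)) :
    ∑ j ∈ Finset.Ioi p, (if a = j then (1 : ℤ) else 0) = if p < a then 1 else 0 := by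
  rw [Finset.sum_ite_eq]
  simp

theorem sum_Iio_ite_eq {n : ℕ} (p a : Fin (2 * n + 1)) :
    ∑ j ∈ Finset.Iio p, (if a = j then (1 : ℤ) else 0) = if a < p then 1 else 0 := by
  rw [Finset.sum_ite_eq]
  simp

/-- The quadratic term in the change of the dimension. It is nonzero only next to the middle row. -/
theorem moveForm_moveMat {n : ℕ} (i : Fin (2 * n)) (p : Fin (2 * n + 1)) :
    moveForm (moveMat i p) i p = (if i.succ = ctr n ∧ p < ctr n then 1 else 0) +
      if i.castSucc = ctr n ∧ ctr n < p then 1 else 0 := by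
  have e1 : p < p.rev ↔ p < ctr n := by
    simp only [Fin.lt_def, Fin.val_rev, ctr]
    omega
  have e2 : p.rev < p ↔ ctr n < p := by
    simp only [Fin.lt_def, Fin.val_rev, ctr]
    omega
  have h1 : ∀ j, moveMat i p i.succ j = (if p = j then 1 else 0) +
      if i.succ = ctr n then if p.rev = j then 1 else 0 else 0 := by
    intro j
    rw [moveMat, Eth_castSucc_succ_row, Eth_apply]
    simp only [rev_eq_self, true_and]
    push_cast
    rw [sub_zero, ← ite_and]
  have h2 : ∀ j, moveMat i p i.castSucc j = -((if p = j then 1 else 0) +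
      if i.castSucc = ctr n then if p.rev = j then 1 else 0 else 0) := by
    intro j
    rw [moveMat, Eth_succ_castSucc_row, Eth_apply]
    simp only [rev_eq_self, true_and]
    push_cast
    rw [zero_sub, ← ite_and]
  simp only [moveForm, h1, h2, Finset.sum_add_distrib, Finset.sum_neg_distrib, sum_Ioi_ite_eq,
    sum_Iio_ite_eq, Finset.sum_ite_irrel, Finset.sum_const_zero, e1, e2, lt_irrefl, if_false,
    ite_and]
  ring

/-- The sum of the entries in the lower left quadrant, the middle row included. -/
def quad {n : ℕ} (A : Fin (2 * n + 1) → Fin (2 * n + 1) → ℤ) : ℤ :=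
  ∑ i : Fin (2 * n + 1), ∑ j : Fin (2 * n + 1), if j.val < n ∧ n ≤ i.val then A i j else 0

theorem quad_moveMat {n : ℕ} (i : Fin (2 * n)) (p : Fin (2 * n + 1)) :
    quad (moveMat i p) = (if i.succ = ctr n ∧ p < ctr n then 1 else 0) -
      if i.castSucc = ctr n ∧ ctr n < p then 1 else 0 := by
  have h : quad (moveMat i p) = ∑ k : Fin (2 * n + 1), ∑ l : Fin (2 * n + 1),
      ((Eth i.succ p k l : ℤ) * (if l.val < n ∧ n ≤ k.val then 1 else 0) -
        (Eth i.castSucc p k l : ℤ) * (if l.val < n ∧ n ≤ k.val then 1 else 0)) := by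
    refine Finset.sum_congr rfl fun k _ => Finset.sum_congr rfl fun l _ => ?_
    split_ifs
    · simp [moveMat]
    · simp
  rw [h]
  simp only [Finset.sum_sub_distrib, sum_Eth_mul]
  have := i.isLt
  have := p.isLt
  simp only [Fin.ext_iff, Fin.lt_def, ctr, Fin.val_rev, Fin.val_castSucc, Fin.val_succ]
  split_ifs <;> omega

theorem dimDiff_eq {n : ℕ} (A : Mat n) :
    dimDiff A = (bil (fun i j => (A i j : ℤ)) (fun i j => (A i j : ℤ)) -
      quad fun i j => (A i j : ℤ)) / 2 := rfl

/-- The correction when a letter in the right half leaves the middle row. -/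
def midCorr {n : ℕ} (i : Fin (2 * n)) (p : Fin (2 * n + 1)) : ℤ :=
  if i.castSucc = ctr n ∧ ctr n < p then 1 else 0

/-- The change of the normalising exponent when a letter `p` moves from row `i` to row `i + 1`. The
numerator changes by an even number, so that the rounding in the definition of `dimDiff` is
harmless. -/
theorem dimDiff_move {n : ℕ} {A C : Mat n} {i : Fin (2 * n)} {p : Fin (2 * n + 1)}
    (hA : ∀ i j, A i.rev j.rev = A i j) (h : A + Eth i.succ p = C + Eth i.castSucc p) :
    dimDiff C = dimDiff A + (∑ j ∈ Finset.Ioi p, (A i.succ j : ℤ) -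
      ∑ j ∈ Finset.Iio p, (A i.castSucc j : ℤ) + midCorr i p) := by
  have hC : (fun a b => (C a b : ℤ)) = (fun a b => (A a b : ℤ)) + moveMat i p := by
    funext a b
    have h1 : A a b + Eth i.succ p a b = C a b + Eth i.castSucc p a b :=
      congrFun (congrFun h a) b
    simp only [Pi.add_apply, moveMat]
    omega
  have hA' : ∀ a b : Fin (2 * n + 1), (A a.rev b.rev : ℤ) = A a b := fun a b => by rw [hA]
  have hq : quad ((fun a b => (A a b : ℤ)) + moveMat i p) = quad (fun a b => (A a b : ℤ)) +
      quad (moveMat i p) := by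
    simp only [quad, ← Finset.sum_add_distrib]
    refine Finset.sum_congr rfl fun k _ => Finset.sum_congr rfl fun l _ => ?_
    split_ifs
    · rfl
    · rfl
  rw [dimDiff_eq, dimDiff_eq, hC, bil_add_left, bil_add_right, bil_add_right, hq,
    bil_comm_of_symm (moveMat_rev i p) hA', bil_moveMat hA', bil_moveMat (moveMat_rev i p),
    moveForm_moveMat, quad_moveMat]
  rw [← Int.add_mul_ediv_right _ _ (by norm_num : (2 : ℤ) ≠ 0)]
  congr 1
  simp only [moveForm, midCorr]
  ring

theorem dimDiff_diagonal {n : ℕ} (d : Fin (2 * n + 1) → ℕ) : dimDiff (Matrix.diagonal d) = 0 := by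
  unfold dimDiff
  rw [Finset.sum_eq_zero, Finset.sum_eq_zero]
  · rfl
  · refine fun i _ => Finset.sum_eq_zero fun j _ => ?_
    split_ifs with h
    · rw [Matrix.diagonal_apply_ne _ (by rintro rfl; omega)]
      rfl
    · rfl
  · refine fun i _ => Finset.sum_eq_zero fun j _ => Finset.sum_eq_zero fun k _ =>
      Finset.sum_eq_zero fun l _ => ?_
    split_ifs with h
    · by_cases hij : i = j
      · subst hij
        rw [Matrix.diagonal_apply_ne d (i := k) (j := l) (fun h' => (h' ▸ h.1).not_gt h.2)]
        simp
      · rw [Matrix.diagonal_apply_ne d hij]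
        simp
    · rfl

theorem diagonal_rev {N : ℕ} {d : Fin N → ℕ} (hd : ∀ i, d i.rev = d i) (i j : Fin N) :
    Matrix.diagonal d i.rev j.rev = Matrix.diagonal d i j := by
  simp only [Matrix.diagonal_apply, Fin.rev_inj, hd]

/-- The normalising exponent of a generator. -/
theorem dimDiff_gen {n r : ℕ} {i : Fin (2 * n)} {k : Comp n r} {B : Mat n}
    (hB : IsGenMat i k B) : dimDiff B = tilde k.1 i.succ := by
  rw [dimDiff_move (diagonal_rev (tilde_rev k.1)) hB.symm, dimDiff_diagonal]
  have h1 : ∑ j ∈ Finset.Ioi i.castSucc, ((Matrix.diagonal (tilde k.1) i.succ j : ℕ) : ℤ) =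
      tilde k.1 i.succ := by
    rw [Finset.sum_eq_single i.succ]
    · rw [Matrix.diagonal_apply_eq]
    · intro b _ hb
      rw [Matrix.diagonal_apply_ne _ hb.symm]
      rfl
    · intro h
      exact absurd (Finset.mem_Ioi.2 (Fin.castSucc_lt_succ)) h
  have h2 : ∑ j ∈ Finset.Iio i.castSucc, ((Matrix.diagonal (tilde k.1) i.castSucc j : ℕ) : ℤ) = 0 := by
    refine Finset.sum_eq_zero fun j hj => ?_
    rw [Matrix.diagonal_apply_ne _ (Finset.mem_Iio.1 hj).ne']
    rfl
  have h3 : midCorr i i.castSucc = 0 := if_neg (fun h => h.2.ne h.1.symm)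
  rw [h1, h2, h3]
  ring

/-! ### Products of normalised basis elements -/

theorem v_ne_zero : v ≠ 0 := RatFunc.X_ne_zero

theorem v_zpow_ne_one {a : ℤ} (ha : a ≠ 0) : v ^ a ≠ 1 := by
  have key : ∀ m : ℕ, m ≠ 0 → v ^ m ≠ 1 := by
    intro m hm h
    have h1 : algebraMap (Polynomial ℚ) Kv (Polynomial.X ^ m) = algebraMap (Polynomial ℚ) Kv 1 := by
      rw [map_pow, RatFunc.algebraMap_X, map_one]
      exact h
    have h2 := congrArg Polynomial.natDegree (RatFunc.algebraMap_injective ℚ h1)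
    rw [Polynomial.natDegree_X_pow, Polynomial.natDegree_one] at h2
    exact hm h2
  rcases Int.natAbs_eq a with h | h
  · rw [h, zpow_natCast]
    exact key _ (by omega)
  · rw [h, zpow_neg, zpow_natCast, ne_eq, inv_eq_one]
    exact key _ (by omega)

theorem qnum_succ (m : ℕ) : qnum (m + 1) = v ^ (2 * (m : ℤ)) * qbar (m + 1) := by
  have h1 : v ^ (-2 : ℤ) - 1 ≠ 0 := sub_ne_zero.2 (v_zpow_ne_one (by norm_num))
  have h2 := geom_sum_mul (v ^ 2) (m + 1)
  have hv := v_ne_zero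
  have h3 : v ^ (-2 : ℤ) * v ^ 2 = 1 := by
    rw [← zpow_natCast v 2, ← zpow_add₀ hv]
    norm_num
  have h4 : v ^ (2 * (m : ℤ)) * v ^ (-2 * ((m + 1 : ℕ) : ℤ)) = v ^ (-2 : ℤ) := by
    rw [← zpow_add₀ hv]
    congr 1
    push_cast
    ring
  have h5 : v ^ (-2 : ℤ) * (v ^ 2) ^ (m + 1) = v ^ (2 * (m : ℤ)) := by
    rw [← pow_mul, ← zpow_natCast v (2 * (m + 1)), ← zpow_add₀ hv]
    congr 1
    push_cast
    ring
  unfold qbar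
  rw [← mul_div_assoc, eq_div_iff h1, mul_sub (v ^ (2 * (m : ℤ))), h4, mul_one, qnum]
  linear_combination (-v ^ (-2 : ℤ)) * h2 + (∑ t ∈ Finset.range (m + 1), (v ^ 2) ^ t) * h3 - h5

/-- The index in `[1, n+1]` of the row `a` or of its mirror image. -/
def fold {n : ℕ} (a : Fin (2 * n + 1)) : Fin (n + 1) := ⟨min a.val (2 * n - a.val), by omega⟩

theorem tilde_eq_fold {n : ℕ} (l : Fin (n + 1) → ℕ) (j : Fin (2 * n + 1)) :
    tilde l j = if j.val = n then 2 * l (fold j) + 1 else l (fold j) := by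
  unfold tilde
  split_ifs with h
  · congr 3
    ext
    simp only [fold, Fin.val_last]
    omega
  · rfl

theorem fold_eq_fold {n : ℕ} (a j : Fin (2 * n + 1)) :
    fold j = fold a ↔ a = j ∨ a.rev = j := by
  have := a.isLt
  have := j.isLt
  simp only [fold, Fin.ext_iff, Fin.val_rev]
  omega

theorem tilde_add_single {n : ℕ} (l : Fin (n + 1) → ℕ) (a j : Fin (2 * n + 1)) :
    tilde (l + Pi.single (fold a) 1) j =
      tilde l j + ((if a = j then 1 else 0) + if a.rev = j then 1 else 0) := by
  have hr : a = a.rev ↔ a.val = n := by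
    have := a.isLt
    simp only [Fin.ext_iff, Fin.val_rev]
    omega
  rw [tilde_eq_fold, tilde_eq_fold]
  simp only [Pi.add_apply, Pi.single_apply, fold_eq_fold]
  by_cases h1 : a = j
  · subst h1
    simp only [true_or, if_true, eq_comm (a := a.rev), hr]
    split_ifs <;> ring
  · by_cases h2 : a.rev = j
    · have h3 : ¬ j.val = n := by
        intro h
        apply h1
        rw [Fin.ext_iff, Fin.val_rev] at h2
        rw [Fin.ext_iff]
        omega
      simp [h1, h2, h3]
    · simp [h1, h2]

theorem diagonal_tilde_add_single {n : ℕ} (l : Fin (n + 1) → ℕ) (a : Fin (2 * n + 1)) :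
    Matrix.diagonal (tilde (l + Pi.single (fold a) 1)) = Matrix.diagonal (tilde l) + Eth a a := by
  ext i j
  rw [Matrix.add_apply, Eth_apply]
  by_cases h : i = j
  · subst h
    rw [Matrix.diagonal_apply_eq, Matrix.diagonal_apply_eq, tilde_add_single]
    simp only [and_self]
  · rw [Matrix.diagonal_apply_ne _ h, Matrix.diagonal_apply_ne _ h,
      if_neg fun h' => h (h'.1.symm.trans h'.2), if_neg fun h' => h (h'.1.symm.trans h'.2)]
    rfl

theorem sum_Eth_row {n : ℕ} (a b j : Fin (2 * n + 1)) :
    ∑ t, Eth a b j t = (if a = j then 1 else 0) + if a.rev = j then 1 else 0 := by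
  simp only [Eth_apply, Finset.sum_add_distrib, ite_and, Finset.sum_ite_irrel, Finset.sum_ite_eq,
    Finset.mem_univ, if_true, Finset.sum_const_zero]

theorem sum_Eth_col {n : ℕ} (a b j : Fin (2 * n + 1)) :
    ∑ t, Eth a b t j = (if b = j then 1 else 0) + if b.rev = j then 1 else 0 := by
  simp only [Eth_apply, and_comm (b := _ = j), Finset.sum_add_distrib, ite_and,
    Finset.sum_ite_irrel, Finset.sum_ite_eq, Finset.mem_univ, if_true, Finset.sum_const_zero]

theorem sum_diagonal_row {N : ℕ} (d : Fin N → ℕ) (j : Fin N) :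
    ∑ t, Matrix.diagonal d j t = d j := by
  simp [Matrix.diagonal_apply]

theorem sum_diagonal_col {N : ℕ} (d : Fin N → ℕ) (j : Fin N) :
    ∑ t, Matrix.diagonal d t j = d j := by
  simp [Matrix.diagonal_apply]

theorem tot_Eth {n : ℕ} (a b : Fin (2 * n + 1)) : tot (Eth a b) = 2 := by
  simp only [tot, sum_Eth_row, Finset.sum_add_distrib, Finset.sum_ite_eq, Finset.mem_univ, if_true]

theorem ent_brk {n r : ℕ} (A : Mat n) (l m : Comp n r) :
    ent (brk r A) l m = v ^ (-dimDiff A) • dcSum l m A := by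
  rw [brk, ent_smul, ent_e]

/-- The pairing of `λ̃` with `j`. -/
def dotp {n : ℕ} (l : Fin (n + 1) → ℕ) (j : Fin (2 * n + 1) → ℤ) : ℤ := ∑ i, (tilde l i : ℤ) * j i

theorem stdElt_of_le {n r : ℕ} {A : Mat n} (h : tot A ≤ 2 * r) (j : Fin (2 * n + 1) → ℤ) :
    stdElt r A j = ∑ l ∈ Finset.piAntidiag (Finset.univ : Finset (Fin (n + 1))) (r - tot A / 2),
      v ^ dotp l j • brk r (A + Matrix.diagonal (tilde l)) := if_pos h

theorem stdElt_of_lt {n r : ℕ} {A : Mat n} (h : 2 * r < tot A) (j : Fin (2 * n + 1) → ℤ) :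
    stdElt r A j = 0 := if_neg (not_le.2 h)

theorem mem_piAntidiag_univ {n r : ℕ} {l : Fin (n + 1) → ℕ} :
    l ∈ Finset.piAntidiag (Finset.univ : Finset (Fin (n + 1))) r ↔ ∑ i, l i = r := by
  simp [Finset.mem_piAntidiag]

theorem sum_add_single {n : ℕ} (l : Fin (n + 1) → ℕ) (c : Fin (n + 1)) :
    ∑ i, (l + (Pi.single c 1 : Fin (n + 1) → ℕ)) i = ∑ i, l i + 1 := by
  simp [Finset.sum_add_distrib]

theorem exists_eq_add_single {n : ℕ} {l : Fin (n + 1) → ℕ} {c : Fin (n + 1)} (h : 1 ≤ l c) :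
    ∃ m : Fin (n + 1) → ℕ, l = m + Pi.single c 1 := by
  refine ⟨l - (Pi.single c 1 : Fin (n + 1) → ℕ), ?_⟩
  funext x
  simp only [Pi.add_apply, Pi.sub_apply, Pi.single_apply]
  split_ifs with hx
  · subst hx
    omega
  · omega

theorem Moved.one_le {n r : ℕ} {i : Fin (2 * n)} {l k : Comp n r} (h : Moved i l k) :
    1 ≤ k.1 (fold i.castSucc) := by
  have h1 := h i.castSucc
  rw [tilde_eq_fold, tilde_eq_fold] at h1
  have h2 := i.isLt
  simp only [Fin.ext_iff, Fin.val_rev, Fin.val_castSucc, Fin.val_succ] at h1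
  split_ifs at h1 <;> omega

theorem moved_of_cosetMatrix {n r : ℕ} {i : Fin (2 * n)} {l k : Comp n r} {C : Mat n}
    {A : Mat n} {p : Fin (2 * n + 1)} (h : A + Eth i.succ p = C + Eth i.castSucc p)
    (hA : ∀ j, ∑ b, A j b = tilde k.1 j) (hC : ∀ j, ∑ b, C j b = tilde l.1 j) : Moved i l k := by
  intro j
  have h1 : ∑ b, (A + Eth i.succ p) j b = ∑ b, (C + Eth i.castSucc p) j b := by rw [h]
  simp only [Matrix.add_apply, Finset.sum_add_distrib, sum_Eth_row, hA, hC] at h1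
  simp only [eq_comm (a := j)]
  omega

/-- At most one of the terms of `E^θ_{i+1,i}(0)` contributes to a given entry. -/
theorem ent_gen {n r : ℕ} {i : Fin (2 * n)} {l k : Comp n r} (h : Moved i l k) :
    ∃ B : Mat n, IsGenMat i k B ∧ ent (stdElt r (Eth i.succ i.castSucc) 0) l k =
      v ^ (-(tilde k.1 i.succ : ℤ)) • dcSum l k B := by
  obtain ⟨m, hm⟩ := exists_eq_add_single h.one_le
  have hr : ∑ c, m c + 1 = r := by rw [← sum_add_single, ← hm, k.2]
  have hB : IsGenMat i k (Eth i.succ i.castSucc + Matrix.diagonal (tilde m)) := by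
    unfold IsGenMat
    rw [hm, diagonal_tilde_add_single]
    abel
  refine ⟨_, hB, ?_⟩
  rw [stdElt_of_le (by rw [tot_Eth]; omega), ent_sum, Finset.sum_eq_single m, ent_smul, ent_brk,
    dimDiff_gen hB]
  · simp [dotp]
  · intro m' _ hne
    rw [ent_smul, ent_brk]
    have : ∃ j, ∑ t, (Eth i.succ i.castSucc + Matrix.diagonal (tilde m')) t j ≠ tilde k.1 j := by
      by_contra! h1
      apply hne
      apply tilde_injective
      funext j
      have h2 := h1 j
      simp only [Matrix.add_apply, Finset.sum_add_distrib, sum_Eth_col, sum_diagonal_col] at h2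
      rw [hm, tilde_add_single] at h2
      omega
    obtain ⟨j, hj⟩ := this
    rw [dcSum_eq_zero_of_col hj, smul_zero, smul_zero]
  · intro h1
    exact absurd (mem_piAntidiag_univ.2 (by rw [tot_Eth]; omega)) h1

theorem ent_gen_of_not {n r : ℕ} {i : Fin (2 * n)} {l k : Comp n r} (h : ¬ Moved i l k) :
    ent (stdElt r (Eth i.succ i.castSucc) 0) l k = 0 := by
  by_cases hr : 2 ≤ 2 * r
  · rw [stdElt_of_le (by rwa [tot_Eth]), ent_sum]
    refine Finset.sum_eq_zero fun m _ => ?_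
    rw [ent_smul, ent_brk, dcSum_eq_zero, smul_zero, smul_zero]
    intro w hw
    apply h
    intro j
    have h1 := sum_cosetMatrix_row l k w j
    have h2 := sum_cosetMatrix_col l k w j
    rw [hw] at h1 h2
    simp only [Matrix.add_apply, Finset.sum_add_distrib, sum_Eth_col, sum_diagonal_col,
      sum_Eth_row, sum_diagonal_row] at h1 h2
    simp only [eq_comm (a := j)]
    omega
  · rw [stdElt_of_lt (by rw [tot_Eth]; omega)]
    rfl

/-- The exponent of the term that moves a letter `p` from row `i` to row `i + 1`. -/
def gam {n : ℕ} (A : Mat n) (i : Fin (2 * n)) (p : Fin (2 * n + 1)) : ℤ :=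
  ∑ j ∈ Finset.Iic p, (A i.succ j : ℤ) - ∑ j ∈ Finset.Iio p, (A i.castSucc j : ℤ) + midCorr i p

open Classical in
/-- The multiplication rule for normalised basis elements. The powers of `v` from the normalisations
of the generator and of the two basis elements combine to the exponent `gam`, in which the row sums
no longer occur. -/
theorem gen_mul_brk {n r : ℕ} (i : Fin (2 * n)) {A : Mat n} (hA : ∀ a b, A a.rev b.rev = A a b)
    (k : Comp n r) (hk : ∀ j, ∑ b, A j b = tilde k.1 j) :
    stdElt r (Eth i.succ i.castSucc) 0 * brk r A = ∑ p with CanMove A i p,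
      (v ^ gam A i p * qbar (A i.succ p + 1)) • brk r (A + Eth i.succ p - Eth i.castSucc p) := by
  apply schur_ext
  intro l m
  rw [ent_mul, Finset.sum_eq_single k, ent_sum]
  · by_cases h : Moved i l k
    · obtain ⟨B, hB, hent⟩ := ent_gen h
      rw [hent, ent_brk, smul_mul_smul_comm, dcSum_mul_dcSum h hB, smul_comm _ (poinc k), smul_smul,
        inv_mul_cancel₀ (poinc_ne_zero k), one_smul, Finset.smul_sum]
      refine Finset.sum_congr rfl fun p hp => ?_
      have hmove := add_sub_Eth_eq_iff.2 ⟨(Finset.mem_filter.1 hp).2, rfl⟩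
      rw [ent_smul, ent_brk, smul_smul, smul_smul, dimDiff_move hA hmove, qnum_succ, ← pow_mul,
        ← zpow_natCast v]
      congr 1
      have hsum : (tilde k.1 i.succ : ℤ) = ∑ j ∈ Finset.Iio p, (A i.succ j : ℤ) + A i.succ p +
          ∑ j ∈ Finset.Ioi p, (A i.succ j : ℤ) := by
        rw [← hk, ← Finset.sum_erase_add _ _ (Finset.mem_univ p)]
        have : Finset.univ.erase p = Finset.Iio p ∪ Finset.Ioi p := by
          ext j
          simp only [Finset.mem_erase, Finset.mem_univ, and_true, Finset.mem_union, Finset.mem_Iio,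
            Finset.mem_Ioi]
          exact ne_iff_lt_or_gt
        rw [this, Finset.sum_union]
        · push_cast
          ring
        · rw [Finset.disjoint_left]
          intro j h1 h2
          exact lt_asymm (Finset.mem_Iio.1 h1) (Finset.mem_Ioi.1 h2)
      have hIic : ∑ j ∈ Finset.Iic p, (A i.succ j : ℤ) =
          ∑ j ∈ Finset.Iio p, (A i.succ j : ℤ) + A i.succ p := by
        rw [← Finset.Iio_insert p, Finset.sum_insert (by simp), add_comm]
      rw [gam, hIic, hsum]
      rw [← mul_assoc, ← mul_assoc, ← zpow_add₀ v_ne_zero, ← zpow_add₀ v_ne_zero,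
        ← zpow_add₀ v_ne_zero, mul_right_comm, ← zpow_add₀ v_ne_zero]
      congr 2
      push_cast
      ring
    · rw [ent_gen_of_not h, zero_mul, smul_zero]
      refine (Finset.sum_eq_zero fun p hp => ?_).symm
      rw [ent_smul, ent_brk, dcSum_eq_zero, smul_zero, smul_zero]
      intro w hw
      have hmove := add_sub_Eth_eq_iff.2 ⟨(Finset.mem_filter.1 hp).2, rfl⟩
      refine h (moved_of_cosetMatrix hmove hk fun j => ?_)
      rw [← hw, sum_cosetMatrix_row]
  · intro k' _ hk'
    have : ∃ j, ∑ b, A j b ≠ tilde k'.1 j := by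
      by_contra! h1
      exact hk' (comp_ext (funext fun j => by rw [← h1, hk]))
    obtain ⟨j, hj⟩ := this
    rw [ent_brk, dcSum_eq_zero_of_row hj, smul_zero, mul_zero, smul_zero]
  · intro h
    exact absurd (Finset.mem_univ k) h

/-! ### Stabilisation of the multiplication by a generator -/

theorem dotp_add {n : ℕ} (l : Fin (n + 1) → ℕ) (j j' : Fin (2 * n + 1) → ℤ) :
    dotp l (j + j') = dotp l j + dotp l j' := by
  simp only [dotp, Pi.add_apply, mul_add, Finset.sum_add_distrib]

theorem dotp_neg {n : ℕ} (l : Fin (n + 1) → ℕ) (j : Fin (2 * n + 1) → ℤ) :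
    dotp l (-j) = -dotp l j := by
  simp only [dotp, Pi.neg_apply, mul_neg, Finset.sum_neg_distrib]

theorem dotp_sub {n : ℕ} (l : Fin (n + 1) → ℕ) (j j' : Fin (2 * n + 1) → ℤ) :
    dotp l (j - j') = dotp l j - dotp l j' := by
  rw [sub_eq_add_neg, dotp_add, dotp_neg, sub_eq_add_neg]

theorem dotp_zero {n : ℕ} (l : Fin (n + 1) → ℕ) : dotp l 0 = 0 := by
  simp [dotp]

theorem dotp_unitVec {n : ℕ} (l : Fin (n + 1) → ℕ) (a : Fin (2 * n + 1)) :
    dotp l (unitVec a) = tilde l a := by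
  simp [dotp, unitVec, Pi.single_apply]

theorem dotp_add_single {n : ℕ} (l : Fin (n + 1) → ℕ) (a : Fin (2 * n + 1))
    (j : Fin (2 * n + 1) → ℤ) :
    dotp (l + Pi.single (fold a) 1) j = dotp l j + j a + j a.rev := by
  simp only [dotp, tilde_add_single, Nat.cast_add, Nat.cast_ite, Nat.cast_one, Nat.cast_zero,
    add_mul, Finset.sum_add_distrib, ite_mul, one_mul, zero_mul, Finset.sum_ite_eq,
    Finset.mem_univ, if_true, add_assoc]

theorem two_mul_dotp {n : ℕ} (l : Fin (n + 1) → ℕ) (j : Fin (2 * n + 1) → ℤ) :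
    2 * dotp l j = ∑ i, (tilde l i : ℤ) * (j i + j i.rev) := by
  have : ∑ i, (tilde l i : ℤ) * j i.rev = dotp l j := by
    rw [dotp, ← Equiv.sum_comp Fin.revPerm]
    simp only [Fin.revPerm_apply, Fin.rev_rev, tilde_rev]
  simp only [mul_add, Finset.sum_add_distrib, this]
  rw [dotp]
  ring

theorem stdElt_symm {n : ℕ} (r : ℕ) (A : Mat n) {j j' : Fin (2 * n + 1) → ℤ}
    (h : ∀ i, j i + j i.rev = j' i + j' i.rev) : stdElt r A j = stdElt r A j' := by
  by_cases hr : tot A ≤ 2 * r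
  · rw [stdElt_of_le hr, stdElt_of_le hr]
    refine Finset.sum_congr rfl fun l _ => ?_
    have h1 := two_mul_dotp l j
    have h2 := two_mul_dotp l j'
    simp only [h] at h1
    rw [show dotp l j = dotp l j' by linarith]
  · rw [stdElt_of_lt (not_le.1 hr), stdElt_of_lt (not_le.1 hr)]

/-- Symmetric vectors with an odd middle entry are of the form `λ̃`. -/
theorem exists_tilde_eq {n : ℕ} {f : Fin (2 * n + 1) → ℕ} (hf : ∀ i, f i.rev = f i)
    (ho : f (ctr n) % 2 = 1) : ∃ k : Fin (n + 1) → ℕ, tilde k = f := by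
  refine ⟨fun c => if c = Fin.last n then f (ctr n) / 2 else f (idx c), ?_⟩
  funext j
  rw [tilde_eq_fold]
  have hj := j.isLt
  split_ifs with h1 h2 h2
  · have : j = ctr n := Fin.ext h1
    rw [this]
    omega
  · exact absurd (Fin.ext (by simp only [fold, Fin.val_last]; omega)) h2
  · simp only [fold, Fin.ext_iff, Fin.val_last] at h2
    omega
  · by_cases h3 : j.val < n
    · congr 1
      ext
      simp only [idx, fold]
      omega
    · rw [← hf]
      congr 1
      ext
      simp only [idx, fold, Fin.val_rev]
      omega

theorem row_sum_rev {n : ℕ} {A : Mat n} (hA : ∀ a b, A a.rev b.rev = A a b)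
    (j : Fin (2 * n + 1)) : ∑ b, A j.rev b = ∑ b, A j b := by
  rw [← Equiv.sum_comp Fin.revPerm]
  simp only [Fin.revPerm_apply, hA]

/-- The middle row of `A` has an even sum, because its middle entry is zero. -/
theorem exists_row_sum {n : ℕ} {A : Mat n} (hA : A ∈ Xi0 n) (l : Fin (n + 1) → ℕ) :
    ∃ k : Fin (n + 1) → ℕ, tilde k = fun j => ∑ b, (A + Matrix.diagonal (tilde l)) j b := by
  apply exists_tilde_eq
  · exact row_sum_rev fun a b => by
      rw [Matrix.add_apply, Matrix.add_apply, hA.1, diagonal_rev (tilde_rev l)]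
  · have h1 := sum_fold (fun b => A (ctr n) b) fun b => by
      have := hA.1 (ctr n) b
      rwa [rev_eq_self.2 rfl] at this
    simp only [hA.2] at h1
    simp only [Matrix.add_apply, Finset.sum_add_distrib, sum_diagonal_row, tilde_ctr, h1]
    omega

theorem sum_of_row_sum {n : ℕ} {A : Mat n} {l k : Fin (n + 1) → ℕ}
    (h : tilde k = fun j => ∑ b, (A + Matrix.diagonal (tilde l)) j b) :
    2 * ∑ i, k i = tot A + 2 * ∑ i, l i := by
  have h1 := sum_tilde k
  rw [h] at h1
  simp only [Matrix.add_apply, Finset.sum_add_distrib, sum_diagonal_row, sum_tilde] at h1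
  rw [tot]
  omega

theorem two_dvd_tot {n : ℕ} {A : Mat n} (hA : A ∈ Xi0 n) : 2 ∣ tot A := by
  obtain ⟨k, hk⟩ := exists_row_sum hA 0
  have := sum_of_row_sum hk
  simp only [Pi.zero_apply, Finset.sum_const_zero] at this
  omega

/-- Compositions of `s + 1` with a nonzero part `c` correspond to compositions of `s`. -/
theorem sum_piAntidiag_succ {n s : ℕ} {M : Type*} [AddCommMonoid M] (c : Fin (n + 1))
    (F : (Fin (n + 1) → ℕ) → M) :
    (∑ l ∈ Finset.piAntidiag (Finset.univ : Finset (Fin (n + 1))) (s + 1),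
      if 1 ≤ l c then F l else 0) =
    ∑ l ∈ Finset.piAntidiag (Finset.univ : Finset (Fin (n + 1))) s, F (l + Pi.single c 1) := by
  rw [← Finset.sum_filter]
  symm
  refine Finset.sum_bij (fun l _ => l + Pi.single c 1) ?_ ?_ ?_ ?_
  · intro l hl
    rw [mem_piAntidiag_univ] at hl
    rw [Finset.mem_filter, mem_piAntidiag_univ, sum_add_single, hl]
    simp
  · intro l _ m _ h
    exact add_right_cancel h
  · intro l hl
    rw [Finset.mem_filter, mem_piAntidiag_univ] at hl
    obtain ⟨m, rfl⟩ := exists_eq_add_single hl.2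
    rw [sum_add_single] at hl
    exact ⟨m, mem_piAntidiag_univ.2 (by omega), rfl⟩
  · intros
    rfl

theorem sum_piAntidiag_zero {n : ℕ} {M : Type*} [AddCommMonoid M] (c : Fin (n + 1))
    (F : (Fin (n + 1) → ℕ) → M) :
    (∑ l ∈ Finset.piAntidiag (Finset.univ : Finset (Fin (n + 1))) 0,
      if 1 ≤ l c then F l else 0) = 0 := by
  refine Finset.sum_eq_zero fun l hl => ?_
  rw [mem_piAntidiag_univ] at hl
  have := Finset.single_le_sum (f := l) (fun i _ => Nat.zero_le _) (Finset.mem_univ c)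
  exact if_neg (by omega)

theorem castSucc_ne_succ {N : ℕ} (i : Fin N) : i.castSucc ≠ i.succ := by
  simp only [ne_eq, Fin.ext_iff, Fin.val_castSucc, Fin.val_succ]
  omega

theorem Eth_le {n : ℕ} {A : Mat n} (hA : ∀ a b, A a.rev b.rev = A a b) {x p : Fin (2 * n + 1)}
    (hp : p ≠ x) (h : 1 ≤ A x p) (a b : Fin (2 * n + 1)) : Eth x p a b ≤ A a b := by
  rw [Eth_apply]
  by_cases h1 : x = a ∧ p = b
  · rw [if_pos h1, ← h1.1, ← h1.2, if_neg]
    · exact h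
    · rintro ⟨h2, h3⟩
      exact hp ((rev_eq_self.1 h3).trans (rev_eq_self.1 h2).symm)
  · rw [if_neg h1]
    split_ifs with h2
    · rw [← h2.1, ← h2.2, hA]
      omega
    · omega

theorem canMove_iff {n : ℕ} {A : Mat n} (hA : ∀ a b, A a.rev b.rev = A a b) {i : Fin (2 * n)}
    {p : Fin (2 * n + 1)} (hp : p ≠ i.castSucc) : CanMove A i p ↔ 1 ≤ A i.castSucc p := by
  refine ⟨fun h => ?_, Eth_le hA hp⟩
  have := h i.castSucc p
  rw [Eth_apply, if_pos ⟨rfl, rfl⟩] at this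
  omega

/-- A diagonal letter of row `i` can be moved exactly if the part `λ_i` is nonzero; in the middle
row, one of the `2 λ_i + 1` diagonal letters always stays in place. -/
theorem canMove_self_iff {n : ℕ} {A : Mat n} (hA : A ∈ Xi0 n) {i : Fin (2 * n)}
    (l : Fin (n + 1) → ℕ) :
    CanMove (A + Matrix.diagonal (tilde l)) i i.castSucc ↔ 1 ≤ l (fold i.castSucc) := by
  have hr : i.castSucc.rev = i.castSucc ↔ i.val = n := by
    rw [rev_eq_self, Fin.ext_iff]
    rfl
  constructor
  · intro h
    have := h i.castSucc i.castSucc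
    rw [Matrix.add_apply, hA.2, Matrix.diagonal_apply_eq, tilde_eq_fold, Eth_apply] at this
    simp only [hr, and_self, if_true, Fin.val_castSucc] at this
    split_ifs at this <;> omega
  · intro h
    obtain ⟨m, rfl⟩ := exists_eq_add_single h
    intro a b
    rw [diagonal_tilde_add_single, Matrix.add_apply, Matrix.add_apply]
    omega

theorem gam_add_diagonal {n : ℕ} (A : Mat n) (d : Fin (2 * n + 1) → ℕ) (i : Fin (2 * n))
    (p : Fin (2 * n + 1)) : gam (A + Matrix.diagonal d) i p = gam A i p +
      (if i.succ ≤ p then (d i.succ : ℤ) else 0) - if i.castSucc < p then (d i.castSucc : ℤ) else 0 := by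
  have h : ∀ (s : Finset (Fin (2 * n + 1))) (a : Fin (2 * n + 1)),
      ∑ j ∈ s, ((A + Matrix.diagonal d) a j : ℤ) =
        ∑ j ∈ s, (A a j : ℤ) + if a ∈ s then (d a : ℤ) else 0 := by
    intro s a
    simp only [Matrix.add_apply, Nat.cast_add, Finset.sum_add_distrib, Matrix.diagonal_apply,
      Nat.cast_ite, Nat.cast_zero, Finset.sum_ite_eq]
  rw [gam, h, h, gam]
  simp only [Finset.mem_Iic, Finset.mem_Iio]
  ring

theorem tot_add {n : ℕ} (A B : Mat n) : tot (A + B) = tot A + tot B := by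
  simp only [tot, Matrix.add_apply, Finset.sum_add_distrib]

theorem tot_sub_add {n : ℕ} {A : Mat n} {i : Fin (2 * n)} {p : Fin (2 * n + 1)}
    (h : CanMove A i p) : tot (A - Eth i.castSucc p) + 2 = tot A := by
  have h1 := tot_add (A - Eth i.castSucc p) (Eth i.castSucc p)
  rw [tot_Eth] at h1
  rw [← h1]
  congr 1
  ext a b
  have := h a b
  simp only [Matrix.sub_apply, Matrix.add_apply]
  omega

theorem tot_move {n : ℕ} {A : Mat n} {i : Fin (2 * n)} {p : Fin (2 * n + 1)}
    (h : CanMove A i p) : tot (A + Eth i.succ p - Eth i.castSucc p) = tot A := by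
  have := congrArg tot (add_sub_Eth_eq_iff.2 ⟨h, rfl⟩)
  rw [tot_add, tot_add, tot_Eth, tot_Eth] at this
  omega

open Classical in
/-- The contribution to the product of the `p`-th way of moving a letter. -/
def moveTerm {n : ℕ} (r : ℕ) (A : Mat n) (j : Fin (2 * n + 1) → ℤ) (i : Fin (2 * n))
    (p : Fin (2 * n + 1)) : Schur n r :=
  ∑ l ∈ Finset.piAntidiag (Finset.univ : Finset (Fin (n + 1))) (r - tot A / 2),
    if CanMove (A + Matrix.diagonal (tilde l)) i p then
      (v ^ dotp l j * (v ^ gam (A + Matrix.diagonal (tilde l)) i p *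
        qbar ((A + Matrix.diagonal (tilde l)) i.succ p + 1))) •
        brk r (A + Matrix.diagonal (tilde l) + Eth i.succ p - Eth i.castSucc p)
    else 0

theorem gen_mul_stdElt_eq_sum {n r : ℕ} (i : Fin (2 * n)) {A : Mat n} (hA : A ∈ Xi0 n)
    (h : tot A ≤ 2 * r) (j : Fin (2 * n + 1) → ℤ) :
    stdElt r (Eth i.succ i.castSucc) 0 * stdElt r A j = ∑ p, moveTerm r A j i p := by
  unfold moveTerm
  rw [stdElt_of_le h, Finset.mul_sum, Finset.sum_comm]
  refine Finset.sum_congr rfl fun l hl => ?_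
  rw [mem_piAntidiag_univ] at hl
  obtain ⟨k, hk⟩ := exists_row_sum hA l
  have h1 := sum_of_row_sum hk
  have h2 := two_dvd_tot hA
  rw [mul_smul_comm, gen_mul_brk i (fun a b => by
      rw [Matrix.add_apply, Matrix.add_apply, hA.1, diagonal_rev (tilde_rev l)])
    ⟨k, by omega⟩ (fun a => (congrFun hk a).symm), Finset.smul_sum, Finset.sum_filter]
  refine Finset.sum_congr rfl fun p _ => ?_
  split_ifs
  · rw [smul_smul]
  · rfl

/-- Moving an off-diagonal letter to an off-diagonal position. For letters to the right of the two
diagonal positions the exponent depends on `λ`, which shifts `j`. -/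
theorem moveTerm_of_ne {n r : ℕ} {i : Fin (2 * n)} {A : Mat n} (hA : A ∈ Xi0 n)
    (h : tot A ≤ 2 * r) (j : Fin (2 * n + 1) → ℤ) {p : Fin (2 * n + 1)} (h0 : p ≠ i.castSucc)
    (h1 : p ≠ i.succ) : moveTerm r A j i p =
      if 1 ≤ A i.castSucc p then (v ^ gam A i p * qbar (A i.succ p + 1)) •
        stdElt r (A + Eth i.succ p - Eth i.castSucc p)
          (if p < i.castSucc then j else j - (unitVec i.castSucc - unitVec i.succ)) else 0 := by
  have hc : ∀ l : Fin (n + 1) → ℕ, CanMove (A + Matrix.diagonal (tilde l)) i p ↔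
      1 ≤ A i.castSucc p := by
    intro l
    rw [canMove_iff (fun a b => by
      rw [Matrix.add_apply, Matrix.add_apply, hA.1, diagonal_rev (tilde_rev l)]) h0,
      Matrix.add_apply, Matrix.diagonal_apply_ne _ h0.symm, add_zero]
  unfold moveTerm
  simp only [hc]
  split_ifs with hap hp
  all_goals first | exact Finset.sum_const_zero | skip
  all_goals
    have hcm := (canMove_iff hA.1 h0).2 hap
    have hmat : ∀ l : Fin (n + 1) → ℕ,
        A + Matrix.diagonal (tilde l) + Eth i.succ p - Eth i.castSucc p =
        A + Eth i.succ p - Eth i.castSucc p + Matrix.diagonal (tilde l) := by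
      intro l
      ext a b
      have := hcm a b
      simp only [Matrix.sub_apply, Matrix.add_apply]
      omega
    rw [stdElt_of_le (by rwa [tot_move hcm]), tot_move hcm, Finset.smul_sum]
    refine Finset.sum_congr rfl fun l _ => ?_
    rw [smul_smul, hmat, gam_add_diagonal, Matrix.add_apply, Matrix.diagonal_apply_ne _ h1.symm,
      add_zero]
    congr 1
  · rw [if_neg, if_neg hp.not_gt, add_zero, sub_zero]
    · ring
    · intro h2
      simp only [Fin.lt_def, Fin.le_def, Fin.val_castSucc, Fin.val_succ] at hp h2
      omega
  · have h2 : i.castSucc < p := lt_of_le_of_ne (not_lt.1 hp) h0.symm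
    rw [if_pos h2, if_pos, dotp_sub, dotp_sub, dotp_unitVec, dotp_unitVec, ← mul_assoc,
      ← zpow_add₀ v_ne_zero, mul_right_comm, ← zpow_add₀ v_ne_zero]
    · congr 2
      ring
    · simp only [Fin.lt_def, Fin.le_def, Fin.val_castSucc, Fin.val_succ] at h2 ⊢
      omega

/-- Moving a diagonal letter of row `i`: the part `λ_i` decreases by one. -/
theorem moveTerm_castSucc {n r : ℕ} (i : Fin (2 * n)) {A : Mat n} (hA : A ∈ Xi0 n)
    (h : tot A ≤ 2 * r) (j : Fin (2 * n + 1) → ℤ) :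
    moveTerm r A j i i.castSucc =
      (v ^ (gam A i i.castSucc + j i.castSucc + j i.castSucc.rev) *
        qbar (A i.succ i.castSucc + 1)) • stdElt r (A + Eth i.succ i.castSucc) j := by
  have h2 := two_dvd_tot hA
  unfold moveTerm
  simp only [canMove_self_iff hA]
  rcases hs : r - tot A / 2 with _ | s
  · rw [sum_piAntidiag_zero, stdElt_of_lt (by rw [tot_add, tot_Eth]; omega), smul_zero]
  · rw [sum_piAntidiag_succ, stdElt_of_le (by rw [tot_add, tot_Eth]; omega), tot_add, tot_Eth,
      show r - (tot A + 2) / 2 = s by omega, Finset.smul_sum]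
    refine Finset.sum_congr rfl fun l _ => ?_
    have hmat : A + Matrix.diagonal (tilde (l + Pi.single (fold i.castSucc) 1)) +
        Eth i.succ i.castSucc - Eth i.castSucc i.castSucc =
        A + Eth i.succ i.castSucc + Matrix.diagonal (tilde l) := by
      rw [diagonal_tilde_add_single]
      ext a b
      simp only [Matrix.sub_apply, Matrix.add_apply]
      omega
    rw [smul_smul, hmat, gam_add_diagonal, Matrix.add_apply,
      Matrix.diagonal_apply_ne _ (castSucc_ne_succ i).symm, if_neg (lt_irrefl _), if_neg,
      dotp_add_single, add_zero, add_zero, sub_zero, ← mul_assoc, ← zpow_add₀ v_ne_zero,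
      mul_right_comm, ← zpow_add₀ v_ne_zero]
    · congr 3
      ring
    · simp only [Fin.le_def, Fin.val_castSucc, Fin.val_succ]
      omega

/-- The quantum integer as a difference of two powers of `v`, which gives the two terms of
`moveTerm_succ`. -/
theorem qbar_succ_eq (m : ℕ) (x : ℤ) :
    v ^ (x + m) * qbar (m + 1) =
      v ^ (x - 1) / (1 - v ^ (-2 : ℤ)) * (v ^ ((m : ℤ) + 1) - v ^ (-((m : ℤ) + 1))) := by
  have h1 : (1 : Kv) - v ^ (-2 : ℤ) ≠ 0 := sub_ne_zero.2 (v_zpow_ne_one (by norm_num)).symm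
  have h2 : v ^ (-2 : ℤ) - 1 ≠ 0 := sub_ne_zero.2 (v_zpow_ne_one (by norm_num))
  have h3 : v ^ (x + m) * v ^ (-2 * ((m + 1 : ℕ) : ℤ)) = v ^ (x - 1) * v ^ (-((m : ℤ) + 1)) := by
    rw [← zpow_add₀ v_ne_zero, ← zpow_add₀ v_ne_zero]
    congr 1
    push_cast
    ring
  have h4 : v ^ (x + m) = v ^ (x - 1) * v ^ ((m : ℤ) + 1) := by
    rw [← zpow_add₀ v_ne_zero]
    congr 1
    ring
  unfold qbar
  rw [← mul_div_assoc, div_mul_eq_mul_div, div_eq_div_iff h2 h1]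
  linear_combination (1 - v ^ (-2 : ℤ)) * h3 - (1 - v ^ (-2 : ℤ)) * h4

/-- The number `1` if row `i + 1` is the middle row, and `0` otherwise. -/
def midDelta {n : ℕ} (i : Fin (2 * n)) : ℤ := if i.succ = ctr n then 1 else 0

theorem tilde_add_single_succ {n : ℕ} (i : Fin (2 * n)) (l : Fin (n + 1) → ℕ) :
    (tilde (l + Pi.single (fold i.succ) 1) i.succ : ℤ) = tilde l i.succ + 1 + midDelta i := by
  rw [tilde_add_single, if_pos rfl, midDelta]
  simp only [rev_eq_self]
  push_cast
  ring

theorem tilde_succ_of_eq_zero {n : ℕ} (i : Fin (2 * n)) {l : Fin (n + 1) → ℕ}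
    (h : l (fold i.succ) = 0) : (tilde l i.succ : ℤ) = midDelta i := by
  rw [tilde_eq_fold, h, midDelta]
  simp only [Fin.ext_iff, ctr]
  split_ifs <;> rfl

/-- The terms in which the last diagonal entry of row `i + 1` is removed cancel in the difference
below, so the sum runs over compositions with a letter to spare. -/
theorem sub_stdElt_eq_sum {n r : ℕ} (i : Fin (2 * n)) (A : Mat n) (j : Fin (2 * n + 1) → ℤ)
    (h : tot A ≤ 2 * r) :
    v ^ (-midDelta i) • stdElt r A (j - (unitVec i.castSucc - unitVec i.succ))
      - v ^ midDelta i • stdElt r A (j + (-unitVec i.castSucc - unitVec i.succ)) =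
    ∑ l ∈ Finset.piAntidiag (Finset.univ : Finset (Fin (n + 1))) (r - tot A / 2),
      if 1 ≤ l (fold i.succ) then
        (v ^ (dotp l j - tilde l i.castSucc) *
          (v ^ ((tilde l i.succ : ℤ) - midDelta i) - v ^ (-((tilde l i.succ : ℤ) - midDelta i)))) •
        brk r (A + Matrix.diagonal (tilde l))
      else 0 := by
  rw [stdElt_of_le h, stdElt_of_le h, Finset.smul_sum, Finset.smul_sum, ← Finset.sum_sub_distrib]
  refine Finset.sum_congr rfl fun l _ => ?_
  have h1 : v ^ (-midDelta i) * v ^ dotp l (j - (unitVec i.castSucc - unitVec i.succ)) -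
      v ^ midDelta i * v ^ dotp l (j + (-unitVec i.castSucc - unitVec i.succ)) =
      v ^ (dotp l j - tilde l i.castSucc) *
        (v ^ ((tilde l i.succ : ℤ) - midDelta i) - v ^ (-((tilde l i.succ : ℤ) - midDelta i))) := by
    simp only [dotp_sub, dotp_add, dotp_neg, dotp_unitVec, mul_sub, ← zpow_add₀ v_ne_zero]
    congr 2 <;> ring
  rw [smul_smul, smul_smul, ← sub_smul, h1]
  split_ifs with h2
  · rfl
  · rw [tilde_succ_of_eq_zero i (by omega), sub_self, neg_zero, sub_self, mul_zero, zero_smul]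

/-- Moving a letter onto the diagonal of row `i + 1`: the part `λ_{i+1}` increases by one, and the
quantum integer depends on it. -/
theorem moveTerm_succ {n r : ℕ} (i : Fin (2 * n)) {A : Mat n} (hA : A ∈ Xi0 n)
    (h : tot A ≤ 2 * r) (j : Fin (2 * n + 1) → ℤ) :
    moveTerm r A j i i.succ =
      if 1 ≤ A i.castSucc i.succ then
        (v ^ (gam A i i.succ - j i.succ - j i.succ.rev - 1) / (1 - v ^ (-2 : ℤ))) •
          (v ^ (-midDelta i) • stdElt r (A - Eth i.castSucc i.succ)
              (j - (unitVec i.castSucc - unitVec i.succ))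
            - v ^ midDelta i • stdElt r (A - Eth i.castSucc i.succ)
              (j + (-unitVec i.castSucc - unitVec i.succ)))
      else 0 := by
  have hc : ∀ l : Fin (n + 1) → ℕ, CanMove (A + Matrix.diagonal (tilde l)) i i.succ ↔
      1 ≤ A i.castSucc i.succ := by
    intro l
    rw [canMove_iff (fun a b => by
      rw [Matrix.add_apply, Matrix.add_apply, hA.1, diagonal_rev (tilde_rev l)])
      (castSucc_ne_succ i).symm, Matrix.add_apply, Matrix.diagonal_apply_ne _ (castSucc_ne_succ i),
      add_zero]
  unfold moveTerm
  simp only [hc]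
  split_ifs with hap
  swap
  · exact Finset.sum_const_zero
  have hcm := (canMove_iff hA.1 (castSucc_ne_succ i).symm).2 hap
  have ht := tot_sub_add hcm
  have h2 := two_dvd_tot hA
  rw [sub_stdElt_eq_sum i _ j (by omega),
    show r - tot (A - Eth i.castSucc i.succ) / 2 = r - tot A / 2 + 1 by omega, sum_piAntidiag_succ,
    Finset.smul_sum]
  refine Finset.sum_congr rfl fun l _ => ?_
  have hmat : A + Matrix.diagonal (tilde l) + Eth i.succ i.succ - Eth i.castSucc i.succ =
      A - Eth i.castSucc i.succ + Matrix.diagonal (tilde (l + Pi.single (fold i.succ) 1)) := by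
    rw [diagonal_tilde_add_single]
    ext a b
    have := hcm a b
    simp only [Matrix.sub_apply, Matrix.add_apply]
    omega
  have h0 : tilde (l + Pi.single (fold i.succ) 1) i.castSucc = tilde l i.castSucc := by
    rw [tilde_add_single, if_neg (castSucc_ne_succ i).symm,
      if_neg (castSucc_ne_rev_succ i).symm]
    rfl
  rw [smul_smul, hmat, tilde_add_single_succ, add_sub_cancel_right, h0, dotp_add_single,
    gam_add_diagonal, if_pos le_rfl, if_pos (Fin.castSucc_lt_succ (i := i)), Matrix.add_apply, hA.2,
    Matrix.diagonal_apply_eq, zero_add, ← mul_assoc, ← zpow_add₀ v_ne_zero]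
  rw [show dotp l j + (gam A i i.succ + (tilde l i.succ : ℤ) - tilde l i.castSucc) =
      dotp l j + gam A i i.succ - tilde l i.castSucc + tilde l i.succ by ring, qbar_succ_eq,
    ← mul_assoc, div_mul_eq_mul_div (v ^ (gam A i i.succ - j i.succ - j i.succ.rev - 1)),
    ← zpow_add₀ v_ne_zero]
  congr 4
  ring

theorem sub_stdElt_eq_zero {n r : ℕ} (i : Fin (2 * n)) {A : Mat n} (hA : A ∈ Xi0 n)
    (j : Fin (2 * n + 1) → ℤ) (h : 2 * r < tot A) (hap : 1 ≤ A i.castSucc i.succ) :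
    v ^ (-midDelta i) • stdElt r (A - Eth i.castSucc i.succ)
        (j - (unitVec i.castSucc - unitVec i.succ))
      - v ^ midDelta i • stdElt r (A - Eth i.castSucc i.succ)
        (j + (-unitVec i.castSucc - unitVec i.succ)) = 0 := by
  have hcm := (canMove_iff hA.1 (castSucc_ne_succ i).symm).2 hap
  have ht := tot_sub_add hcm
  have h2 := two_dvd_tot hA
  by_cases h3 : tot (A - Eth i.castSucc i.succ) ≤ 2 * r
  · rw [sub_stdElt_eq_sum i _ j h3,
      show r - tot (A - Eth i.castSucc i.succ) / 2 = 0 by omega, sum_piAntidiag_zero]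
  · rw [stdElt_of_lt (not_le.1 h3), stdElt_of_lt (not_le.1 h3), smul_zero, smul_zero, sub_zero]

theorem sum_split {n : ℕ} {M : Type*} [AddCommMonoid M] (i : Fin (2 * n))
    (f : Fin (2 * n + 1) → M) : ∑ p, f p =
      ∑ p with p < i.castSucc, f p + f i.castSucc + f i.succ + ∑ p with i.succ < p, f p := by
  have h1 : (Finset.univ : Finset (Fin (2 * n + 1))) =
      insert i.castSucc (insert i.succ ((Finset.univ.filter fun p => p < i.castSucc) ∪
        Finset.univ.filter fun p => i.succ < p)) := by
    ext p
    simp only [Finset.mem_univ, Finset.mem_insert, Finset.mem_union, Finset.mem_filter, true_and,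
      Fin.ext_iff, Fin.lt_def, Fin.val_castSucc, Fin.val_succ, true_iff]
    omega
  rw [h1, Finset.sum_insert, Finset.sum_insert, Finset.sum_union, ← h1]
  · abel
  · rw [Finset.disjoint_left]
    intro p
    simp only [Finset.mem_filter, Finset.mem_univ, true_and, Fin.lt_def, Fin.val_castSucc,
      Fin.val_succ]
    omega
  · simp only [Finset.mem_union, Finset.mem_filter, Finset.mem_univ, true_and, Fin.lt_def,
      Fin.val_castSucc, Fin.val_succ]
    omega
  · simp only [Finset.mem_insert, Finset.mem_union, Finset.mem_filter, Finset.mem_univ, true_and,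
      Fin.lt_def, Fin.ext_iff, Fin.val_castSucc, Fin.val_succ]
    omega

/-- The multiplication formula for the generator that moves a letter from row `i` to row `i + 1`.
The two families of formulas in the presentation are the cases where row `i` lies in the upper half,
and, after a reflection of the indices, in the lower half. -/
theorem gen_mul_stdElt {n : ℕ} (r : ℕ) (i : Fin (2 * n)) {A : Mat n} (hA : A ∈ Xi0 n)
    (j : Fin (2 * n + 1) → ℤ) :
    stdElt r (Eth i.succ i.castSucc) 0 * stdElt r A j =
      (∑ p with p < i.castSucc ∧ 1 ≤ A i.castSucc p, (v ^ gam A i p * qbar (A i.succ p + 1)) •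
        stdElt r (A + Eth i.succ p - Eth i.castSucc p) j)
      + (v ^ (gam A i i.castSucc + j i.castSucc + j i.castSucc.rev) *
          qbar (A i.succ i.castSucc + 1)) • stdElt r (A + Eth i.succ i.castSucc) j
      + (if 1 ≤ A i.castSucc i.succ then
          (v ^ (gam A i i.succ - j i.succ - j i.succ.rev - 1) / (1 - v ^ (-2 : ℤ))) •
            (v ^ (-midDelta i) • stdElt r (A - Eth i.castSucc i.succ)
                (j - (unitVec i.castSucc - unitVec i.succ))
              - v ^ midDelta i • stdElt r (A - Eth i.castSucc i.succ)
                (j + (-unitVec i.castSucc - unitVec i.succ)))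
        else 0)
      + ∑ p with i.succ < p ∧ 1 ≤ A i.castSucc p, (v ^ gam A i p * qbar (A i.succ p + 1)) •
        stdElt r (A + Eth i.succ p - Eth i.castSucc p)
          (j - (unitVec i.castSucc - unitVec i.succ)) := by
  by_cases h : tot A ≤ 2 * r
  · rw [gen_mul_stdElt_eq_sum i hA h, sum_split i, moveTerm_castSucc i hA h, moveTerm_succ i hA h]
    simp only [← Finset.filter_filter]
    congr 1
    · congr 2
      rw [Finset.sum_filter fun p => 1 ≤ A i.castSucc p]
      refine Finset.sum_congr rfl fun p hp => ?_
      have hp := (Finset.mem_filter.1 hp).2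
      rw [moveTerm_of_ne hA h j hp.ne (hp.trans Fin.castSucc_lt_succ).ne, if_pos hp]
    · rw [Finset.sum_filter fun p => 1 ≤ A i.castSucc p]
      refine Finset.sum_congr rfl fun p hp => ?_
      have hp := (Finset.mem_filter.1 hp).2
      have hp' := Fin.castSucc_lt_succ.trans hp
      rw [moveTerm_of_ne hA h j hp'.ne' hp.ne', if_neg hp'.not_gt]
  · rw [not_le] at h
    have h1 : ∀ p, p ≠ i.castSucc → 1 ≤ A i.castSucc p → ∀ j,
        stdElt r (A + Eth i.succ p - Eth i.castSucc p) j = 0 := by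
      intro p hp hap j
      exact stdElt_of_lt (by rwa [tot_move ((canMove_iff hA.1 hp).2 hap)]) j
    rw [stdElt_of_lt h, mul_zero, stdElt_of_lt (A := A + _) (by rw [tot_add]; omega), smul_zero,
      Finset.sum_eq_zero, Finset.sum_eq_zero, add_zero, add_zero, zero_add]
    · split_ifs with hap
      · rw [sub_stdElt_eq_zero i hA j h hap, smul_zero]
      · rfl
    · intro p hp
      have hp := (Finset.mem_filter.1 hp).2
      rw [h1 p (Fin.castSucc_lt_succ.trans hp.1).ne' hp.2, smul_zero]
    · intro p hp
      have hp := (Finset.mem_filter.1 hp).2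
      rw [h1 p hp.1.ne hp.2, smul_zero]

/-! ### The multiplication formulas -/

theorem ent_stdElt_zero {n r : ℕ} (j : Fin (2 * n + 1) → ℤ) (l k : Comp n r) :
    ent (stdElt r 0 j) l k = if l = k then v ^ dotp k.1 j • xElt k else 0 := by
  have h0 : tot (0 : Mat n) = 0 := by simp [tot]
  rw [stdElt_of_le (by rw [h0]; omega), ent_sum, Finset.sum_eq_single k.1]
  · rw [ent_smul, ent_brk, zero_add, dimDiff_diagonal, neg_zero, zpow_zero, one_smul]
    split_ifs with h
    · rw [h, xElt_eq_dcSum]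
    · have : ∃ a, ∑ b, Matrix.diagonal (tilde k.1) a b ≠ tilde l.1 a := by
        by_contra! h1
        apply h
        apply comp_ext
        funext a
        rw [← h1, sum_diagonal_row]
      obtain ⟨a, ha⟩ := this
      rw [dcSum_eq_zero_of_row ha, smul_zero]
  · intro m _ hm
    have : ∃ a, ∑ b, ((0 : Mat n) + Matrix.diagonal (tilde m)) b a ≠ tilde k.1 a := by
      by_contra! h1
      apply hm
      apply tilde_injective
      funext a
      rw [← h1, zero_add, sum_diagonal_col]
    obtain ⟨a, ha⟩ := this
    rw [ent_smul, ent_brk, dcSum_eq_zero_of_col ha, smul_zero, smul_zero]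
  · intro h
    exact absurd (mem_piAntidiag_univ.2 (by rw [k.2, h0]; omega)) h

/-- The sum of the idempotents `[diag(λ̃)]` is the identity. -/
theorem stdElt_zero_zero {n : ℕ} (r : ℕ) : stdElt r (0 : Mat n) 0 = 1 := by
  apply schur_ext
  intro l k
  rw [ent_stdElt_zero, ent_one, dotp_zero, zpow_zero, one_smul]

theorem ent_stdElt {n r : ℕ} {A : Mat n} (h : tot A ≤ 2 * r) (j : Fin (2 * n + 1) → ℤ)
    (l m : Comp n r) : ent (stdElt r A j) l m =
      ∑ k ∈ Finset.piAntidiag (Finset.univ : Finset (Fin (n + 1))) (r - tot A / 2),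
        (v ^ dotp k j * v ^ (-dimDiff (A + Matrix.diagonal (tilde k)))) •
          dcSum l m (A + Matrix.diagonal (tilde k)) := by
  rw [stdElt_of_le h, ent_sum]
  refine Finset.sum_congr rfl fun k _ => ?_
  rw [ent_smul, ent_brk, smul_smul]

theorem LInv_stdElt {n r : ℕ} (A : Mat n) (j : Fin (2 * n + 1) → ℤ) (l m : Comp n r) :
    LInv l (ent (stdElt r A j) l m) :=
  (mem_xIdeal l _).1 ((stdElt r A j (xGen m) l).2)

theorem stdElt_zero_mul {n : ℕ} (r : ℕ) (A : Mat n) (j j' : Fin (2 * n + 1) → ℤ) :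
    stdElt r 0 j * stdElt r A j' = v ^ rowDot A j • stdElt r A (j + j') := by
  by_cases h : tot A ≤ 2 * r
  swap
  · rw [stdElt_of_lt (not_le.1 h), stdElt_of_lt (not_le.1 h), mul_zero, smul_zero]
  apply schur_ext
  intro l m
  rw [ent_mul, Finset.sum_eq_single l]
  · rw [ent_stdElt_zero, if_pos rfl, smul_mul_assoc, (LInv_stdElt A j' l m).xElt_mul,
      smul_comm _ (poinc l), smul_smul, inv_mul_cancel₀ (poinc_ne_zero l), one_smul, ent_smul,
      ent_stdElt h, ent_stdElt h, Finset.smul_sum, Finset.smul_sum]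
    refine Finset.sum_congr rfl fun k _ => ?_
    by_cases hk : ∀ a, ∑ b, (A + Matrix.diagonal (tilde k)) a b = tilde l.1 a
    · rw [smul_smul, smul_smul]
      congr 1
      have h1 : dotp l.1 j = rowDot A j + dotp k j := by
        simp only [dotp, rowDot, ← hk, Matrix.add_apply, Finset.sum_add_distrib, sum_diagonal_row,
          Nat.cast_add, Nat.cast_sum, add_mul]
      rw [h1, dotp_add, zpow_add₀ v_ne_zero, zpow_add₀ v_ne_zero]
      ring
    · push Not at hk
      obtain ⟨a, ha⟩ := hk
      rw [dcSum_eq_zero_of_row ha, smul_zero, smul_zero, smul_zero, smul_zero]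
  · intro k _ hk
    rw [ent_stdElt_zero, if_neg (Ne.symm hk), zero_mul, smul_zero]
  · intro h
    exact absurd (Finset.mem_univ l) h

theorem mul_stdElt_zero {n : ℕ} (r : ℕ) (A : Mat n) (j j' : Fin (2 * n + 1) → ℤ) :
    stdElt r A j' * stdElt r 0 j = v ^ colDot A j • stdElt r A (j + j') := by
  by_cases h : tot A ≤ 2 * r
  swap
  · rw [stdElt_of_lt (not_le.1 h), stdElt_of_lt (not_le.1 h), zero_mul, smul_zero]
  apply schur_ext
  intro l m
  have hx : ∀ C : Mat n, dcSum l m C * xElt m = poinc m • dcSum l m C :=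
    fun C => (RInv_dcSum l m C).mul_xElt
  rw [ent_mul, Finset.sum_eq_single m]
  · rw [ent_stdElt_zero, if_pos rfl, mul_smul_comm, ent_smul,
      ent_stdElt h, ent_stdElt h, Finset.smul_sum, Finset.sum_mul, Finset.smul_sum,
      Finset.smul_sum]
    refine Finset.sum_congr rfl fun k _ => ?_
    rw [smul_mul_assoc, hx, smul_comm _ (poinc m), smul_comm _ (poinc m), smul_smul _ (poinc m),
      inv_mul_cancel₀ (poinc_ne_zero m), one_smul]
    by_cases hk : ∀ a, ∑ b, (A + Matrix.diagonal (tilde k)) b a = tilde m.1 a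
    · rw [smul_smul, smul_smul]
      congr 1
      have h1 : dotp m.1 j = colDot A j + dotp k j := by
        simp only [dotp, colDot, ← hk, Matrix.add_apply, Finset.sum_add_distrib, sum_diagonal_col,
          Nat.cast_add, Nat.cast_sum, add_mul]
      rw [h1, dotp_add, zpow_add₀ v_ne_zero, zpow_add₀ v_ne_zero]
      ring
    · push Not at hk
      obtain ⟨a, ha⟩ := hk
      rw [dcSum_eq_zero_of_col ha, smul_zero, smul_zero, smul_zero, smul_zero]
  · intro k _ hk
    rw [ent_stdElt_zero, if_neg hk, mul_zero, smul_zero]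
  · intro h
    exact absurd (Finset.mem_univ m) h

theorem elt_symm {n : ℕ} (A : Mat n) {j j' : Fin (2 * n + 1) → ℤ}
    (h : ∀ i, j i + j i.rev = j' i + j' i.rev) : elt A j = elt A j' :=
  funext fun r => stdElt_symm r A h

theorem Eth_rev {n : ℕ} (a b : Fin (2 * n + 1)) : Eth a.rev b.rev = Eth a b := by
  unfold Eth
  rw [Fin.rev_rev, Fin.rev_rev, add_comm]

theorem gen_mul_elt {n : ℕ} (i : Fin (2 * n)) {A : Mat n} (hA : A ∈ Xi0 n)
    (j : Fin (2 * n + 1) → ℤ) :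
    elt (Eth i.succ i.castSucc) 0 * elt A j =
      (∑ p with p < i.castSucc ∧ 1 ≤ A i.castSucc p, (v ^ gam A i p * qbar (A i.succ p + 1)) •
        elt (A + Eth i.succ p - Eth i.castSucc p) j)
      + (v ^ (gam A i i.castSucc + j i.castSucc + j i.castSucc.rev) *
          qbar (A i.succ i.castSucc + 1)) • elt (A + Eth i.succ i.castSucc) j
      + (if 1 ≤ A i.castSucc i.succ then
          (v ^ (gam A i i.succ - j i.succ - j i.succ.rev - 1) / (1 - v ^ (-2 : ℤ))) •
            (v ^ (-midDelta i) • elt (A - Eth i.castSucc i.succ)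
                (j - (unitVec i.castSucc - unitVec i.succ))
              - v ^ midDelta i • elt (A - Eth i.castSucc i.succ)
                (j + (-unitVec i.castSucc - unitVec i.succ)))
        else 0)
      + ∑ p with i.succ < p ∧ 1 ≤ A i.castSucc p, (v ^ gam A i p * qbar (A i.succ p + 1)) •
        elt (A + Eth i.succ p - Eth i.castSucc p)
          (j - (unitVec i.castSucc - unitVec i.succ)) := by
  funext r
  rw [Pi.mul_apply]
  refine (gen_mul_stdElt r i hA j).trans ?_
  rw [Pi.add_apply, Pi.add_apply, Pi.add_apply, Finset.sum_apply, Finset.sum_apply]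
  congr 2
  split_ifs <;> rfl

/-- Row `h`, as the source of a move to row `h + 1`. -/
def loIdx {n : ℕ} (h : Fin n) : Fin (2 * n) := ⟨h.val, by omega⟩

/-- The mirror image of row `h + 1`, as the source of a move to the mirror image of row `h`. -/
def hiIdx {n : ℕ} (h : Fin n) : Fin (2 * n) := ⟨2 * n - 1 - h.val, by omega⟩

theorem loIdx_castSucc {n : ℕ} (h : Fin n) : (loIdx h).castSucc = lo h := rfl

theorem loIdx_succ {n : ℕ} (h : Fin n) : (loIdx h).succ = hi h := rfl

theorem hiIdx_castSucc {n : ℕ} (h : Fin n) : (hiIdx h).castSucc = (hi h).rev := by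
  ext
  simp only [hiIdx, hi, Fin.val_castSucc, Fin.val_rev]
  omega

theorem hiIdx_succ {n : ℕ} (h : Fin n) : (hiIdx h).succ = (lo h).rev := by
  ext
  simp only [hiIdx, lo, Fin.val_succ, Fin.val_rev]
  omega

theorem midDelta_loIdx {n : ℕ} (h : Fin n) : midDelta (loIdx h) = deltaN h := by
  simp only [midDelta, deltaN, loIdx_succ, Fin.ext_iff, hi, ctr]

theorem midDelta_hiIdx {n : ℕ} (h : Fin n) : midDelta (hiIdx h) = 0 := by
  rw [midDelta, hiIdx_succ, if_neg]
  simp only [Fin.ext_iff, lo, ctr, Fin.val_rev]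
  omega

theorem gam_loIdx {n : ℕ} (A : Mat n) (h : Fin n) (p : Fin (2 * n + 1)) :
    gam A (loIdx h) p = beta' A h p := by
  rw [gam, midCorr, if_neg, add_zero]
  · rfl
  · rintro ⟨h1, -⟩
    simp only [Fin.ext_iff, loIdx_castSucc, lo, ctr] at h1
    omega

theorem gam_hiIdx {n : ℕ} {A : Mat n} (hA : A ∈ Xi0 n) (h : Fin n) (p : Fin (2 * n + 1)) :
    gam A (hiIdx h) p.rev = beta A h p := by
  rw [gam, beta, hiIdx_castSucc, hiIdx_succ]
  have h1 : ∑ j ∈ Finset.Iic p.rev, (A (lo h).rev j : ℤ) = ∑ j ∈ Finset.Ici p, (A (lo h) j : ℤ) := by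
    refine Finset.sum_bij' (fun j _ => j.rev) (fun j _ => j.rev) ?_ ?_ ?_ ?_ ?_
    · intro j hj
      rw [Finset.mem_Iic] at hj
      rw [Finset.mem_Ici]
      exact Fin.le_rev_iff.1 hj
    · intro j hj
      rw [Finset.mem_Ici] at hj
      rw [Finset.mem_Iic]
      exact Fin.rev_le_rev.2 hj
    · intros; exact Fin.rev_rev _
    · intros; exact Fin.rev_rev _
    · intro j _
      rw [← hA.1, Fin.rev_rev]
  have h2 : ∑ j ∈ Finset.Iio p.rev, (A (hi h).rev j : ℤ) = ∑ j ∈ Finset.Ioi p, (A (hi h) j : ℤ) := by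
    refine Finset.sum_bij' (fun j _ => j.rev) (fun j _ => j.rev) ?_ ?_ ?_ ?_ ?_
    · intro j hj
      rw [Finset.mem_Iio] at hj
      rw [Finset.mem_Ioi]
      exact Fin.lt_rev_iff.1 hj
    · intro j hj
      rw [Finset.mem_Ioi] at hj
      rw [Finset.mem_Iio]
      exact Fin.rev_lt_rev.2 hj
    · intros; exact Fin.rev_rev _
    · intros; exact Fin.rev_rev _
    · intro j _
      rw [← hA.1, Fin.rev_rev]
  rw [h1, h2]
  congr 1
  rw [midCorr, deltaN, hiIdx_castSucc]
  simp only [Fin.ext_iff, Fin.lt_def, Fin.val_rev, hi, ctr]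
  split_ifs <;> first | rfl | omega

theorem sum_filter_rev {N : ℕ} {M : Type*} [AddCommMonoid M] (P Q : Fin N → Prop)
    [DecidablePred P] [DecidablePred Q] (f g : Fin N → M) (hP : ∀ p, P p.rev ↔ Q p)
    (hf : ∀ p, f p.rev = g p) : ∑ p with P p, f p = ∑ p with Q p, g p := by
  rw [Finset.sum_filter, Finset.sum_filter, ← Equiv.sum_comp Fin.revPerm]
  simp only [Fin.revPerm_apply, hP, hf]

theorem lower_elt {n : ℕ} {A : Mat n} (hA : A ∈ Xi0 n) (j : Fin (2 * n + 1) → ℤ) (h : Fin n) :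
    elt (Eth (hi h) (lo h)) 0 * elt A j =
      (∑ p with p < lo h ∧ 1 ≤ A (lo h) p,
        (v ^ beta' A h p * qbar (A (hi h) p + 1)) •
          elt (A + Eth (hi h) p - Eth (lo h) p) j)
      + (v ^ (beta' A h (lo h) + j (lo h) + j (lo h).rev) * qbar (A (hi h) (lo h) + 1)) •
          elt (A + Eth (hi h) (lo h)) j
      + (if 1 ≤ A (lo h) (hi h) then
          (v ^ (beta' A h (hi h) - j (hi h) - j (hi h).rev - 1) / (1 - v ^ (-2 : ℤ))) •
            (v ^ (-deltaN h) • elt (A - Eth (lo h) (hi h)) (j - alpha h)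
              - v ^ deltaN h • elt (A - Eth (lo h) (hi h)) (j + alphaMinus h))
        else 0)
      + ∑ p with hi h < p ∧ 1 ≤ A (lo h) p,
        (v ^ beta' A h p * qbar (A (hi h) p + 1)) •
          elt (A + Eth (hi h) p - Eth (lo h) p) (j - alpha h) := by
  have := gen_mul_elt (loIdx h) hA j
  simp only [gam_loIdx, midDelta_loIdx, loIdx_castSucc, loIdx_succ] at this
  exact this

theorem raise_elt {n : ℕ} {A : Mat n} (hA : A ∈ Xi0 n) (j : Fin (2 * n + 1) → ℤ) (h : Fin n) :
    elt (Eth (lo h) (hi h)) 0 * elt A j =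
      (∑ p with p < lo h ∧ 1 ≤ A (hi h) p,
        (v ^ beta A h p * qbar (A (lo h) p + 1)) •
          elt (A + Eth (lo h) p - Eth (hi h) p) (j + alpha h))
      + (if 1 ≤ A (hi h) (lo h) then
          (v ^ (beta A h (lo h) - j (lo h) - j (lo h).rev - 1) / (1 - v ^ (-2 : ℤ))) •
            (elt (A - Eth (hi h) (lo h)) (j + alpha h)
              - elt (A - Eth (hi h) (lo h)) (j + alphaMinus h))
        else 0)
      + (v ^ (beta A h (hi h) + j (hi h) + j (hi h).rev) * qbar (A (lo h) (hi h) + 1)) •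
          elt (A + Eth (lo h) (hi h)) j
      + ∑ p with hi h < p ∧ 1 ≤ A (hi h) p,
        (v ^ beta A h p * qbar (A (lo h) p + 1)) •
          elt (A + Eth (lo h) p - Eth (hi h) p) j := by
  have hu : ∀ a b : Fin (2 * n + 1), unitVec a.rev b = unitVec a b.rev := by
    intro a b
    simp only [unitVec, Pi.single_apply, Fin.rev_eq_iff]
  have h1 : ∀ C : Mat n, elt C (j - (unitVec (hi h).rev - unitVec (lo h).rev)) =
      elt C (j + alpha h) := by
    intro C
    apply elt_symm
    intro i
    simp only [alpha, Pi.add_apply, Pi.sub_apply, hu, Fin.rev_rev]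
    ring
  have h2 : ∀ C : Mat n, elt C (j + (-unitVec (hi h).rev - unitVec (lo h).rev)) =
      elt C (j + alphaMinus h) := by
    intro C
    apply elt_symm
    intro i
    simp only [alphaMinus, Pi.add_apply, Pi.sub_apply, Pi.neg_apply, hu, Fin.rev_rev]
    ring
  have := gen_mul_elt (hiIdx h) hA j
  simp only [gam_hiIdx hA, midDelta_hiIdx, hiIdx_castSucc, hiIdx_succ, Eth_rev, hA.1, Fin.rev_rev,
    neg_zero, zpow_zero, one_smul, h1, h2] at this
  rw [this, sum_filter_rev (fun p => p < (hi h).rev ∧ _) (fun p => hi h < p ∧ 1 ≤ A (hi h) p) _ fun p =>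
      (v ^ beta A h p * qbar (A (lo h) p + 1)) • elt (A + Eth (lo h) p - Eth (hi h) p) j,
    sum_filter_rev (fun p => (lo h).rev < p ∧ _) (fun p => p < lo h ∧ 1 ≤ A (hi h) p) _ fun p =>
      (v ^ beta A h p * qbar (A (lo h) p + 1)) •
        elt (A + Eth (lo h) p - Eth (hi h) p) (j + alpha h),
    sub_right_comm _ (j (lo h).rev), add_right_comm _ (j (hi h).rev)]
  · abel
  · intro p
    rw [hA.1, Fin.rev_lt_rev]
  · intro p
    rw [gam_hiIdx hA, hA.1, Eth_rev, Eth_rev]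
  · intro p
    rw [hA.1, Fin.rev_lt_rev]
  · intro p
    rw [gam_hiIdx hA, hA.1, Eth_rev, Eth_rev]

theorem multFormulas_elt (n : ℕ) : MultFormulas n (elt (n := n)) where
  symm A _ _ _ h := elt_symm A h
  one := funext fun r => stdElt_zero_zero r
  zero_mul A _ j j' := funext fun r => stdElt_zero_mul r A j j'
  mul_zero A _ j j' := funext fun r => mul_stdElt_zero r A j j'
  raise A hA j h := raise_elt hA j h
  lower A hA j h := lower_elt hA j h

/-! ### Double cosets are nonempty -/

/-- A monotone map to the set of blocks is determined by the sizes of its fibres. -/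
theorem eq_bi_of_monotone {n r : ℕ} (l : Comp n r) {f : Fin (2 * r + 1) → Fin (2 * n + 1)}
    (hf : Monotone f) (hc : ∀ i, (Finset.univ.filter fun x => f x = i).card = tilde l.1 i)
    (x : Fin (2 * r + 1)) : bi l x = f x := by
  -- The preimage of `[0, k)` is an initial segment whose size is read off from the fibres.
  have h1 : ∀ k, (Finset.univ.filter fun x => (f x).val < k).card = psum l.1 k := by
    intro k
    rw [psum, Finset.card_eq_sum_card_fiberwise (f := f)
      (t := Finset.univ.filter fun i : Fin (2 * n + 1) => i.val < k)]
    · refine Finset.sum_congr rfl fun i hi => ?_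
      rw [← hc]
      congr 1
      ext y
      simp only [Finset.mem_filter, Finset.mem_univ, true_and] at hi ⊢
      constructor
      · exact fun h => h.2
      · exact fun h => ⟨h ▸ hi, h⟩
    · intro y hy
      simpa using hy
  have h2 : ∀ k, (f x).val < k → x.val < psum l.1 k := by
    intro k hk
    rw [← h1]
    have : (Finset.Iic x).card ≤ (Finset.univ.filter fun x => (f x).val < k).card := by
      refine Finset.card_le_card fun y hy => ?_
      rw [Finset.mem_filter]
      exact ⟨Finset.mem_univ y, lt_of_le_of_lt (hf (Finset.mem_Iic.1 hy)) hk⟩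
    rw [Fin.card_Iic] at this
    omega
  have h3 : ∀ k, k ≤ (f x).val → psum l.1 k ≤ x.val := by
    intro k hk
    rw [← h1]
    have : (Finset.univ.filter fun x => (f x).val < k).card ≤ (Finset.Iio x).card := by
      refine Finset.card_le_card fun y hy => ?_
      rw [Finset.mem_filter] at hy
      rw [Finset.mem_Iio]
      by_contra h
      have h4 : (f x).val ≤ (f y).val := hf (not_lt.1 h)
      omega
    rwa [Fin.card_Iio] at this
  exact (bi_eq_iff l x (f x)).2 ⟨h3 _ le_rfl, h2 _ (Nat.lt_succ_self _)⟩

/-- Sorting a finite set by an injective key `κ` that refines `f` lists the fibres of `f` as the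
blocks of `λ`. A map `σ` that reverses the order corresponds to the reversal of the positions. -/
theorem exists_sorting {n r : ℕ} (l : Comp n r) {S β : Type*} [Fintype S] [LinearOrder β]
    {κ : S → β} (hκ : Function.Injective κ) {f : S → Fin (2 * n + 1)}
    (hf : ∀ s t, κ s < κ t → f s ≤ f t) {σ : S → S} (hσ : ∀ s t, κ s < κ t → κ (σ t) < κ (σ s))
    (hc : ∀ i, (Finset.univ.filter fun s => f s = i).card = tilde l.1 i) :
    ∃ e : Fin (2 * r + 1) ≃ S, (∀ x, bi l x = f (e x)) ∧ ∀ x, e x.rev = σ (e x) := by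
  let : LinearOrder S := LinearOrder.lift' κ hκ
  have hcard : Fintype.card S = 2 * r + 1 := by
    rw [← Finset.card_univ, Finset.card_eq_sum_card_fiberwise (f := f) (t := Finset.univ)
      fun _ _ => Finset.mem_univ _]
    simp only [hc, sum_tilde, l.2]
  let e : Fin (2 * r + 1) ≃o S := Fintype.orderIsoFinOfCardEq S hcard
  refine ⟨e.toEquiv, fun x => ?_, fun x => ?_⟩
  · refine eq_bi_of_monotone l (f := fun x => f (e x)) ?_ ?_ x
    · intro y z hyz
      rcases hyz.lt_or_eq with h | h
      · exact hf _ _ (e.lt_iff_lt.2 h)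
      · rw [h]
    · intro i
      rw [← hc]
      refine Finset.card_bij (fun y _ => e y) ?_ ?_ ?_
      · intro y hy
        simpa using hy
      · intro y _ z _ h
        exact e.injective h
      · intro s hs
        exact ⟨e.symm s, by simpa using hs, e.apply_symm_apply s⟩
  · have h1 : StrictMono fun x : Fin (2 * r + 1) => σ (e x.rev) := by
      intro y z hyz
      exact hσ _ _ (e.lt_iff_lt.2 (Fin.rev_lt_rev.2 hyz))
    have h2 : (fun x : Fin (2 * r + 1) => σ (e x.rev)) = e := by
      refine (h1.range_inj e.strictMono).1 ?_
      rw [e.surjective.range_eq, Set.range_eq_univ]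
      exact ((Fintype.bijective_iff_injective_and_card _).2
        ⟨h1.injective, by rw [Fintype.card_fin, hcard]⟩).2
    have h3 := congrFun h2 x.rev
    rw [Fin.rev_rev] at h3
    exact h3.symm

/-- Every centrally symmetric matrix with the right row and column sums labels a double coset. The
points are enumerated by the cells `(i, j, t)`, `t < a_{i,j}`, once with the rows and once with the
columns as the leading coordinate; the comparison of the two enumerations is the element of `W`. -/
theorem exists_cosetMatrix_eq {n r : ℕ} {l m : Comp n r} {A : Mat n}
    (hA : ∀ a b, A a.rev b.rev = A a b) (hl : ∀ i, ∑ j, A i j = tilde l.1 i)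
    (hm : ∀ j, ∑ i, A i j = tilde m.1 j) : ∃ w : W r, cosetMatrix l m w = A := by
  let S : Type := Σ p : Fin (2 * n + 1) × Fin (2 * n + 1), Fin (A p.1 p.2)
  let σ : S → S := fun s => ⟨(s.1.1.rev, s.1.2.rev), ⟨A s.1.1 s.1.2 - 1 - s.2.val, by
    have := s.2.isLt
    rw [hA]
    omega⟩⟩
  let κ : S → Fin (2 * n + 1) ×ₗ (Fin (2 * n + 1) ×ₗ ℕ) := fun s =>
    toLex (s.1.1, toLex (s.1.2, s.2.val))
  let κ' : S → Fin (2 * n + 1) ×ₗ (Fin (2 * n + 1) ×ₗ ℕ) := fun s =>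
    toLex (s.1.2, toLex (s.1.1, s.2.val))
  have hcard : ∀ P : Fin (2 * n + 1) × Fin (2 * n + 1) → Prop, ∀ [DecidablePred P],
      (Finset.univ.filter fun s : S => P s.1).card = ∑ i, ∑ j, if P (i, j) then A i j else 0 := by
    intro P _
    rw [Finset.card_filter, Fintype.sum_sigma, Fintype.sum_prod_type]
    refine Finset.sum_congr rfl fun i _ => Finset.sum_congr rfl fun j _ => ?_
    split_ifs with h <;> simp
  obtain ⟨e, he, her⟩ := exists_sorting l (κ := κ) (f := fun s : S => s.1.1) (σ := σ) (by
      rintro ⟨⟨i, j⟩, t⟩ ⟨⟨i', j'⟩, t'⟩ h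
      simp only [κ, EmbeddingLike.apply_eq_iff_eq, Prod.mk.injEq] at h
      obtain ⟨rfl, rfl, h⟩ := h
      rw [Fin.ext h]) (by
      intro s t h
      simp only [κ, Prod.Lex.toLex_lt_toLex] at h
      rcases h with h | h
      · exact h.le
      · exact h.1.le) (by
      rintro ⟨⟨i, j⟩, t⟩ ⟨⟨i', j'⟩, t'⟩ h
      simp only [κ, σ, Prod.Lex.toLex_lt_toLex, Fin.rev_lt_rev, Fin.rev_inj] at h ⊢
      rcases h with h | ⟨rfl, h | ⟨rfl, h⟩⟩
      · exact Or.inl h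
      · exact Or.inr ⟨rfl, Or.inl h⟩
      · have := t'.isLt
        exact Or.inr ⟨rfl, Or.inr ⟨rfl, by dsimp only at *; omega⟩⟩) (by
      intro i
      rw [hcard fun p => p.1 = i, ← hl]
      rw [Finset.sum_comm]
      simp)
  obtain ⟨e', he', her'⟩ := exists_sorting m (κ := κ') (f := fun s : S => s.1.2) (σ := σ) (by
      rintro ⟨⟨i, j⟩, t⟩ ⟨⟨i', j'⟩, t'⟩ h
      simp only [κ', EmbeddingLike.apply_eq_iff_eq, Prod.mk.injEq] at h
      obtain ⟨rfl, rfl, h⟩ := h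
      rw [Fin.ext h]) (by
      intro s t h
      simp only [κ', Prod.Lex.toLex_lt_toLex] at h
      rcases h with h | h
      · exact h.le
      · exact h.1.le) (by
      rintro ⟨⟨i, j⟩, t⟩ ⟨⟨i', j'⟩, t'⟩ h
      simp only [κ', σ, Prod.Lex.toLex_lt_toLex, Fin.rev_lt_rev, Fin.rev_inj] at h ⊢
      rcases h with h | ⟨rfl, h | ⟨rfl, h⟩⟩
      · exact Or.inl h
      · exact Or.inr ⟨rfl, Or.inl h⟩
      · have := t'.isLt
        exact Or.inr ⟨rfl, Or.inr ⟨rfl, by dsimp only at *; omega⟩⟩) (by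
      intro j
      rw [hcard fun p => p.2 = j, ← hm]
      simp)
  refine ⟨⟨e'.trans e.symm, mem_W fun x => ?_⟩, ?_⟩
  · rw [Equiv.trans_apply, Equiv.trans_apply, her', Equiv.symm_apply_eq, her,
      Equiv.apply_symm_apply]
  · ext i j
    rw [cosetMatrix_apply']
    simp only [he, he', Equiv.trans_apply, Equiv.apply_symm_apply]
    have h1 := hcard fun p => p.1 = i ∧ p.2 = j
    rw [show (∑ a, ∑ b, if (a, b).1 = i ∧ (a, b).2 = j then A a b else 0) = A i j by
      rw [Finset.sum_eq_single i, Finset.sum_eq_single j] <;> simp +contextual [eq_comm]] at h1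
    rw [← h1]
    refine Finset.card_bij (fun y _ => e' y) ?_ ?_ ?_
    · intro y hy
      simpa using hy
    · intro y _ z _ h
      exact e'.injective h
    · intro s hs
      exact ⟨e'.symm s, by simpa using hs, e'.apply_symm_apply s⟩

/-! ### Linear independence -/

theorem transpose_mem_Xi0 {n : ℕ} {A : Mat n} (hA : A ∈ Xi0 n) : A.transpose ∈ Xi0 n :=
  ⟨fun i j => hA.1 j i, fun i => hA.2 i⟩

theorem tot_transpose {n : ℕ} (A : Mat n) : tot A.transpose = tot A :=
  Finset.sum_comm

theorem add_diagonal_inj {n : ℕ} {A A' : Mat n} (hA : A ∈ Xi0 n) (hA' : A' ∈ Xi0 n)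
    {k k' : Fin (n + 1) → ℕ} :
    A + Matrix.diagonal (tilde k) = A' + Matrix.diagonal (tilde k') ↔ A = A' ∧ k = k' := by
  constructor
  · intro h
    have h1 : ∀ i j, (A + Matrix.diagonal (tilde k)) i j = (A' + Matrix.diagonal (tilde k')) i j :=
      fun i j => by rw [h]
    constructor
    · ext i j
      by_cases hij : i = j
      · rw [hij, hA.2, hA'.2]
      · have := h1 i j
        rwa [Matrix.add_apply, Matrix.add_apply, Matrix.diagonal_apply_ne _ hij,
          Matrix.diagonal_apply_ne _ hij] at this
    · apply tilde_injective
      funext i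
      have := h1 i i
      rwa [Matrix.add_apply, Matrix.add_apply, Matrix.diagonal_apply_eq, Matrix.diagonal_apply_eq,
        hA.2, hA'.2, zero_add, zero_add] at this
  · rintro ⟨rfl, rfl⟩
    rfl

/-- A coefficient of the component of degree `|λ| + |A|/2` separates `A(j)` from the other `A'(j')`
and reads off the power of `v` with exponent `λ̃ · j`. -/
theorem exists_coefficient {n : ℕ} {A : Mat n} (hA : A ∈ Xi0 n) (k : Fin (n + 1) → ℕ) :
    ∃ φ : SchurProd n →ₗ[Kv] Kv, ∀ A' ∈ Xi0 n, ∀ j,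
      φ (elt A' j) = if A' = A then v ^ dotp k j else 0 := by
  obtain ⟨l, hl⟩ := exists_row_sum hA k
  obtain ⟨m, hm⟩ := exists_row_sum (transpose_mem_Xi0 hA) k
  have h1 := sum_of_row_sum hl
  have h2 := sum_of_row_sum hm
  rw [tot_transpose] at h2
  obtain ⟨r, hr⟩ : ∃ r, ∑ i, l i = r := ⟨_, rfl⟩
  obtain ⟨w, hw⟩ := exists_cosetMatrix_eq (l := ⟨l, hr⟩) (m := ⟨m, by omega⟩)
    (A := A + Matrix.diagonal (tilde k))
    (fun a b => by rw [Matrix.add_apply, Matrix.add_apply, hA.1, diagonal_rev (tilde_rev k)])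
    (fun i => (congrFun hl i).symm) (fun j => by
      rw [hm]
      refine Finset.sum_congr rfl fun b _ => ?_
      rw [Matrix.add_apply, Matrix.add_apply, Matrix.transpose_apply]
      congr 1
      exact congrFun (congrFun (Matrix.diagonal_transpose (tilde k)) j) b)
  refine ⟨v ^ dimDiff (A + Matrix.diagonal (tilde k)) • LinearMap.proj w ∘ₗ coef ∘ₗ
    entHom ⟨l, hr⟩ ⟨m, by omega⟩ ∘ₗ LinearMap.proj r, fun A' hA' j => ?_⟩
  change v ^ dimDiff (A + Matrix.diagonal (tilde k)) *
    coef (ent (stdElt r A' j) ⟨l, hr⟩ ⟨m, by omega⟩) w = _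
  by_cases hle : tot A' ≤ 2 * r
  · rw [ent_stdElt hle, map_sum, Finset.sum_apply]
    simp only [map_smul, Pi.smul_apply, coef_dcSum, hw, smul_eq_mul, add_diagonal_inj hA hA',
      mul_ite, mul_one, mul_zero, eq_comm (a := A)]
    by_cases h : A' = A
    · subst h
      simp only [true_and, if_true, Finset.sum_ite_eq]
      rw [if_pos (mem_piAntidiag_univ.2 (by omega)), mul_left_comm, ← zpow_add₀ v_ne_zero,
        add_neg_cancel, zpow_zero, mul_one]
    · simp [h]
  · rw [stdElt_of_lt (not_le.1 hle), ent_zero, map_zero, Pi.zero_apply, mul_zero, if_neg]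
    rintro rfl
    omega

theorem tilde_add {n : ℕ} (k k' : Fin (n + 1) → ℕ) (i : Fin (2 * n + 1)) :
    tilde (k + k') i + tilde 0 i = tilde k i + tilde k' i := by
  simp only [tilde, Pi.add_apply, Pi.zero_apply]
  split_ifs <;> omega

/-- The character `λ ↦ v ^ ((λ̃ - 0̃) · j)` of `ℕ^{n+1}`. -/
def character {n : ℕ} (j : Fin (2 * n + 1) → ℤ) : Multiplicative (Fin (n + 1) → ℕ) →* Kv where
  toFun k := v ^ (dotp k.toAdd j - dotp 0 j)
  map_one' := by
    rw [toAdd_one, sub_self, zpow_zero]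
  map_mul' k k' := by
    rw [toAdd_mul, ← zpow_add₀ v_ne_zero]
    congr 1
    have : dotp (k.toAdd + k'.toAdd) j + dotp 0 j = dotp k.toAdd j + dotp k'.toAdd j := by
      simp only [dotp, ← Finset.sum_add_distrib, ← add_mul]
      refine Finset.sum_congr rfl fun i _ => ?_
      rw [← Nat.cast_add, tilde_add, Nat.cast_add]
    linarith

theorem zpow_v_injective {a b : ℤ} (h : v ^ a = v ^ b) : a = b := by
  by_contra hab
  apply v_zpow_ne_one (sub_ne_zero.2 hab)
  rw [zpow_sub₀ v_ne_zero, h, div_self (zpow_ne_zero _ v_ne_zero)]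

/-- A character is determined by the sums `j_i + j_{N+1-i}`, since `v` is not a root of unity. -/
theorem eq_of_character_eq {n : ℕ} {j j' : Fin (2 * n + 1) → ℤ} (h : character j = character j')
    (i : Fin (2 * n + 1)) : j i + j i.rev = j' i + j' i.rev := by
  have h1 := DFunLike.congr_fun h (Multiplicative.ofAdd (0 + Pi.single (fold i) 1))
  have h2 := zpow_v_injective h1
  rw [toAdd_ofAdd, dotp_add_single, dotp_add_single] at h2
  linarith

/-- The extension by zero of a vector in `ℤ^{n+1}`. -/
def extVec {n : ℕ} (k : Fin (n + 1) → ℤ) (i : Fin (2 * n + 1)) : ℤ :=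
  if h : i.val < n + 1 then k ⟨i.val, h⟩ else 0

theorem extVec_of_lt {n : ℕ} (k : Fin (n + 1) → ℤ) {i : Fin (2 * n + 1)} (h : i.val < n + 1) :
    extVec k i = k ⟨i.val, h⟩ := dif_pos h

theorem extVec_of_ge {n : ℕ} (k : Fin (n + 1) → ℤ) {i : Fin (2 * n + 1)} (h : n + 1 ≤ i.val) :
    extVec k i = 0 := dif_neg (not_lt.2 h)

theorem extVec_injective {n : ℕ} {k k' : Fin (n + 1) → ℤ}
    (h : ∀ i, extVec k i + extVec k i.rev = extVec k' i + extVec k' i.rev) : k = k' := by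
  funext c
  have h1 := h (idx c)
  have hc := c.isLt
  rw [extVec_of_lt k (i := idx c) hc, extVec_of_lt k' (i := idx c) hc] at h1
  by_cases h2 : c.val = n
  · rw [rev_eq_self.2 (Fin.ext h2), extVec_of_lt k (i := idx c) hc,
      extVec_of_lt k' (i := idx c) hc] at h1
    simp only [idx] at h1
    linarith
  · have h3 : n + 1 ≤ (idx c).rev.val := by
      simp only [idx, Fin.val_rev]
      omega
    rw [extVec_of_ge k h3, extVec_of_ge k' h3, add_zero, add_zero] at h1
    exact h1

theorem exists_extVec {n : ℕ} (j : Fin (2 * n + 1) → ℤ) :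
    ∃ k : Fin (n + 1) → ℤ, ∀ i, j i + j i.rev = extVec k i + extVec k i.rev := by
  refine ⟨fun c => if c.val = n then j (ctr n) else j (idx c) + j (idx c).rev, fun i => ?_⟩
  have hi := i.isLt
  rcases lt_trichotomy i.val n with h | h | h
  · simp only [extVec, Fin.val_rev]
    rw [dif_pos (by omega), dif_neg (by omega), if_neg h.ne, add_zero]
    rfl
  · have : i = ctr n := Fin.ext h
    rw [rev_eq_self.2 this, this]
    simp [extVec, ctr]
  · simp only [extVec, Fin.val_rev]
    rw [dif_neg (by omega), dif_pos (by omega), if_neg (by omega), zero_add]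
    have : idx ⟨2 * n + 1 - (i.val + 1), by omega⟩ = i.rev := by
      ext
      simp only [idx, Fin.val_rev]
    rw [this, Fin.rev_rev, add_comm]

/-- The elements `A(j)`, with `j` supported on `[1, n+1]`, are linearly independent: the matrix `A`
is separated by the coefficients of `exists_coefficient`, and for fixed `A` the vectors `j` give
distinct characters of `ℕ^{n+1}`. -/
theorem linearIndependent_elt (n : ℕ) : LinearIndependent Kv
    fun x : Xi0 n × (Fin (n + 1) → ℤ) => elt x.1.1 (extVec x.2) := by
  classical
  have hind := (linearIndependent_monoidHom (Multiplicative (Fin (n + 1) → ℕ)) Kv).comp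
    (fun k : Fin (n + 1) → ℤ => character (extVec k)) fun k k' h =>
      extVec_injective (eq_of_character_eq h)
  rw [linearIndependent_iff'] at hind ⊢
  rintro s g hs ⟨⟨A, hA⟩, k⟩ hx
  have h1 := hind (s.image Prod.snd)
    (fun k => if (⟨⟨A, hA⟩, k⟩ : Xi0 n × (Fin (n + 1) → ℤ)) ∈ s then
      g ⟨⟨A, hA⟩, k⟩ * v ^ dotp 0 (extVec k) else 0) (by
      funext d
      obtain ⟨φ, hφ⟩ := exists_coefficient hA d.toAdd
      have h2 := congrArg φ hs
      rw [map_zero, map_sum] at h2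
      rw [Finset.sum_apply, Pi.zero_apply]
      refine Eq.trans ?_ h2
      symm
      rw [← Finset.sum_fiberwise_of_maps_to (g := Prod.snd) (t := s.image Prod.snd)
        fun x hx => Finset.mem_image_of_mem _ hx]
      refine Finset.sum_congr rfl fun k _ => ?_
      rw [Finset.sum_congr rfl fun x _ => by rw [map_smul, hφ _ x.1.2 (extVec x.2)]]
      have h3 : ∀ x ∈ s.filter fun x => x.2 = k, x.1.1 = A →
          x = (⟨⟨A, hA⟩, k⟩ : Xi0 n × (Fin (n + 1) → ℤ)) := fun x hx h =>
        Prod.ext (Subtype.ext h) (Finset.mem_filter.1 hx).2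
      split_ifs with hmem
      · have h4 : (⟨⟨A, hA⟩, k⟩ : Xi0 n × (Fin (n + 1) → ℤ)) ∈ s.filter fun x => x.2 = k :=
          Finset.mem_filter.2 ⟨hmem, rfl⟩
        rw [Finset.sum_eq_single_of_mem _ h4, if_pos rfl]
        · change _ = (g _ * v ^ dotp 0 (extVec k)) * v ^ (dotp d.toAdd (extVec k) - dotp 0 (extVec k))
          rw [mul_assoc, ← zpow_add₀ v_ne_zero, add_sub_cancel, smul_eq_mul]
        · intro x hx hne
          rw [if_neg fun h => hne (h3 x hx h), smul_zero]
      · rw [zero_smul]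
        refine Finset.sum_eq_zero fun x hx => ?_
        rw [if_neg, smul_zero]
        intro h
        apply hmem
        rw [← h3 x hx h]
        exact (Finset.mem_filter.1 hx).1) k (Finset.mem_image.2 ⟨_, hx, rfl⟩)
  rw [if_pos hx] at h1
  exact (mul_eq_zero.1 h1).resolve_right (zpow_ne_zero _ v_ne_zero)

/-! ### Generation -/

theorem Eth_diag {n : ℕ} {x p : Fin (2 * n + 1)} (h : x ≠ p) (a : Fin (2 * n + 1)) :
    Eth x p a a = 0 := by
  rw [Eth_apply, if_neg fun h' => h (h'.1.trans h'.2.symm),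
    if_neg fun h' => h (Fin.rev_injective (h'.1.trans h'.2.symm))]

theorem zero_mem_Xi0 (n : ℕ) : (0 : Mat n) ∈ Xi0 n := ⟨fun _ _ => rfl, fun _ => rfl⟩

theorem add_Eth_mem_Xi0 {n : ℕ} {A : Mat n} (hA : A ∈ Xi0 n) {x p : Fin (2 * n + 1)} (h : x ≠ p) :
    A + Eth x p ∈ Xi0 n := by
  constructor
  · intro i j
    rw [Matrix.add_apply, Matrix.add_apply, hA.1, Eth_rev_apply]
  · intro i
    rw [Matrix.add_apply, hA.2, Eth_diag h]

theorem sub_Eth_mem_Xi0 {n : ℕ} {A : Mat n} (hA : A ∈ Xi0 n) (x p : Fin (2 * n + 1)) :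
    A - Eth x p ∈ Xi0 n := by
  constructor
  · intro i j
    rw [Matrix.sub_apply, Matrix.sub_apply, hA.1, Eth_rev_apply]
  · intro i
    rw [Matrix.sub_apply, hA.2, Nat.zero_sub]

theorem Eth_mem_Xi0 {n : ℕ} {x p : Fin (2 * n + 1)} (h : x ≠ p) : Eth x p ∈ Xi0 n := by
  have := add_Eth_mem_Xi0 (zero_mem_Xi0 n) h
  rwa [zero_add] at this

theorem eth_succ_mem_gens {n : ℕ} (i : Fin (2 * n)) :
    elt (Eth i.succ i.castSucc) 0 ∈ gens n := by
  have hlt := i.isLt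
  by_cases h : i.val < n
  · exact Or.inl ⟨⟨i.val, h⟩, Or.inr rfl⟩
  · refine Or.inl ⟨⟨2 * n - 1 - i.val, by omega⟩, Or.inl ?_⟩
    rw [← Eth_rev]
    congr 2
    · ext
      simp only [lo, Fin.val_rev, Fin.val_succ]
      omega
    · ext
      simp only [hi, Fin.val_rev, Fin.val_castSucc]
      omega

theorem rowDot_zero {n : ℕ} (j : Fin (2 * n + 1) → ℤ) : rowDot (0 : Mat n) j = 0 := by
  simp [rowDot]

theorem elt_zero_mul {n : ℕ} (j j' : Fin (2 * n + 1) → ℤ) :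
    elt (0 : Mat n) j * elt 0 j' = elt 0 (j + j') := by
  rw [(multFormulas_elt n).zero_mul 0 (zero_mem_Xi0 n), rowDot_zero, zpow_zero, one_smul]

theorem elt_zero_mem {n : ℕ} {S : Subalgebra Kv (SchurProd n)} (hS : gens n ⊆ S)
    (j : Fin (2 * n + 1) → ℤ) : elt 0 j ∈ S := by
  let H : AddSubgroup (Fin (2 * n + 1) → ℤ) :=
    { carrier := {j | elt 0 j ∈ S ∧ elt 0 (-j) ∈ S}
      zero_mem' := by
        have : elt (0 : Mat n) 0 = 1 := (multFormulas_elt n).one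
        simp only [Set.mem_ofPred_eq, neg_zero, this]
        exact ⟨S.one_mem, S.one_mem⟩
      add_mem' := by
        rintro a b ⟨h1, h2⟩ ⟨h3, h4⟩
        refine ⟨?_, ?_⟩
        · rw [← elt_zero_mul]
          exact S.mul_mem h1 h3
        · rw [neg_add, ← elt_zero_mul]
          exact S.mul_mem h2 h4
      neg_mem' := by
        rintro a ⟨h1, h2⟩
        exact ⟨h2, by rwa [neg_neg]⟩ }
  have h1 : ∀ c, unitVec (idx c) ∈ H := fun c =>
    ⟨hS (Or.inr ⟨c, Or.inl rfl⟩), hS (Or.inr ⟨c, Or.inr rfl⟩)⟩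
  have h2 : ∀ a : Fin (2 * n + 1), unitVec a.rev ∈ H → unitVec a ∈ H := by
    rintro a ⟨h3, h4⟩
    have hu : ∀ i, unitVec a i = unitVec a.rev i.rev := by
      intro i
      simp only [unitVec, Pi.single_apply, Fin.rev_inj]
    have hu' : ∀ i, unitVec a i.rev = unitVec a.rev i := by
      intro i
      rw [hu, Fin.rev_rev]
    refine ⟨?_, ?_⟩
    · rwa [elt_symm 0 (j' := unitVec a.rev)]
      intro i
      rw [hu, hu', add_comm]
    · rwa [elt_symm 0 (j' := -unitVec a.rev)]
      intro i
      rw [Pi.neg_apply, Pi.neg_apply, Pi.neg_apply, Pi.neg_apply, hu, hu', add_comm]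
  have h3 : ∀ a : Fin (2 * n + 1), unitVec a ∈ H := by
    intro a
    have ha := a.isLt
    by_cases h : a.val < n + 1
    · exact h1 ⟨a.val, h⟩
    · apply h2
      have := h1 ⟨a.rev.val, by rw [Fin.val_rev]; omega⟩
      exact this
  have h4 : j = ∑ a, j a • unitVec a := by
    funext i
    simp [unitVec, Finset.sum_apply, Pi.single_apply]
  have h5 : j ∈ H := by
    rw [h4]
    exact H.sum_mem fun a _ => H.zsmul_mem (h3 a) (j a)
  exact h5.1

/-- The sum of the squared distances of the letters from the diagonal. -/
def wt {n : ℕ} (A : Mat n) : ℤ := ∑ a, ∑ b, (A a b : ℤ) * ((a.val : ℤ) - b.val) ^ 2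

theorem wt_nonneg {n : ℕ} (A : Mat n) : 0 ≤ wt A :=
  Finset.sum_nonneg fun _ _ => Finset.sum_nonneg fun _ _ => by positivity

theorem wt_add {n : ℕ} (A B : Mat n) : wt (A + B) = wt A + wt B := by
  simp only [wt, Matrix.add_apply, Nat.cast_add, add_mul, Finset.sum_add_distrib]

theorem wt_Eth {n : ℕ} (x p : Fin (2 * n + 1)) : wt (Eth x p) = 2 * ((x.val : ℤ) - p.val) ^ 2 := by
  have h : ∀ c d : Fin (2 * n + 1), ∑ a : Fin (2 * n + 1), ∑ b : Fin (2 * n + 1),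
      (if c = a ∧ d = b then 1 else 0) * ((a.val : ℤ) - b.val) ^ 2 =
        ((c.val : ℤ) - d.val) ^ 2 := by
    intro c d
    rw [Finset.sum_eq_single c, Finset.sum_eq_single d] <;> simp +contextual [eq_comm]
  have hx := x.isLt
  have hp := p.isLt
  simp only [wt, Eth_apply, Nat.cast_add, add_mul, Finset.sum_add_distrib, Nat.cast_ite,
    Nat.cast_one, Nat.cast_zero, h, Fin.val_rev]
  rw [Nat.cast_sub (by omega), Nat.cast_sub (by omega)]
  push_cast
  ring

theorem wt_sub_Eth {n : ℕ} {A : Mat n} (hA : A ∈ Xi0 n) {x p : Fin (2 * n + 1)} (hp : p ≠ x)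
    (h : 1 ≤ A x p) : wt (A - Eth x p) = wt A - 2 * ((x.val : ℤ) - p.val) ^ 2 := by
  have h1 := wt_add (A - Eth x p) (Eth x p)
  have h2 : A - Eth x p + Eth x p = A := by
    ext a b
    have := Eth_le hA.1 hp h a b
    simp only [Matrix.sub_apply, Matrix.add_apply]
    omega
  rw [h2, wt_Eth] at h1
  linarith

theorem wt_move {n : ℕ} {A : Mat n} (hA : A ∈ Xi0 n) {x p : Fin (2 * n + 1)} (hp : p ≠ x)
    (h : 1 ≤ A x p) (y : Fin (2 * n + 1)) : wt (A + Eth y p - Eth x p) =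
      wt A + 2 * ((y.val : ℤ) - p.val) ^ 2 - 2 * ((x.val : ℤ) - p.val) ^ 2 := by
  have h1 := wt_add (A + Eth y p - Eth x p) (Eth x p)
  have h2 : A + Eth y p - Eth x p + Eth x p = A + Eth y p := by
    ext a b
    have := Eth_le hA.1 hp h a b
    simp only [Matrix.sub_apply, Matrix.add_apply]
    omega
  rw [h2, wt_add, wt_Eth, wt_Eth] at h1
  linarith

theorem qbar_succ_ne_zero (m : ℕ) : qbar (m + 1) ≠ 0 := by
  unfold qbar
  refine div_ne_zero (sub_ne_zero.2 (v_zpow_ne_one ?_)) (sub_ne_zero.2 (v_zpow_ne_one (by norm_num)))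
  push_cast
  omega

/-- Let `(i + 1, p)` be a letter of `A` below the diagonal, in the first column that has one, and
let `A₁` be `A` with this letter moved back to row `i` (or removed, if `p = i`). In the product of
the generator that moves letters from row `i` to row `i + 1` with `A₁(j)`, the term of `A(j)`
occurs with a nonzero coefficient, and all others have smaller weight: letters `p' < p` of row `i`
would lie below the diagonal in an earlier column, and the letters `p' > p` gain less weight than
`p`. -/
theorem elt_mem_of_lower {n : ℕ} {S : Subalgebra Kv (SchurProd n)} (hS : gens n ⊆ S)
    {A : Mat n} (hA : A ∈ Xi0 n) (ih : ∀ C ∈ Xi0 n, wt C < wt A → ∀ j, elt C j ∈ S)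
    (hne : A ≠ 0) (j : Fin (2 * n + 1) → ℤ) : elt A j ∈ S := by
  classical
  -- A letter below the diagonal, in the first column that has one.
  have hex : ∃ p x, p < x ∧ 1 ≤ A x p := by
    by_contra! h
    apply hne
    ext a b
    rw [Matrix.zero_apply]
    rcases lt_trichotomy a b with h1 | rfl | h1
    · have := h b.rev a.rev (Fin.rev_lt_rev.2 h1)
      rw [hA.1] at this
      omega
    · exact hA.2 a
    · have := h b a h1
      omega
  obtain ⟨p, ⟨x, hpx, hxp⟩, hmin⟩ := exists_minimal_of_wellFoundedLT
    (fun p => ∃ x, p < x ∧ 1 ≤ A x p) hex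
  have hmin : ∀ a b, b < a → b < p → A a b = 0 := by
    intro a b hab hbp
    by_contra h
    exact absurd (hmin ⟨a, hab, by omega⟩ hbp.le) (not_le.2 hbp)
  obtain ⟨i, rfl⟩ : ∃ i : Fin (2 * n), i.succ = x :=
    ⟨x.pred (Fin.ne_zero_of_lt hpx), Fin.succ_pred _ _⟩
  have hg := hS (eth_succ_mem_gens i)
  have hval : (i.succ.val : ℤ) = i.castSucc.val + 1 := by simp
  have hii := castSucc_ne_succ i
  have h3 : ∀ A₁ ∈ Xi0 n, wt A₁ < wt A → (if 1 ≤ A₁ i.castSucc i.succ then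
      (v ^ (gam A₁ i i.succ - j i.succ - j i.succ.rev - 1) / (1 - v ^ (-2 : ℤ))) •
        (v ^ (-midDelta i) • elt (A₁ - Eth i.castSucc i.succ)
            (j - (unitVec i.castSucc - unitVec i.succ))
          - v ^ midDelta i • elt (A₁ - Eth i.castSucc i.succ)
            (j + (-unitVec i.castSucc - unitVec i.succ))) else 0) ∈ S := by
    intro A₁ hA₁ hlt
    split_ifs with h
    · have hw := wt_sub_Eth hA₁ hii.symm h
      have hlt' : wt (A₁ - Eth i.castSucc i.succ) < wt A := by
        rw [hw]
        have := sq_nonneg ((i.castSucc.val : ℤ) - i.succ.val)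
        linarith
      have hmem := ih _ (sub_Eth_mem_Xi0 hA₁ _ _) hlt'
      exact S.smul_mem (S.sub_mem (S.smul_mem (hmem _) _) (S.smul_mem (hmem _) _)) _
    · exact S.zero_mem
  have h4 : ∀ A₁ ∈ Xi0 n, wt A₁ < wt A → (∑ p with i.succ < p ∧ 1 ≤ A₁ i.castSucc p,
      (v ^ gam A₁ i p * qbar (A₁ i.succ p + 1)) • elt (A₁ + Eth i.succ p - Eth i.castSucc p)
        (j - (unitVec i.castSucc - unitVec i.succ))) ∈ S := by
    intro A₁ hA₁ hlt
    refine S.sum_mem fun b hb => S.smul_mem (ih _ ?_ ?_ _) _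
    · exact sub_Eth_mem_Xi0 (add_Eth_mem_Xi0 hA₁ (Finset.mem_filter.1 hb).2.1.ne) _ _
    · obtain ⟨h5, h6⟩ := (Finset.mem_filter.1 hb).2
      rw [wt_move hA₁ (Fin.castSucc_lt_succ.trans h5).ne' h6, hval]
      have : (i.succ.val : ℤ) < b.val := by exact_mod_cast h5
      nlinarith
  rcases (Fin.le_castSucc_iff.2 hpx).lt_or_eq with hp | rfl
  · set A₁ := A + Eth i.castSucc p - Eth i.succ p with hA₁
    have hp' : (p.val : ℤ) + 1 ≤ i.castSucc.val := by exact_mod_cast hp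
    have hA₁m : A₁ ∈ Xi0 n := sub_Eth_mem_Xi0 (add_Eth_mem_Xi0 hA hp.ne') _ _
    have hwt : wt A₁ = wt A - 2 * (2 * (i.castSucc.val - p.val) + 1) := by
      rw [hA₁, wt_move hA hpx.ne hxp, hval]
      ring
    have hback : A₁ + Eth i.succ p - Eth i.castSucc p = A := by
      ext a b
      have := Eth_le hA.1 hpx.ne hxp a b
      simp only [hA₁, Matrix.sub_apply, Matrix.add_apply]
      omega
    have hlt : wt A₁ < wt A := by linarith
    -- Row `i` of `A₁` differs from row `i` of `A` only by the letter that was moved back.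
    have hent : ∀ b, A₁ i.castSucc b = A i.castSucc b + Eth i.castSucc p i.castSucc b := by
      intro b
      rw [hA₁, Matrix.sub_apply, Matrix.add_apply, Eth_succ_castSucc_row, Nat.sub_zero]
    have hmem := S.mul_mem hg (ih A₁ hA₁m hlt j)
    have hpm : p ∈ Finset.univ.filter fun b => b < i.castSucc ∧ 1 ≤ A₁ i.castSucc b := by
      rw [Finset.mem_filter, hent, Eth_apply, if_pos ⟨rfl, rfl⟩]
      exact ⟨Finset.mem_univ _, hp, by omega⟩
    rw [gen_mul_elt i hA₁m j, add_mem_cancel_right (h4 A₁ hA₁m hlt),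
      add_mem_cancel_right (h3 A₁ hA₁m hlt), add_mem_cancel_right,
      ← Finset.add_sum_erase _ _ hpm, add_mem_cancel_right, hback] at hmem
    · have h5 := S.smul_mem hmem (v ^ gam A₁ i p * qbar (A₁ i.succ p + 1))⁻¹
      rwa [smul_smul, inv_mul_cancel₀
        (mul_ne_zero (zpow_ne_zero _ v_ne_zero) (qbar_succ_ne_zero _)), one_smul] at h5
    · refine S.sum_mem fun b hb => S.smul_mem (ih _ ?_ ?_ _) _
      · have := (Finset.mem_filter.1 (Finset.mem_of_mem_erase hb)).2.1
        exact sub_Eth_mem_Xi0 (add_Eth_mem_Xi0 hA₁m (this.trans Fin.castSucc_lt_succ).ne') _ _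
      · obtain ⟨h5, h6⟩ := (Finset.mem_filter.1 (Finset.mem_of_mem_erase hb)).2
        have hbp : p < b := by
          refine lt_of_le_of_ne (not_lt.1 fun hbp => ?_) (Finset.ne_of_mem_erase hb).symm
          rw [hent, hmin _ _ h5 hbp, Eth_apply, if_neg fun h => hbp.ne' h.2, if_neg] at h6
          · omega
          · rintro ⟨h7, h8⟩
            have h7 := rev_eq_self.1 h7
            have h9 : p.rev < i.castSucc := h8 ▸ h5
            simp only [Fin.lt_def, Fin.val_rev, Fin.ext_iff, ctr] at h7 h9 hp
            omega
        rw [wt_move hA₁m h5.ne h6, hwt, hval]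
        have h7 : (p.val : ℤ) < b.val := by exact_mod_cast hbp
        nlinarith
    · refine S.smul_mem (ih _ (add_Eth_mem_Xi0 hA₁m hii.symm) ?_ _) _
      rw [wt_add, wt_Eth, hwt, hval]
      nlinarith
  · set A₁ := A - Eth i.succ i.castSucc with hA₁
    have hA₁m : A₁ ∈ Xi0 n := sub_Eth_mem_Xi0 hA _ _
    have hwt : wt A₁ = wt A - 2 := by
      rw [hA₁, wt_sub_Eth hA hii hxp, hval]
      ring
    have hback : A₁ + Eth i.succ i.castSucc = A := by
      ext a b
      have := Eth_le hA.1 hii hxp a b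
      simp only [hA₁, Matrix.sub_apply, Matrix.add_apply]
      omega
    have hlt : wt A₁ < wt A := by linarith
    have hmem := S.mul_mem hg (ih A₁ hA₁m hlt j)
    rw [gen_mul_elt i hA₁m j, add_mem_cancel_right (h4 A₁ hA₁m hlt),
      add_mem_cancel_right (h3 A₁ hA₁m hlt), add_mem_cancel_left, hback] at hmem
    · have h5 := S.smul_mem hmem (v ^ (gam A₁ i i.castSucc + j i.castSucc + j i.castSucc.rev) *
        qbar (A₁ i.succ i.castSucc + 1))⁻¹
      rwa [smul_smul, inv_mul_cancel₀
        (mul_ne_zero (zpow_ne_zero _ v_ne_zero) (qbar_succ_ne_zero _)), one_smul] at h5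
    · refine S.sum_mem fun b hb => absurd (Finset.mem_filter.1 hb).2.2 ?_
      have := (Finset.mem_filter.1 hb).2.1
      rw [hA₁, Matrix.sub_apply, hmin _ _ this this]
      omega

/-- Induction on the weight. -/
theorem elt_mem_of_gens_subset {n : ℕ} {S : Subalgebra Kv (SchurProd n)} (hS : gens n ⊆ S)
    {A : Mat n} (hA : A ∈ Xi0 n) (j : Fin (2 * n + 1) → ℤ) : elt A j ∈ S := by
  obtain ⟨k, hk⟩ : ∃ k, (wt A).toNat = k := ⟨_, rfl⟩
  induction k using Nat.strong_induction_on generalizing A j with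
  | _ k ih =>
    by_cases hne : A = 0
    · rw [hne]
      exact elt_zero_mem hS j
    · refine elt_mem_of_lower hS hA (fun C hC hlt j' => ih _ ?_ hC j' rfl) hne j
      have := wt_nonneg C
      omega

/-! ### The algebra spanned by the elements `A(j)` and its presentation -/

theorem lo_lt_hi {n : ℕ} (h : Fin n) : lo h < hi h := Nat.lt_succ_self _

theorem elt_mem_spanA {n : ℕ} {A : Mat n} (hA : A ∈ Xi0 n) (j : Fin (2 * n + 1) → ℤ) :
    elt A j ∈ spanA n := Submodule.subset_span ⟨A, hA, j, rfl⟩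

theorem gens_mul_elt_mem {n : ℕ} {x : SchurProd n} (hx : x ∈ gens n) {A : Mat n} (hA : A ∈ Xi0 n)
    (j : Fin (2 * n + 1) → ℤ) : x * elt A j ∈ spanA n := by
  have hmove : ∀ (a b p : Fin (2 * n + 1)) (j : Fin (2 * n + 1) → ℤ), a ≠ p →
      elt (A + Eth a p - Eth b p) j ∈ spanA n := fun a b p j h =>
    elt_mem_spanA (sub_Eth_mem_Xi0 (add_Eth_mem_Xi0 hA h) _ _) j
  have hsub : ∀ (a b : Fin (2 * n + 1)) (j : Fin (2 * n + 1) → ℤ),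
      elt (A - Eth a b) j ∈ spanA n := fun a b j => elt_mem_spanA (sub_Eth_mem_Xi0 hA _ _) j
  have hadd : ∀ (a b : Fin (2 * n + 1)) (j : Fin (2 * n + 1) → ℤ), a ≠ b →
      elt (A + Eth a b) j ∈ spanA n := fun a b j h => elt_mem_spanA (add_Eth_mem_Xi0 hA h) j
  rcases hx with ⟨h, rfl | rfl⟩ | ⟨i, rfl | rfl⟩
  · rw [raise_elt hA]
    refine add_mem (add_mem (add_mem (sum_mem fun p hp => ?_) ?_) ?_) (sum_mem fun p hp => ?_)
    · exact Submodule.smul_mem _ _ (hmove _ _ _ _ (Finset.mem_filter.1 hp).2.1.ne')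
    · split_ifs
      · exact Submodule.smul_mem _ _ (sub_mem (hsub _ _ _) (hsub _ _ _))
      · exact zero_mem _
    · exact Submodule.smul_mem _ _ (hadd _ _ _ (lo_lt_hi h).ne)
    · exact Submodule.smul_mem _ _ (hmove _ _ _ _
        ((lo_lt_hi h).trans (Finset.mem_filter.1 hp).2.1).ne)
  · rw [lower_elt hA]
    refine add_mem (add_mem (add_mem (sum_mem fun p hp => ?_) ?_) ?_) (sum_mem fun p hp => ?_)
    · exact Submodule.smul_mem _ _ (hmove _ _ _ _
        ((Finset.mem_filter.1 hp).2.1.trans (lo_lt_hi h)).ne')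
    · exact Submodule.smul_mem _ _ (hadd _ _ _ (lo_lt_hi h).ne')
    · split_ifs
      · exact Submodule.smul_mem _ _ (sub_mem (Submodule.smul_mem _ _ (hsub _ _ _))
          (Submodule.smul_mem _ _ (hsub _ _ _)))
      · exact zero_mem _
    · exact Submodule.smul_mem _ _ (hmove _ _ _ _ (Finset.mem_filter.1 hp).2.1.ne)
  · rw [(multFormulas_elt n).zero_mul A hA]
    exact Submodule.smul_mem _ _ (elt_mem_spanA hA _)
  · rw [(multFormulas_elt n).zero_mul A hA]
    exact Submodule.smul_mem _ _ (elt_mem_spanA hA _)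

/-- The span is stable under left multiplication by the generators, by the multiplication formulas.
-/
theorem mul_mem_spanA {n : ℕ} {x : SchurProd n} (hx : x ∈ Algebra.adjoin Kv (gens n))
    {y : SchurProd n} (hy : y ∈ spanA n) : x * y ∈ spanA n := by
  induction hx using Algebra.adjoin_induction generalizing y with
  | mem x hx =>
    induction hy using Submodule.span_induction with
    | mem y hy =>
      obtain ⟨A, hA, j, rfl⟩ := hy
      exact gens_mul_elt_mem hx hA j
    | zero => rw [mul_zero]; exact zero_mem _
    | add y z _ _ h1 h2 => rw [mul_add]; exact add_mem h1 h2
    | smul c y _ h1 => rw [mul_smul_comm]; exact Submodule.smul_mem _ _ h1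
  | algebraMap c => rw [← Algebra.smul_def]; exact Submodule.smul_mem _ _ hy
  | add a b _ _ h1 h2 => rw [add_mul]; exact add_mem (h1 hy) (h2 hy)
  | mul a b _ _ h1 h2 => rw [mul_assoc]; exact h1 (h2 hy)

theorem toSubmodule_adjoin_gens (n : ℕ) :
    Subalgebra.toSubmodule (Algebra.adjoin Kv (gens n)) = spanA n := by
  apply le_antisymm
  · intro x hx
    have h1 : (1 : SchurProd n) ∈ spanA n := by
      rw [← (multFormulas_elt n).one]
      exact elt_mem_spanA (zero_mem_Xi0 n) 0
    have h2 := mul_mem_spanA hx h1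
    rwa [mul_one] at h2
  · refine Submodule.span_le.2 ?_
    rintro _ ⟨A, hA, j, rfl⟩
    exact elt_mem_of_gens_subset Algebra.subset_adjoin hA j

section Presentation

variable {n : ℕ} {B : Type*} [Ring B] [Algebra Kv B] {b : Mat n → (Fin (2 * n + 1) → ℤ) → B}

/-- By linear independence, the assignment `A(j) ↦ b(A, j)` extends to a linear map. -/
theorem MultFormulas.exists_linearMap (hb : MultFormulas n b) :
    ∃ F : SchurProd n →ₗ[Kv] B, ∀ A ∈ Xi0 n, ∀ j, F (elt A j) = b A j := by
  have hli := linearIndependent_elt n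
  obtain ⟨F, hF⟩ := LinearMap.exists_extend
    ((Module.Basis.span hli).constr Kv fun x : Xi0 n × (Fin (n + 1) → ℤ) => b x.1.1 (extVec x.2))
  refine ⟨F, fun A hA j => ?_⟩
  obtain ⟨k, hk⟩ := exists_extVec j
  rw [elt_symm A hk, hb.symm A hA _ _ hk]
  have h1 := LinearMap.congr_fun hF (Module.Basis.span hli (⟨A, hA⟩, k))
  rw [Module.Basis.constr_basis, LinearMap.comp_apply, Submodule.subtype_apply,
    Module.Basis.span_apply] at h1
  exact h1

/-- Both families satisfy the same formulas for the products with a generator. -/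
theorem MultFormulas.map_gens_mul_elt (hb : MultFormulas n b) {F : SchurProd n →ₗ[Kv] B}
    (hF : ∀ A ∈ Xi0 n, ∀ j, F (elt A j) = b A j) {x : SchurProd n} (hx : x ∈ gens n) {A : Mat n}
    (hA : A ∈ Xi0 n) (j : Fin (2 * n + 1) → ℤ) : F (x * elt A j) = F x * F (elt A j) := by
  have hmove : ∀ (a b' p : Fin (2 * n + 1)) (j : Fin (2 * n + 1) → ℤ), a ≠ p →
      F (elt (A + Eth a p - Eth b' p) j) = b (A + Eth a p - Eth b' p) j := fun a b p j h =>
    hF _ (sub_Eth_mem_Xi0 (add_Eth_mem_Xi0 hA h) _ _) j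
  have hsub : ∀ (a b' : Fin (2 * n + 1)) (j : Fin (2 * n + 1) → ℤ),
      F (elt (A - Eth a b') j) = b (A - Eth a b') j := fun a b j =>
    hF _ (sub_Eth_mem_Xi0 hA _ _) j
  rcases hx with ⟨h, rfl | rfl⟩ | ⟨i, rfl | rfl⟩
  · have h1 := lo_lt_hi h
    rw [raise_elt hA, hF A hA, hF _ (Eth_mem_Xi0 h1.ne), hb.raise A hA, map_add, map_add, map_add,
      map_sum, map_sum, map_smul, hF _ (add_Eth_mem_Xi0 hA h1.ne)]
    congr 1
    · congr 2
      · refine Finset.sum_congr rfl fun p hp => ?_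
        rw [map_smul, hmove _ _ _ _ (Finset.mem_filter.1 hp).2.1.ne']
      · split_ifs
        · rw [map_smul, map_sub, hsub, hsub]
        · exact map_zero F
    · refine Finset.sum_congr rfl fun p hp => ?_
      rw [map_smul, hmove _ _ _ _ (h1.trans (Finset.mem_filter.1 hp).2.1).ne]
  · have h1 := lo_lt_hi h
    rw [lower_elt hA, hF A hA, hF _ (Eth_mem_Xi0 h1.ne'), hb.lower A hA, map_add, map_add, map_add,
      map_sum, map_sum, map_smul, hF _ (add_Eth_mem_Xi0 hA h1.ne')]
    congr 1
    · congr 1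
      · congr 1
        refine Finset.sum_congr rfl fun p hp => ?_
        rw [map_smul, hmove _ _ _ _ ((Finset.mem_filter.1 hp).2.1.trans h1).ne']
      · split_ifs
        · rw [map_smul, map_sub, map_smul, map_smul, hsub, hsub]
        · exact map_zero F
    · refine Finset.sum_congr rfl fun p hp => ?_
      rw [map_smul, hmove _ _ _ _ (Finset.mem_filter.1 hp).2.1.ne]
  · rw [(multFormulas_elt n).zero_mul A hA, map_smul, hF A hA, hF _ hA, hF _ (zero_mem_Xi0 n),
      hb.zero_mul A hA]
  · rw [(multFormulas_elt n).zero_mul A hA, map_smul, hF A hA, hF _ hA, hF _ (zero_mem_Xi0 n),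
      hb.zero_mul A hA]

/-- The elements `x` with `F (x * y) = F x * F y` for all `y` form a subalgebra, so it suffices to
know this for the generators. -/
theorem MultFormulas.map_mul (hb : MultFormulas n b) {F : SchurProd n →ₗ[Kv] B}
    (hF : ∀ A ∈ Xi0 n, ∀ j, F (elt A j) = b A j) {x : SchurProd n}
    (hx : x ∈ Algebra.adjoin Kv (gens n)) {y : SchurProd n} (hy : y ∈ spanA n) :
    F (x * y) = F x * F y := by
  have hone : F 1 = 1 := by
    rw [← hb.one, ← hF 0 (zero_mem_Xi0 n) 0, (multFormulas_elt n).one]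
  induction hx using Algebra.adjoin_induction generalizing y with
  | mem x hx =>
    induction hy using Submodule.span_induction with
    | mem y hy =>
      obtain ⟨A, hA, j, rfl⟩ := hy
      exact hb.map_gens_mul_elt hF hx hA j
    | zero => rw [MulZeroClass.mul_zero, map_zero, MulZeroClass.mul_zero]
    | add y z _ _ h1 h2 => rw [mul_add, map_add, map_add, mul_add, h1, h2]
    | smul c y _ h1 => rw [mul_smul_comm, map_smul, map_smul, mul_smul_comm, h1]
  | algebraMap c =>
    rw [← Algebra.smul_def, map_smul, Algebra.algebraMap_eq_smul_one, map_smul, hone,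
      smul_mul_assoc, one_mul]
  | add a b _ _ h1 h2 => rw [add_mul, map_add, map_add, add_mul, h1 hy, h2 hy]
  | mul a c ha hc h1 h2 =>
    have hc' : c ∈ spanA n := by
      rw [← toSubmodule_adjoin_gens]
      exact hc
    rw [mul_assoc, h1 (mul_mem_spanA hc hy), h2 hy, h1 hc', mul_assoc]

theorem MultFormulas.existsUnique_algHom (hb : MultFormulas n b) :
    ∃! f : Algebra.adjoin Kv (gens n) →ₐ[Kv] B, ∀ A ∈ Xi0 n, ∀ (j : Fin (2 * n + 1) → ℤ)
      (x : Algebra.adjoin Kv (gens n)), (x : SchurProd n) = elt A j → f x = b A j := by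
  obtain ⟨F, hF⟩ := hb.exists_linearMap
  have hspan : ∀ x : Algebra.adjoin Kv (gens n), (x : SchurProd n) ∈ spanA n := by
    intro x
    rw [← toSubmodule_adjoin_gens]
    exact x.2
  have hone : F 1 = 1 := by
    rw [← hb.one, ← hF 0 (zero_mem_Xi0 n) 0, (multFormulas_elt n).one]
  refine ⟨AlgHom.ofLinearMap (F ∘ₗ (Algebra.adjoin Kv (gens n)).val.toLinearMap) hone
    fun x y => hb.map_mul hF x.2 (hspan y), ?_, ?_⟩
  · intro A hA j x hx
    change F x = _
    rw [hx, hF A hA]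
  · intro g hg
    -- Two homomorphisms with the prescribed values agree on the generators.
    refine AlgHom.adjoin_ext fun x hx => ?_
    change g _ = F x
    rcases id hx with ⟨h, rfl | rfl⟩ | ⟨i, rfl | rfl⟩
    · have hA := Eth_mem_Xi0 (lo_lt_hi h).ne
      rw [hg _ hA 0 _ rfl, hF _ hA]
    · have hA := Eth_mem_Xi0 (lo_lt_hi h).ne'
      rw [hg _ hA 0 _ rfl, hF _ hA]
    · rw [hg _ (zero_mem_Xi0 n) _ _ rfl, hF _ (zero_mem_Xi0 n)]
    · rw [hg _ (zero_mem_Xi0 n) _ _ rfl, hF _ (zero_mem_Xi0 n)]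

end Presentation

end TypeB

end

theorem mainTheorem4 (n : ℕ) :
    ∃ 𝔄 : Subalgebra TypeB.Kv (TypeB.SchurProd n),
      Subalgebra.toSubmodule 𝔄 = TypeB.spanA n ∧
      𝔄 = Algebra.adjoin TypeB.Kv (TypeB.gens n) ∧
      TypeB.MultFormulas n (TypeB.elt (n := n)) ∧
      ∀ (B : Type*) [Ring B] [Algebra TypeB.Kv B]
        (b : TypeB.Mat n → (Fin (2 * n + 1) → ℤ) → B), TypeB.MultFormulas n b →
        ∃! f : 𝔄 →ₐ[TypeB.Kv] B, ∀ A ∈ TypeB.Xi0 n, ∀ (j : Fin (2 * n + 1) → ℤ) (x : 𝔄),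
          (x : TypeB.SchurProd n) = TypeB.elt A j → f x = b A j :=
  ⟨Algebra.adjoin TypeB.Kv (TypeB.gens n), TypeB.toSubmodule_adjoin_gens n, rfl,
    TypeB.multFormulas_elt n, fun _ _ _ _ hb => hb.existsUnique_algHom⟩
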